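/- All graphs $G=(V,E)$ are finite, simple, connected and of minimum degree at least $2$; $m=|E|$. A \emph{threading} of $G$ is a closed walk $v_1,\dots,v_\ell,v_1$ in $G$ that visits every edge at least once, never traverses the same edge twice in (cyclic) sequence, and for which, at every vertex $v$, the \emph{junction graph} is connected: its vertices are the edges of $G$ incident to $v$, and two of them are joined whenever the walk visits $v$ immediately between traversing them. A \emph{turn} is an unordered pair of distinct edges with a common endpoint; turn costs are a function $\alpha$ from the set of turns to $\mathbb{R}_{\ge 0}$, and the turn cost $\alpha(W)$ of a closed walk $W$ is the sum of the costs of all (cyclically) consecutive pairs of edges of $W$. \textsc{Decision Threading} asks, given $(G,\alpha)$ and $c\ge 0$, whether $G$ has a threading $T$ with $\alpha(T)\le c$. As an input to a Turing machine, an instance has rational $\alpha$ and $c$, given as fractions of integers in binary; it is written as the string listing the number of vertices, $c$, the edges, and all turns with their costs. \textbf{Theorem.} (1) \textsc{Decision Threading} is in \textsc{NP}: the language of the encodings of its yes-instances has a polynomial-time verifier with certificates of polynomial length. (2) There is a constant $C$ such that for every such graph $G$, all real turn costs $\alpha\ge 0$ and every threading $T$ of $G$, one can obtain from $T$, by successively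 deleting cycles (each time the part of the closed walk between two traversals of the same edge in the same direction) so that each closed walk arising on the way is again a threading, a threading $T'$ with $\alpha(T')\le\alpha(T)$ that traverses each edge at most $C m^2$ times; in particular $T'$ has length at most $C m^3$. -/

import Mathlib

open scoped NNReal

namespace Threading

section Walks

variable {V : Type*}

/-- The cyclically consecutive pairs `(vᵢ, vᵢ₊₁)` of a sequence `v₁, …, v_ℓ`, including the closing
pair `(v_ℓ, v₁)`. -/
def cyclicPairs (T : List V) : List (V × V) :=
  T.zip (T.rotate 1)

/-- The cyclically consecutive triples `(vᵢ₋₁, vᵢ, vᵢ₊₁)` of a sequence `v₁, …, v_ℓ`, including the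
two triples `(v_{ℓ-1}, v_ℓ, v₁)` and `(v_ℓ, v₁, v₂)` that go around the end. -/
def cyclicTriples (T : List V) : List (V × V × V) :=
  T.zip ((T.rotate 1).zip (T.rotate 2))

/-- The edges traversed by the closed walk `v₁, …, v_ℓ, v₁`, with repetitions. -/
def walkEdges (T : List V) : List (Sym2 V) :=
  (cyclicPairs T).map fun p => s(p.1, p.2)

/-- The number of times the closed walk `T` traverses the edge `e` (in either direction). -/
def traversals [DecidableEq V] (T : List V) (e : Sym2 V) : ℕ :=
  (walkEdges T).count e

/-- The junction graph of the vertex `v` induced by the closed walk `T`. Its vertices are the edges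
of `G` incident to `v`; two of them are adjacent when `T` visits `v` immediately between traversing
them. (Parallel edges are not recorded: only connectedness of this graph is used.) -/
def junctionGraph (G : SimpleGraph V) (T : List V) (v : V) : SimpleGraph (G.incidenceSet v) :=
  SimpleGraph.fromRel fun e f =>
    ∃ a b : V, (a, v, b) ∈ cyclicTriples T ∧ e.1 = s(a, v) ∧ f.1 = s(v, b)

/-- The sequence of vertices `T = [v₁, …, v_ℓ]`, read as the closed walk `v₁, …, v_ℓ, v₁`, is a
threading of `G`. -/
structure IsThreading (G : SimpleGraph V) (T : List V) : Prop where
  closedWalk : ∀ p ∈ cyclicPairs T, G.Adj p.1 p.2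
  visitsEdges : ∀ e ∈ G.edgeSet, e ∈ walkEdges T
  noUTurn : ∀ t ∈ cyclicTriples T, s(t.1, t.2.1) ≠ s(t.2.1, t.2.2)
  junctionConnected : ∀ v : V, (junctionGraph G T v).Connected

/-- The turn cost of the closed walk `T`. A turn is an unordered pair of distinct edges with a
common endpoint; `α` is a function on all unordered pairs of unordered pairs, of which only the
values at the turns of the graph are used on a threading. -/
noncomputable def turnCost (α : Sym2 (Sym2 V) → ℝ≥0) (T : List V) : ℝ≥0 :=
  ((cyclicTriples T).map fun t => α s(s(t.1, t.2.1), s(t.2.1, t.2.2))).sum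

/-- The standing assumption on graphs: connected, with minimum degree at least two. -/
def Admissible (G : SimpleGraph V) : Prop :=
  G.Connected ∧ ∀ v : V, 2 ≤ (G.neighborSet v).ncard

/-- `T'` arises from the closed walk `T` by deleting one cycle: the part of `T` between two
traversals of the same edge `uv` in the same direction (closed walks may be rotated first). -/
def DeletesCycle (T T' : List V) : Prop :=
  ∃ (u v : V) (A B : List V), T.IsRotated (u :: v :: (A ++ u :: v :: B)) ∧ T' = u :: v :: B

/-- `T'` arises from `T` by deleting one cycle that is redundant: what remains is a threading. -/
def DeletesRedundantCycle (G : SimpleGraph V) (T T' : List V) : Prop :=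
  DeletesCycle T T' ∧ IsThreading G T'

end Walks

section Complexity

/-- A pair of strings, written one after the other over the disjoint union of the alphabets. -/
def encodePair {Γ Δ : Type} (p : List Γ × List Δ) : List (Γ ⊕ Δ) :=
  p.1.map Sum.inl ++ p.2.map Sum.inr

/-- The class NP: membership in `L` is the existence of a certificate of polynomial length, over
some finite alphabet, that is accepted by a verifier running in polynomial time on a (multi-stack)
Turing machine. -/
def InNP {Γ : Type} (L : Language Γ) : Prop :=
  ∃ (Δ : Type) (_ : Fintype Δ) (verify : List Γ × List Δ → Bool) (p : Polynomial ℕ),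
    Nonempty (Turing.TM2ComputableInPolyTime encodePair Computability.encodeBool verify) ∧
    ∀ x : List Γ, x ∈ L ↔ ∃ w : List Δ, w.length ≤ p.eval x.length ∧ verify (x, w) = true

end Complexity

section Problem

/-- An instance `(G, α, c)` of Decision Threading. So that an instance is a finite object, turn
costs and the bound `c` are nonnegative rationals, given as fractions of natural numbers. -/
structure ThreadingInstance where
  n : ℕ
  G : SimpleGraph (Fin n)
  [decAdj : DecidableRel G.Adj]
  admissible : Admissible G
  costNum : Sym2 (Sym2 (Fin n)) → ℕ
  costDen : Sym2 (Sym2 (Fin n)) → ℕ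
  costDen_pos : ∀ t, 0 < costDen t
  boundNum : ℕ
  boundDen : ℕ
  boundDen_pos : 0 < boundDen

namespace ThreadingInstance

attribute [instance] ThreadingInstance.decAdj

variable (I : ThreadingInstance)

/-- The turn costs of the instance. -/
noncomputable def cost (t : Sym2 (Sym2 (Fin I.n))) : ℝ≥0 :=
  (I.costNum t : ℝ≥0) / (I.costDen t : ℝ≥0)

/-- The bound `c` of the instance. -/
noncomputable def bound : ℝ≥0 :=
  (I.boundNum : ℝ≥0) / (I.boundDen : ℝ≥0)

/-- The answer to the instance is yes. -/
def IsYes : Prop :=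
  ∃ T : List (Fin I.n), IsThreading I.G T ∧ turnCost I.cost T ≤ I.bound

/-- The edges `uv` with `u < v`, in lexicographic order. -/
def edgeList : List (Fin I.n × Fin I.n) :=
  (List.finRange I.n ×ˢ List.finRange I.n).filter fun p => p.1 < p.2 ∧ I.G.Adj p.1 p.2

/-- The turns `{uv, vw}` with `u < w`, as triples `(u, v, w)` in lexicographic order. -/
def turnList : List (Fin I.n × Fin I.n × Fin I.n) :=
  (List.finRange I.n ×ˢ List.finRange I.n ×ˢ List.finRange I.n).filter fun t =>
    t.1 < t.2.2 ∧ I.G.Adj t.1 t.2.1 ∧ I.G.Adj t.2.1 t.2.2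

/-- The instance as a list of numbers: the number of vertices, the bound, the number of edges, the
edges by their endpoints, and all turns `{uv, vw}` as `u, v, w` followed by numerator and
denominator of the cost. -/
def toNats : List ℕ :=
  [I.n, I.boundNum, I.boundDen, I.edgeList.length]
    ++ I.edgeList.flatMap (fun p => [(p.1 : ℕ), (p.2 : ℕ)])
    ++ I.turnList.flatMap (fun t =>
        [(t.1 : ℕ), (t.2.1 : ℕ), (t.2.2 : ℕ),
          I.costNum s(s(t.1, t.2.1), s(t.2.1, t.2.2)),
          I.costDen s(s(t.1, t.2.1), s(t.2.1, t.2.2))])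

end ThreadingInstance

/-- A list of numbers as a string: each number in binary (least significant bit first), followed by
the separator `none`. -/
def encodeNats (l : List ℕ) : List (Option Bool) :=
  l.flatMap fun k => (Nat.bits k).map some ++ [none]

/-- The string that encodes an instance. -/
def ThreadingInstance.encode (I : ThreadingInstance) : List (Option Bool) :=
  encodeNats I.toNats

/-- Decision Threading, as the language of the encodings of its yes-instances. -/
def decisionThreading : Language (Option Bool) :=
  {x | ∃ I : ThreadingInstance, I.encode = x ∧ I.IsYes}

end Problem

end Threading

namespace Threading

/-! ### Cyclic sequences and their decomposition at a repeated directed edge. -/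

section Sequences

variable {V : Type*}

/-! Part (2). A spanning tree of the junction graph at `v` uses fewer than `deg v` passages
(consecutive triples through `v`), so at most `2m` passages witness that all junction graphs are
connected. Suppose that the directed edge `uv` is traversed more than `2m` times, and cut the walk
at these traversals. Every piece is itself a closed walk, and the passages of the walk are
distributed among the pieces (`cyclicTriples_joinSegments`). Hence some piece contains none of the
chosen passages and can be deleted: no new passage arises, so there is still no U-turn and the cost
does not grow; the junction graphs stay connected; and since degrees are at least two, connected
junction graphs force every edge to be visited. In the end each direction of an edge is used at most
`2m` times, so each edge at most `4m` times, which is stronger than the required quadratic bound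
(`IsThreading.exists_short`).

Part (1). By part (2) a yes-instance has a threading of polynomial length, which is the core of the
certificate. Instead of a Turing machine for the verification, the proof writes a formula:
`Ctx.Good` speaks about the input string, a guessed number `N` and a guessed string that stores
tables of numbers below `N`. Its quantifiers are bounded by `N`; its terms are built by addition,
multiplication and lookups in the input and the tables.

That such formulas define languages in NP is `inNP_of_fml`. A formula is compiled into a
nondeterministic program with unary counters and two tapes. A program is a regular language of
elementary actions, and the certificate is a run of it, written out action by action. The verifier,
a multi-stack machine, feeds the actions to a finite automaton while it executes them
(`simMachine_computes`, `inNP_of_isProgram`).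

Costs are binary and may be exponentially large, so they never occur as values of terms. All costs
are multiplied by a common denominator, and the resulting identities between integers are checked
digit by digit, with tables for partial products, partial sums and carries. The formula is sound by
`Ctx.Good.mem_decisionThreading`: the tables determine an instance whose encoding is the input, and
a threading in it. It is complete by `exists_good`. -/

theorem cyclicPairs_eq_map (T : List V) :
    cyclicPairs T = (cyclicTriples T).map fun t => (t.1, t.2.1) := by
  refine List.ext_getElem (by simp [cyclicPairs, cyclicTriples]) fun i h1 h2 => ?_
  simp [cyclicPairs, cyclicTriples]

theorem cyclicTriples_rotate (T : List V) (n : ℕ) :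
    cyclicTriples (T.rotate n) = (cyclicTriples T).rotate n := by
  have zip_rotate {α β : Type _} (l : List α) (l' : List β) (h : l.length = l'.length) :
      (l.zip l').rotate n = (l.rotate n).zip (l'.rotate n) :=
    List.zipWith_rotate_distrib _ _ _ _ h
  rw [cyclicTriples, cyclicTriples, zip_rotate _ _ (by simp), zip_rotate _ _ (by simp)]
  simp only [List.rotate_rotate, Nat.add_comm]

theorem cyclicPairs_rotate (T : List V) (n : ℕ) :
    cyclicPairs (T.rotate n) = (cyclicPairs T).rotate n := by
  rw [cyclicPairs_eq_map, cyclicPairs_eq_map, cyclicTriples_rotate, List.map_rotate]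

theorem cyclicTriples_perm {T T' : List V} (h : T.IsRotated T') :
    (cyclicTriples T').Perm (cyclicTriples T) := by
  obtain ⟨n, rfl⟩ := h
  rw [cyclicTriples_rotate]
  exact List.rotate_perm _ _

theorem cyclicPairs_perm {T T' : List V} (h : T.IsRotated T') :
    (cyclicPairs T').Perm (cyclicPairs T) := by
  obtain ⟨n, rfl⟩ := h
  rw [cyclicPairs_rotate]
  exact List.rotate_perm _ _

theorem mem_cyclicPairs_of_mem_cyclicTriples {T : List V} {a v b : V}
    (h : (a, v, b) ∈ cyclicTriples T) : (a, v) ∈ cyclicPairs T ∧ (v, b) ∈ cyclicPairs T := by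
  constructor
  · rw [cyclicPairs_eq_map]
    exact List.mem_map.2 ⟨_, h, rfl⟩
  · have h1 := (List.of_mem_zip h).2
    have e : cyclicPairs (T.rotate 1) = (T.rotate 1).zip (T.rotate 2) := by
      rw [cyclicPairs, List.rotate_rotate]
    rw [← e] at h1
    exact (cyclicPairs_perm ⟨1, rfl⟩).mem_iff.1 h1

/-- The consecutive triples of a sequence. -/
def linearTriples (l : List V) : List (V × V × V) := l.zip (l.tail.zip l.tail.tail)

/-- The two factors overlap in the two letters `u, v`. A triple that starts in `l` ends at `v` at
the latest, and all others start at `u` or later, so each triple is counted exactly once. -/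
theorem linearTriples_append (l m : List V) (u v : V) :
    linearTriples (l ++ u :: v :: m) = linearTriples (l ++ [u, v]) ++ linearTriples (u :: v :: m) := by
  induction l with
  | nil => simp [linearTriples]
  | cons a l ih =>
    have key (x : List V) : linearTriples (a :: (l ++ u :: v :: x)) =
        (a, (l ++ [u]).head (by simp), (l ++ [u, v]).tail.head (by cases l <;> simp)) ::
          linearTriples (l ++ u :: v :: x) := by
      rcases l with _ | ⟨b, _ | ⟨c, l⟩⟩ <;> simp [linearTriples]
    rw [List.cons_append, key m, ih, List.cons_append, key []]
    rfl

/-- Repeating the first two letters at the end unrolls the cycle. -/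
theorem cyclicTriples_cons_cons (u v : V) (A : List V) :
    cyclicTriples (u :: v :: A) = linearTriples (u :: v :: A ++ [u, v]) := by
  refine List.ext_getElem (by simp [cyclicTriples, linearTriples]) fun i h1 h2 => ?_
  have e1 : (u :: v :: A).rotate 1 = v :: A ++ [u] := by simp
  have e2 : (u :: v :: A).rotate 2 = A ++ [u, v] := by
    rw [show 2 = 1 + 1 from rfl, ← List.rotate_rotate, e1]; simp
  have hi : i < A.length + 2 := by simp [cyclicTriples] at h1; omega
  simp only [cyclicTriples, linearTriples, e1, e2, List.getElem_zip, List.tail_cons,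
    List.cons_append]
  have a1 : (u :: v :: (A ++ [u, v]))[i]'(by simp; omega) = (u :: v :: A)[i]'(by simp; omega) :=
    List.getElem_append_left (as := u :: v :: A) (by simp; omega)
  have a2 : (v :: (A ++ [u, v]))[i]'(by simp; omega) = (v :: (A ++ [u]))[i]'(by simp; omega) := by
    have := List.getElem_append_left (as := v :: A ++ [u]) (bs := [v]) (i := i)
      (h' := by simp; omega) (by simp; omega)
    simpa using this
  rw [a1, a2]

/-- The concatenation of cyclic sequences that all start with `u, v`. -/
def joinSegments (u v : V) (S : List (List V)) : List V := S.flatMap fun A => u :: v :: A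

/-- Whatever segment comes next, it starts with `u, v`, and these are also the letters that close
the present segment up to a cycle. So cutting into closed pieces neither creates nor destroys a
passage. -/
theorem cyclicTriples_joinSegments (u v : V) (S : List (List V)) :
    cyclicTriples (joinSegments u v S) = S.flatMap fun A => cyclicTriples (u :: v :: A) := by
  cases S with
  | nil => rfl
  | cons A S =>
    have e : joinSegments u v (A :: S) = u :: v :: (A ++ joinSegments u v S) := by
      simp [joinSegments]
    rw [e, cyclicTriples_cons_cons, List.flatMap_cons, cyclicTriples_cons_cons]
    have e2 : u :: v :: (A ++ joinSegments u v S) ++ [u, v] =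
      (u :: v :: A) ++ (joinSegments u v S ++ [u, v]) := by simp
    rw [e2]
    clear e e2
    -- The induction needs an arbitrary first segment, since in each step the next segment takes
    -- over this role.
    generalize u :: v :: A = A'
    induction S generalizing A' with
    | nil => simp [joinSegments]
    | cons B S ih =>
      have e : joinSegments u v (B :: S) ++ [u, v] =
          u :: v :: (B ++ (joinSegments u v S ++ [u, v])) := by
        simp [joinSegments]
      have e' : u :: v :: (B ++ (joinSegments u v S ++ [u, v])) =
        (u :: v :: B) ++ (joinSegments u v S ++ [u, v]) := by simp
      rw [e, linearTriples_append, e', ih, List.flatMap_cons, cyclicTriples_cons_cons]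

variable [DecidableEq V]

/-- Reading from the right, a new segment is opened at every occurrence of `u, v`; `A` is what
precedes the first one. Because `u ≠ v`, occurrences do not overlap. -/
theorem exists_joinSegments_eq {u v : V} (huv : u ≠ v) (l : List V) :
    ∃ A S, l = A ++ joinSegments u v S ∧ (l.zip l.tail).count (u, v) ≤ S.length := by
  induction l with
  | nil => exact ⟨[], [], rfl, by simp⟩
  | cons a l ih =>
    obtain ⟨A, S, rfl, hc⟩ := ih
    by_cases h : a = u ∧ ∃ B, A = v :: B
    · obtain ⟨rfl, B, rfl⟩ := h
      refine ⟨[], B :: S, by simp [joinSegments], ?_⟩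
      simp only [List.cons_append, List.tail_cons, List.zip_cons_cons, List.count_cons_self,
        List.length_cons] at hc ⊢
      omega
    · refine ⟨a :: A, S, rfl, ?_⟩
      refine le_trans (le_of_eq ?_) hc
      rw [List.tail_cons]
      rcases A with _ | ⟨b, A⟩
      · rcases S with _ | ⟨B, S⟩
        · simp [joinSegments]
        · simp only [joinSegments, List.flatMap_cons, List.cons_append, List.nil_append,
            List.zip_cons_cons, List.tail_cons]
          rw [List.count_cons_of_ne (by simp [huv])]
      · simp only [List.cons_append, List.zip_cons_cons, List.tail_cons]
        rw [List.count_cons_of_ne]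
        rintro e
        simp only [Prod.mk.injEq] at e
        exact h ⟨e.1, A, by rw [e.2]⟩

/-- A closed walk that traverses `uv` splits into segments that begin with a traversal of `uv`. -/
theorem exists_isRotated_joinSegments {u v : V} (huv : u ≠ v) (T : List V)
    (h : (u, v) ∈ cyclicPairs T) :
    ∃ S, T.IsRotated (joinSegments u v S) ∧ (cyclicPairs T).count (u, v) ≤ S.length := by
  obtain ⟨A, hA⟩ : ∃ A, T.IsRotated (u :: v :: A) := by
    obtain ⟨i, hi, e⟩ := List.getElem_of_mem h
    have hi' : i < T.length := by simpa [cyclicPairs] using hi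
    simp only [cyclicPairs, List.getElem_zip, List.getElem_rotate, Prod.mk.injEq] at e
    have hl : 2 ≤ T.length := by
      by_contra hl
      have h1 : T.length = 1 := by omega
      have : i = 0 := by omega
      subst this
      exact huv (by rw [← e.1, ← e.2]; simp [h1])
    refine ⟨(T.rotate i).tail.tail, i, ?_⟩
    have hl' : (T.rotate i).length = T.length := by simp
    have e1 : (T.rotate i)[0]'(by omega) = u := by
      rw [List.getElem_rotate, ← e.1]; simp [Nat.mod_eq_of_lt hi']
    have e2 : (T.rotate i)[1]'(by omega) = v := by
      rw [List.getElem_rotate, ← e.2]; simp [Nat.add_comm]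
    rcases hT : T.rotate i with _ | ⟨a, _ | ⟨b, B⟩⟩
    · rw [hT] at hl'; simp at hl'; omega
    · rw [hT] at hl'; simp at hl'; omega
    · simp only [hT] at e1 e2
      simp at e1 e2
      simp [e1, e2]
  obtain ⟨B, S, rfl, hS⟩ := exists_joinSegments_eq huv A
  refine ⟨B :: S, by simpa [joinSegments] using hA, ?_⟩
  rw [← (cyclicPairs_perm hA).count_eq]
  generalize joinSegments u v S = C at *
  generalize hD : B ++ C = D at *
  have e : cyclicPairs (u :: v :: D) = (u, v) :: ((v :: D).zip (D ++ [u])) := by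
    simp [cyclicPairs]
  rw [e, List.count_cons_self, List.length_cons]
  -- The pair in front is counted by the segment `B`. Neither the pair that starts with `v` nor the
  -- closing pair, which ends in `u`, is `(u, v)`, so all other occurrences lie inside `D`.
  refine Nat.succ_le_succ (le_trans (le_of_eq ?_) hS)
  rcases D with _ | ⟨d, D⟩
  · simp [huv.symm]
  · simp only [List.cons_append, List.zip_cons_cons, List.tail_cons]
    rw [List.count_cons_of_ne (by simp [huv.symm])]
    clear e hD hS hA
    induction D generalizing d with
    | nil =>
      rw [List.nil_append, List.zip_cons_cons, List.count_cons_of_ne (by grind)]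
      simp
    | cons d' D ih => simp only [List.cons_append, List.zip_cons_cons, List.count_cons, ih]

end Sequences

/-! ### Deletion of redundant cycles. -/

section Threadings

variable {V : Type*} {G : SimpleGraph V}

theorem Admissible.two_le_card_incidenceSet [Finite V] (hG : Admissible G) (v : V) :
    2 ≤ (G.incidenceSet v).ncard := by
  refine (hG.2 v).trans ?_
  refine Set.ncard_le_ncard_of_injOn (fun w => s(v, w)) (fun w hw => ?_) ?_ (Set.toFinite _)
  · exact ⟨hw, Sym2.mem_mk_left _ _⟩
  · intro w _ w' _ h
    exact Sym2.congr_right.1 h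

/-- In a graph of minimum degree at least two, a closed walk with connected junction graphs visits
all edges. -/
theorem Admissible.visitsEdges [Finite V] (hG : Admissible G) {T : List V}
    (h : ∀ v, (junctionGraph G T v).Connected) {e : Sym2 V} (he : e ∈ G.edgeSet) :
    e ∈ walkEdges T := by
  induction e with | h u v =>
  have hu : s(u, v) ∈ G.incidenceSet u := ⟨he, Sym2.mem_mk_left _ _⟩
  have : Nontrivial (G.incidenceSet u) := by
    rw [Set.nontrivial_coe_sort, ← Set.one_lt_ncard_iff_nontrivial]
    exact hG.two_le_card_incidenceSet u
  -- A connected graph on at least two vertices has no isolated vertex, so the edge takes part in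
  -- some passage through `u`.
  obtain ⟨f, -, hf⟩ := (h u).preconnected.exists_adj_of_nontrivial ⟨_, hu⟩
  rcases hf with ⟨a, b, ht, h1, h2⟩ | ⟨a, b, ht, h1, h2⟩
  · simp only at h1
    rw [h1]
    exact List.mem_map.2 ⟨_, (mem_cyclicPairs_of_mem_cyclicTriples ht).1, rfl⟩
  · simp only at h2
    rw [h2]
    exact List.mem_map.2 ⟨_, (mem_cyclicPairs_of_mem_cyclicTriples ht).2, rfl⟩

theorem walkEdges_mem_edgeSet {T : List V} (hT : IsThreading G T) {e : Sym2 V}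
    (he : e ∈ walkEdges T) : e ∈ G.edgeSet := by
  obtain ⟨p, hp, rfl⟩ := List.mem_map.1 he
  exact hT.closedWalk p hp

theorem traversals_le [DecidableEq V] (T : List V) (u v : V) :
    traversals T s(u, v) ≤ (cyclicPairs T).count (u, v) + (cyclicPairs T).count (v, u) := by
  rw [traversals, walkEdges]
  induction cyclicPairs T with
  | nil => simp
  | cons p l ih =>
    simp only [List.map_cons, List.count_cons, beq_iff_eq]
    have : s(p.1, p.2) = s(u, v) ↔ p = (u, v) ∨ p = (v, u) := by
      rw [Sym2.eq_iff, Prod.ext_iff, Prod.ext_iff]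
    by_cases h1 : p = (u, v)
    · simp [h1]; omega
    · by_cases h2 : p = (v, u)
      · simp [h2]; omega
      · simp [this, h1, h2]; omega

variable [Fintype V]

/-- Connectedness of the junction graph of `v` is witnessed by at most `deg v` passages. -/
theorem exists_passages_at [DecidableEq V] [DecidableRel G.Adj] {T : List V} {v : V}
    (h : (junctionGraph G T v).Connected) :
    ∃ F : Finset (V × V × V), F.card ≤ G.degree v ∧ (∀ t ∈ F, t ∈ cyclicTriples T) ∧
      ∀ T' : List V, (∀ t ∈ F, t ∈ cyclicTriples T') → (junctionGraph G T' v).Connected := by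
  classical
  -- One passage is chosen for every edge of a spanning tree. The tree then lies in the junction
  -- graph of every walk that has these passages.
  obtain ⟨H, hH, hTree⟩ := h.exists_isTree_le
  have key : ∀ q ∈ H.edgeSet, ∃ t ∈ cyclicTriples T, t.2.1 = v ∧
      q.map Subtype.val = s(s(t.1, v), s(v, t.2.2)) := by
    intro q hq
    induction q with | h e f =>
    rw [Sym2.map_mk]
    rcases (hH hq).2 with ⟨a, b, ht, h1, h2⟩ | ⟨a, b, ht, h1, h2⟩
    · exact ⟨_, ht, rfl, Sym2.eq_iff.2 (Or.inl ⟨h1, h2⟩)⟩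
    · exact ⟨_, ht, rfl, Sym2.eq_iff.2 (Or.inr ⟨h2, h1⟩)⟩
  have : Nonempty (V × V × V) := ⟨(v, v, v)⟩
  choose! g hg using key
  refine ⟨H.edgeFinset.image g, ?_, ?_, ?_⟩
  · refine Finset.card_image_le.trans ?_
    have h1 := hTree.card_edgeFinset
    have h2 : Fintype.card (G.incidenceSet v) = G.degree v := by
      rw [← G.card_incidenceFinset_eq_degree v, SimpleGraph.incidenceFinset, Set.toFinset_card]
    omega
  · intro t ht
    obtain ⟨q, hq, rfl⟩ := Finset.mem_image.1 ht
    exact (hg q (SimpleGraph.mem_edgeFinset.1 hq)).1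
  · intro T' hT'
    refine hTree.connected.mono fun e f hef => ⟨hef.ne, ?_⟩
    have hq : s(e, f) ∈ H.edgeSet := hef
    obtain ⟨-, h1, h2⟩ := hg _ hq
    have h3 := hT' _ (Finset.mem_image.2 ⟨_, SimpleGraph.mem_edgeFinset.2 hq, rfl⟩)
    generalize g s(e, f) = t at h1 h2 h3
    obtain ⟨a, w, b⟩ := t
    obtain rfl : w = v := h1
    rw [Sym2.map_mk, Sym2.eq_iff] at h2
    rcases h2 with ⟨h4, h5⟩ | ⟨h4, h5⟩
    · exact Or.inl ⟨a, b, h3, h4, h5⟩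
    · exact Or.inr ⟨a, b, h3, h5, h4⟩

/-- Connectedness of all junction graphs is witnessed by at most `2m` passages. -/
theorem exists_passages {T : List V} (h : ∀ v, (junctionGraph G T v).Connected) :
    ∃ F : Finset (V × V × V), F.card ≤ 2 * G.edgeSet.ncard ∧ (∀ t ∈ F, t ∈ cyclicTriples T) ∧
      ∀ T' : List V, (∀ t ∈ F, t ∈ cyclicTriples T') → ∀ v, (junctionGraph G T' v).Connected := by
  classical
  choose F hF hT hT' using fun v => exists_passages_at (h v)
  refine ⟨Finset.univ.biUnion F, ?_, ?_, ?_⟩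
  · refine Finset.card_biUnion_le.trans ((Finset.sum_le_sum fun v _ => hF v).trans ?_)
    rw [G.sum_degrees_eq_twice_card_edges, Set.ncard_eq_toFinset_card', SimpleGraph.edgeFinset]
  · intro t ht
    obtain ⟨v, -, hv⟩ := Finset.mem_biUnion.1 ht
    exact hT v t hv
  · intro T' h' v
    exact hT' v T' fun t ht => h' t (Finset.mem_biUnion.2 ⟨v, Finset.mem_univ _, ht⟩)

/-- If a threading traverses an edge more than `2m` times in the same direction, then a redundant
cycle can be deleted. -/
theorem IsThreading.exists_deletesRedundantCycle [DecidableEq V] (hG : Admissible G) {T : List V}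
    (hT : IsThreading G T) {u v : V}
    (hc : 2 * G.edgeSet.ncard < (cyclicPairs T).count (u, v)) :
    ∃ T', DeletesRedundantCycle G T T' ∧ (∀ α, turnCost α T' ≤ turnCost α T) ∧
      T'.length < T.length := by
  have hmem : (u, v) ∈ cyclicPairs T := List.count_pos_iff.1 (by omega)
  have huv : G.Adj u v := hT.closedWalk _ hmem
  have hm : 1 ≤ G.edgeSet.ncard := (Set.ncard_pos (Set.toFinite _)).2 ⟨s(u, v), huv⟩
  obtain ⟨S, hS, hl⟩ := exists_isRotated_joinSegments huv.ne T hmem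
  obtain ⟨F, hF, hFT, hF'⟩ := exists_passages hT.junctionConnected
  have key : ∀ t ∈ F, ∃ i : Fin S.length, t ∈ cyclicTriples (u :: v :: S[i]) := by
    intro t ht
    have h1 := (cyclicTriples_perm hS).mem_iff.2 (hFT t ht)
    rw [cyclicTriples_joinSegments, List.mem_flatMap] at h1
    obtain ⟨A, hA, hA'⟩ := h1
    obtain ⟨i, hi, rfl⟩ := List.getElem_of_mem hA
    exact ⟨⟨i, hi⟩, hA'⟩
  have : Nonempty (Fin S.length) := ⟨⟨0, by omega⟩⟩
  choose! j hj using key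
  -- Pigeonhole: at most `2m` chosen passages, but more than `2m` segments.
  obtain ⟨i, hi⟩ : ∃ i : Fin S.length, i ∉ F.image j := by
    by_contra! h
    have h1 : (Finset.univ : Finset (Fin S.length)).card ≤ (F.image j).card :=
      Finset.card_le_card fun i _ => h i
    have h2 : (F.image j).card ≤ F.card := Finset.card_image_le
    simp only [Finset.card_univ, Fintype.card_fin] at h1
    omega
  -- The walk is rotated so that the segment to be deleted comes first.
  set R := S.drop (i + 1) ++ S.take i with hR
  have hrot : T.IsRotated (joinSegments u v (S[i] :: R)) := by
    refine hS.trans ?_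
    have e : S = S.take i ++ S[i] :: S.drop (i + 1) := by simp
    have e1 : joinSegments u v S =
        joinSegments u v (S.take i) ++ joinSegments u v (S[i] :: S.drop (i + 1)) := by
      conv_lhs => rw [e]
      rw [joinSegments, List.flatMap_append]; rfl
    have e2 : joinSegments u v (S[i] :: R) =
        joinSegments u v (S[i] :: S.drop (i + 1)) ++ joinSegments u v (S.take i) := by
      rw [hR, ← List.cons_append, joinSegments, List.flatMap_append]; rfl
    rw [e1, e2]
    exact List.isRotated_append
  have hperm := cyclicTriples_perm hrot
  have hjoin : cyclicTriples (joinSegments u v (S[i] :: R)) =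
      cyclicTriples (u :: v :: S[i]) ++ cyclicTriples (joinSegments u v R) := by
    rw [cyclicTriples_joinSegments, cyclicTriples_joinSegments, List.flatMap_cons]
  have hsub : ∀ t ∈ cyclicTriples (joinSegments u v R), t ∈ cyclicTriples T := fun t ht =>
    hperm.mem_iff.1 (by rw [hjoin]; exact List.mem_append_right _ ht)
  have hconn : ∀ w, (junctionGraph G (joinSegments u v R) w).Connected := by
    refine hF' _ fun t ht => ?_
    rw [cyclicTriples_joinSegments, List.mem_flatMap]
    refine ⟨S[j t], ?_, hj t ht⟩
    have hne : (j t : ℕ) ≠ i := fun h => hi (Finset.mem_image.2 ⟨t, ht, Fin.ext h⟩)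
    rw [hR, List.mem_append, List.mem_drop_iff_getElem, List.mem_take_iff_getElem]
    rcases Nat.lt_or_gt_of_ne hne with h | h
    · exact Or.inr ⟨j t, by simp [h], rfl⟩
    · refine Or.inl ⟨j t - (i + 1), by have := (j t).2; omega, ?_⟩
      simp only [show (i : ℕ) + 1 + (j t - (i + 1)) = j t by omega]
      rfl
  -- There are at least three segments because `m ≥ 1`; a traversal of `uv` must be left over for
  -- `DeletesCycle`.
  have hRne : R ≠ [] := by
    intro h
    have h1 : R.length = 0 := by rw [h]; rfl
    simp [hR] at h1
    omega
  obtain ⟨B, R', hRB⟩ := List.exists_cons_of_ne_nil hRne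
  have hB : joinSegments u v R = u :: v :: (B ++ joinSegments u v R') := by
    rw [hRB]; simp [joinSegments]
  refine ⟨joinSegments u v R, ⟨⟨u, v, S[i], B ++ joinSegments u v R', ?_, hB⟩, ?_⟩, ?_, ?_⟩
  · rw [← hB]
    simpa [joinSegments] using hrot
  -- Local conditions are inherited because all passages are old. That every edge is visited is not
  -- inherited; it follows from the connected junction graphs.
  · refine ⟨fun p hp => ?_, fun e he => hG.visitsEdges hconn he, fun t ht => hT.noUTurn t (hsub t ht),
      hconn⟩
    rw [cyclicPairs_eq_map] at hp
    obtain ⟨t, ht, rfl⟩ := List.mem_map.1 hp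
    exact hT.closedWalk _ (by rw [cyclicPairs_eq_map]; exact List.mem_map.2 ⟨t, hsub t ht, rfl⟩)
  · intro α
    rw [turnCost, turnCost, ← (hperm.map _).sum_eq, hjoin, List.map_append, List.sum_append]
    exact le_add_self
  · have : T.length = (joinSegments u v (S[i] :: R)).length := hrot.perm.length_eq
    rw [this]
    simp [joinSegments]
    omega

theorem IsThreading.length_le [DecidableEq V] {T : List V} (hT : IsThreading G T) {c : ℕ}
    (h : ∀ e ∈ G.edgeSet, traversals T e ≤ c) : T.length ≤ G.edgeSet.ncard * c := by
  classical
  have h1 : T.length = (walkEdges T).length := by simp [walkEdges, cyclicPairs]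
  rw [h1, ← List.sum_toFinset_count_eq_length]
  refine (Finset.sum_le_card_nsmul _ _ c fun e he =>
    h e (walkEdges_mem_edgeSet hT (List.mem_toFinset.1 he))).trans ?_
  rw [smul_eq_mul, Set.ncard_eq_toFinset_card']
  refine Nat.mul_le_mul_right _ (Finset.card_le_card fun e he => ?_)
  exact Set.mem_toFinset.2 (walkEdges_mem_edgeSet hT (List.mem_toFinset.1 he))

/-- By deleting redundant cycles, every threading can be shortened to a threading that traverses
every edge at most `4m` times. -/
theorem IsThreading.exists_short [DecidableEq V] (hG : Admissible G) {T : List V}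
    (hT : IsThreading G T) :
    ∃ T', Relation.ReflTransGen (DeletesRedundantCycle G) T T' ∧ IsThreading G T' ∧
      (∀ α, turnCost α T' ≤ turnCost α T) ∧
      ∀ e ∈ G.edgeSet, traversals T' e ≤ 4 * G.edgeSet.ncard := by
  induction hn : T.length using Nat.strong_induction_on generalizing T with
  | h n ih =>
    by_cases h : ∃ u v, 2 * G.edgeSet.ncard < (cyclicPairs T).count (u, v)
    · obtain ⟨u, v, h⟩ := h
      obtain ⟨T1, h1, h2, h3⟩ := hT.exists_deletesRedundantCycle hG h
      obtain ⟨T2, h4, h5, h6, h7⟩ := ih T1.length (by omega) h1.2 rfl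
      exact ⟨T2, .head h1 h4, h5, fun α => (h6 α).trans (h2 α), h7⟩
    -- Each of the two directions contributes at most `2m` traversals.
    · push Not at h
      refine ⟨T, .refl, hT, fun _ => le_rfl, fun e _ => ?_⟩
      induction e with | h u v =>
      have := traversals_le T u v
      have := h u v
      have := h v u
      omega

end Threadings
end Threading

namespace Threading

/-! ### Regular languages are closed under products and stars. -/

section Regular

variable {α : Type*}

/-- Myhill–Nerode in the form used below: it suffices to confine the left quotients to a finite set.
-/
theorem isRegular_of_finite_superset {L : Language α} {S : Set (Language α)} (hS : S.Finite)
    (h : ∀ w, L.leftQuotient w ∈ S) : L.IsRegular :=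
  Language.IsRegular.of_finite_range_leftQuotient
    (hS.subset (by rintro _ ⟨w, rfl⟩; exact h w))

theorem isRegular_one : (1 : Language α).IsRegular := by
  refine isRegular_of_finite_superset (S := {0, 1}) (by simp) fun w => ?_
  cases w with
  | nil => right; rfl
  | cons a w =>
    left
    ext y
    simp [Language.mem_leftQuotient, Language.mem_one]

theorem isRegular_singleton (a : α) : ({[a]} : Language α).IsRegular := by
  refine isRegular_of_finite_superset (S := {0, 1, {[a]}}) (by simp) fun w => ?_
  rcases w with _ | ⟨b, w⟩
  · right; right; rfl
  · by_cases h : b = a ∧ w = []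
    · obtain ⟨rfl, rfl⟩ := h
      right; left
      ext y
      rw [Language.mem_leftQuotient, Language.mem_one]
      change [b] ++ y = [b] ↔ _
      simp
    · left
      ext y
      rw [Language.mem_leftQuotient]
      change (b :: w) ++ y = [a] ↔ _
      simp only [List.cons_append, List.cons.injEq, List.append_eq_nil_iff, Language.notMem_zero,
        iff_false]
      tauto

/-- The union of a set of languages. -/
def sUnionLang (S : Set (Language α)) : Language α := {x | ∃ N ∈ S, x ∈ N}

/-- A factorisation of `w ++ y` breaks either inside `y` or inside `w`. The right side depends only
on one quotient of `L` and a set of quotients of `M`, which leaves finitely many possibilities when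
both languages are regular. -/
theorem leftQuotient_mul (L M : Language α) (w : List α) :
    (L * M).leftQuotient w =
      L.leftQuotient w * M +
        sUnionLang {N | ∃ u v, w = u ++ v ∧ u ∈ L ∧ N = M.leftQuotient v} := by
  ext y
  rw [Language.mem_leftQuotient, Language.mem_add, Language.mem_mul, Language.mem_mul]
  constructor
  · rintro ⟨a, ha, b, hb, hab⟩
    rcases List.append_eq_append_iff.1 hab with ⟨c, rfl, rfl⟩ | ⟨c, rfl, rfl⟩
    · right
      exact ⟨M.leftQuotient c, ⟨a, c, rfl, ha, rfl⟩, hb⟩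
    · left
      exact ⟨c, ha, b, hb, rfl⟩
  · rintro (⟨a, ha, b, hb, rfl⟩ | ⟨N, ⟨u, v, rfl, hu, rfl⟩, hy⟩)
    · exact ⟨w ++ a, ha, b, hb, by simp⟩
    · exact ⟨u, hu, v ++ y, hy, by simp⟩

theorem isRegular_mul {L M : Language α} (hL : L.IsRegular) (hM : M.IsRegular) :
    (L * M).IsRegular := by
  have h1 := hL.finite_range_leftQuotient
  have h2 := hM.finite_range_leftQuotient
  refine isRegular_of_finite_superset
    (S := (fun p : Language α × Set (Language α) => p.1 * M + sUnionLang p.2) ''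
      (Set.range L.leftQuotient ×ˢ {s | s ⊆ Set.range M.leftQuotient}))
    ((h1.prod h2.finite_subsets).image _) fun w => ?_
  refine ⟨(L.leftQuotient w, {N | ∃ u v, w = u ++ v ∧ u ∈ L ∧ N = M.leftQuotient v}),
    ⟨⟨w, rfl⟩, ?_⟩, (leftQuotient_mul L M w).symm⟩
  rintro _ ⟨u, v, -, -, rfl⟩
  exact ⟨v, rfl⟩

/-- The factor `v ++ a` is the one that contains the last letter of `w`, which is why `w` must not
be empty. -/
theorem mem_kstar_append {L : Language α} {w y : List α} (hw : w ≠ []) :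
    w ++ y ∈ KStar.kstar L ↔
      ∃ u v a b, w = u ++ v ∧ u ∈ KStar.kstar L ∧ v ++ a ∈ L ∧ b ∈ KStar.kstar L ∧ y = a ++ b := by
  constructor
  · rw [Language.mem_kstar]
    rintro ⟨S, hS, hL⟩
    induction S generalizing w with
    | nil => simp at hS; exact absurd hS.1 hw
    | cons s S ih =>
      rw [List.flatten_cons] at hS
      have hsS : ∀ z ∈ S, z ∈ L := fun z hz => hL z (by simp [hz])
      rcases List.append_eq_append_iff.1 hS with ⟨c, rfl, rfl⟩ | ⟨c, rfl, hc⟩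
      · exact ⟨[], w, c, S.flatten, by simp, Language.nil_mem_kstar L, hL _ (by simp),
          Language.join_mem_kstar hsS, rfl⟩
      · by_cases hc0 : c = []
        · subst hc0
          refine ⟨[], s, [], S.flatten, by simp, Language.nil_mem_kstar L, ?_,
            Language.join_mem_kstar hsS, ?_⟩
          · simpa using hL s (by simp)
          · simpa using hc.symm
        · obtain ⟨u, v, a, b, rfl, hu, hv, hb, rfl⟩ := ih hc0 hc.symm hsS
          refine ⟨s ++ u, v, a, b, by simp, ?_, hv, hb, rfl⟩
          obtain ⟨U, rfl, hU⟩ := Language.mem_kstar.1 hu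
          exact Language.mem_kstar.2 ⟨s :: U, by simp, by
            intro z hz
            rcases List.mem_cons.1 hz with rfl | hz
            · exact hL _ (by simp)
            · exact hU z hz⟩
  · rintro ⟨u, v, a, b, rfl, hu, hv, hb, rfl⟩
    obtain ⟨U, rfl, hU⟩ := Language.mem_kstar.1 hu
    obtain ⟨B, rfl, hB⟩ := Language.mem_kstar.1 hb
    refine Language.mem_kstar.2 ⟨U ++ [v ++ a] ++ B, by simp, ?_⟩
    intro z hz
    simp only [List.append_assoc, List.cons_append, List.nil_append, List.mem_append,
      List.mem_cons] at hz
    rcases hz with hz | rfl | hz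
    · exact hU z hz
    · exact hv
    · exact hB z hz

theorem isRegular_kstar {L : Language α} (hL : L.IsRegular) : (KStar.kstar L).IsRegular := by
  have h1 := hL.finite_range_leftQuotient
  refine isRegular_of_finite_superset
    (S := insert (KStar.kstar L)
      ((fun p : Set (Language α) => sUnionLang p * KStar.kstar L) ''
        {s | s ⊆ Set.range L.leftQuotient}))
    ((h1.finite_subsets.image _).insert _) fun w => ?_
  -- The quotient by the empty word is the star itself; all others are determined by a set of
  -- quotients of `L`.
  by_cases hw : w = []
  · subst hw
    exact Or.inl rfl
  right
  refine ⟨{N | ∃ u v, w = u ++ v ∧ u ∈ KStar.kstar L ∧ N = L.leftQuotient v}, ?_, ?_⟩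
  · rintro _ ⟨u, v, -, -, rfl⟩
    exact ⟨v, rfl⟩
  · ext y
    rw [Language.mem_leftQuotient, mem_kstar_append hw, Language.mem_mul]
    constructor
    · rintro ⟨a, ⟨_, ⟨u, v, rfl, hu, rfl⟩, ha⟩, b, hb, rfl⟩
      exact ⟨u, v, a, b, rfl, hu, ha, hb, rfl⟩
    · rintro ⟨u, v, a, b, rfl, hu, hv, hb, rfl⟩
      exact ⟨a, ⟨L.leftQuotient v, ⟨u, v, rfl, hu, rfl⟩, hv⟩, b, hb, rfl⟩

end Regular

/-! ### Elementary actions on counters and tapes, and the stacks that represent them. -/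

section Machine

/-- The elementary actions of a program that has a counter for every index in `ι` and two tapes
over `Γ` (`false` for the input, `true` for the work tape). A tape is a pair of lists: the part to
the left of the head, nearest symbol first, and the part to the right. -/
inductive Act (Γ ι : Type)
  | inc (k : ι)
  | dec (k : ι)
  | isZero (k : ι)
  | moveR (t : Bool)
  | moveL (t : Bool)
  | read (t : Bool) (o : Option Γ)
  | atStart (t : Bool)
  | write (a : Γ)
  deriving DecidableEq, Fintype

/-- The memory contents of a program. -/
@[ext] structure Conf (Γ ι : Type) where
  left : Bool → List Γ
  right : Bool → List Γ
  cnt : ι → ℕ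

variable {Γ ι : Type} [DecidableEq Γ] [DecidableEq ι]

/-- The effect of an action; `none` if it is not possible. -/
def Act.exec : Act Γ ι → Conf Γ ι → Option (Conf Γ ι)
  | .inc k, s => some { s with cnt := Function.update s.cnt k (s.cnt k + 1) }
  | .dec k, s =>
    if s.cnt k = 0 then none else some { s with cnt := Function.update s.cnt k (s.cnt k - 1) }
  | .isZero k, s => if s.cnt k = 0 then some s else none
  | .moveR t, s =>
    match s.right t with
    | [] => none
    | a :: l => some { s with left := Function.update s.left t (a :: s.left t),
                              right := Function.update s.right t l }
  | .moveL t, s =>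
    match s.left t with
    | [] => none
    | a :: l => some { s with left := Function.update s.left t l,
                              right := Function.update s.right t (a :: s.right t) }
  | .read t o, s => if (s.right t).head? = o then some s else none
  | .atStart t, s => if s.left t = [] then some s else none
  | .write a, s => some { s with right := Function.update s.right true (a :: s.right true) }

/-- The effect of a sequence of actions. -/
def execs : List (Act Γ ι) → Conf Γ ι → Option (Conf Γ ι)
  | [], s => some s
  | a :: w, s => (a.exec s).bind (execs w)

@[simp] theorem execs_nil (s : Conf Γ ι) : execs [] s = some s := rfl

@[simp] theorem execs_cons (a : Act Γ ι) (w : List (Act Γ ι)) (s : Conf Γ ι) :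
    execs (a :: w) s = (a.exec s).bind (execs w) := rfl

theorem execs_append (v w : List (Act Γ ι)) (s : Conf Γ ι) :
    execs (v ++ w) s = (execs v s).bind (execs w) := by
  induction v generalizing s with
  | nil => rfl
  | cons a v ih =>
    simp only [List.cons_append, execs_cons]
    cases a.exec s <;> simp [ih]

/-- The initial memory contents on input `x`: the head of the input tape stands at its end. -/
def Conf.init (x : List Γ) : Conf Γ ι where
  left t := if t then [] else x.reverse
  right _ := []
  cnt _ := 0

/-- The stacks of the simulating machine. -/
inductive Stk (c : ℕ)
  | inp
  | out
  | left (t : Bool)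
  | right (t : Bool)
  | cnt (k : Fin c)
  deriving DecidableEq, Fintype

/-- The labels of the simulating machine. -/
inductive Lab (Γ : Type) (c : ℕ)
  | main
  | sym (a : Γ)
  | act (a : Act Γ (Fin c))
  | clear (b : Bool)
  deriving Fintype

/-- The stack alphabets. -/
abbrev stkAlph (Γ : Type) (c : ℕ) : Stk c → Type
  | .inp => Γ ⊕ Act Γ (Fin c)
  | .out => Bool
  | .left _ => Γ
  | .right _ => Γ
  | .cnt _ => Unit

/-- The internal memory: an automaton state, the symbol last read, and a flag. -/
abbrev Reg (Γ : Type) (c : ℕ) (Q : Type) : Type := Q × Option (Γ ⊕ Act Γ (Fin c)) × Bool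

end Machine
end Threading

namespace Threading

set_option linter.unusedSectionVars false

/-! ### Reachability in a bounded number of steps. -/

section Simulation

variable {σ : Type*} (f : σ → Option σ)

/-- The transition function `f` leads from `a` to `b` in at most `m` steps. -/
def LeadsIn (a b : σ) (m : ℕ) : Prop := ∃ n ≤ m, (flip bind f)^[n] (some a) = some b

variable {f}

theorem LeadsIn.refl (a : σ) (m : ℕ) : LeadsIn f a a m := ⟨0, Nat.zero_le _, rfl⟩

theorem LeadsIn.head {a a' b : σ} {m : ℕ} (h : f a = some a') (h' : LeadsIn f a' b m) :
    LeadsIn f a b (m + 1) := by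
  obtain ⟨n, hn, e⟩ := h'
  refine ⟨n + 1, by omega, ?_⟩
  rw [Function.iterate_succ_apply]
  have : flip bind f (some a) = some a' := h
  rw [this, e]

theorem LeadsIn.mono {a b : σ} {m m' : ℕ} (h : LeadsIn f a b m) (hm : m ≤ m') :
    LeadsIn f a b m' := by
  obtain ⟨n, hn, e⟩ := h
  exact ⟨n, hn.trans hm, e⟩

end Simulation

/-! ### A multi-stack machine that executes a given sequence of actions. -/

section Machine

open Turing TM2.Stmt

variable {Γ : Type} [DecidableEq Γ] [Inhabited Γ] {c : ℕ} {Q : Type}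

/-- Remove the top symbol from all stacks of a list, and record whether all of them were empty. -/
def popAll : List (Stk c) → TM2.Stmt (stkAlph Γ c) (Lab Γ c) (Reg Γ c Q) →
    TM2.Stmt (stkAlph Γ c) (Lab Γ c) (Reg Γ c Q)
  | [], q => q
  | k :: ks, q => pop k (fun v s => (v.1, v.2.1, v.2.2 && s.isNone)) (popAll ks q)

/-- Finish the execution of an action by updating the state of the automaton. -/
def advance (M : DFA (Act Γ (Fin c)) Q) (d : Act Γ (Fin c)) :
    TM2.Stmt (stkAlph Γ c) (Lab Γ c) (Reg Γ c Q) :=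
  load (fun v => (M.step v.1 d, none, true)) (goto fun _ => .main)

/-- Continue if the flag is set, and reject otherwise. -/
def check (q : TM2.Stmt (stkAlph Γ c) (Lab Γ c) (Reg Γ c Q)) :
    TM2.Stmt (stkAlph Γ c) (Lab Γ c) (Reg Γ c Q) :=
  branch (fun v => v.2.2) q (goto fun _ => .clear false)

/-- The symbol of the buffer. -/
def bufSym (v : Reg Γ c Q) : Γ :=
  match v.2.1 with
  | some (.inl a) => a
  | _ => default

/-- The statement that carries out an action. -/
def actStmt (M : DFA (Act Γ (Fin c)) Q) (d : Act Γ (Fin c)) :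
    TM2.Stmt (stkAlph Γ c) (Lab Γ c) (Reg Γ c Q) :=
  match d with
  | .inc k => push (.cnt k) (fun _ => ()) (advance M d)
  | .dec k => pop (.cnt k) (fun v s => (v.1, v.2.1, s.isSome)) (check (advance M d))
  | .isZero k => peek (.cnt k) (fun v s => (v.1, v.2.1, s.isNone)) (check (advance M d))
  | .moveR t =>
    pop (.right t) (fun v (s : Option Γ) => (v.1, s.map Sum.inl, s.isSome))
      (check (push (.left t) (bufSym (Γ := Γ)) (advance M d)))
  | .moveL t =>
    pop (.left t) (fun v (s : Option Γ) => (v.1, s.map Sum.inl, s.isSome))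
      (check (push (.right t) (bufSym (Γ := Γ)) (advance M d)))
  | .read t o =>
    peek (.right t) (fun v (s : Option Γ) => (v.1, v.2.1, decide (s = o))) (check (advance M d))
  | .atStart t => peek (.left t) (fun v s => (v.1, v.2.1, s.isNone)) (check (advance M d))
  | .write a => push (.right true) (fun _ => a) (advance M d)

open Classical in
/-- The program of the simulating machine. -/
noncomputable def simStmt (M : DFA (Act Γ (Fin c)) Q) :
    Lab Γ c → TM2.Stmt (stkAlph Γ c) (Lab Γ c) (Reg Γ c Q)
  | .main => pop .inp (fun v s => (v.1, s, v.2.2)) (goto fun v =>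
      match v.2.1 with
      | none => .clear (decide (v.1 ∈ M.accept))
      | some (.inl a) => .sym a
      | some (.inr d) => .act d)
  | .sym a => push (.left false) (fun _ => a) (goto fun _ => .main)
  | .act d => actStmt M d
  | .clear b => load (fun v => (v.1, v.2.1, true)) (popAll Finset.univ.toList
      (branch (fun v => v.2.2)
        (push .out (fun _ => b) (load (fun _ => (M.start, none, true)) halt))
        (goto fun _ => .clear b)))

/-- The stacks that represent the remaining input and the memory contents. -/
def stkOf (w : List (Γ ⊕ Act Γ (Fin c))) (s : Conf Γ (Fin c)) : ∀ k, List (stkAlph Γ c k)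
  | .inp => w
  | .out => []
  | .left t => s.left t
  | .right t => s.right t
  | .cnt k => List.replicate (s.cnt k) ()

theorem stepAux_popAll (ks : List (Stk c)) (hks : ks.Nodup)
    (q : TM2.Stmt (stkAlph Γ c) (Lab Γ c) (Reg Γ c Q)) (v : Reg Γ c Q)
    (S : ∀ k, List (stkAlph Γ c k)) :
    TM2.stepAux (popAll ks q) v S =
      TM2.stepAux q (v.1, v.2.1, v.2.2 && ks.all fun k => (S k).isEmpty)
        (fun k => if k ∈ ks then (S k).tail else S k) := by
  induction ks generalizing v S with
  | nil => simp [popAll]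
  | cons k ks ih =>
    rw [List.nodup_cons] at hks
    simp only [popAll, TM2.stepAux]
    rw [ih hks.2]
    have h1 : (ks.all fun j => (Function.update S k (S k).tail j).isEmpty) =
        ks.all fun j => (S j).isEmpty := by
      rw [Bool.eq_iff_iff, List.all_eq_true, List.all_eq_true]
      refine forall₂_congr fun j hj => ?_
      rw [Function.update_of_ne]
      rintro rfl
      exact hks.1 hj
    congr 1
    · rw [h1]
      cases hS : S k <;> simp [hS]
    · funext j
      by_cases hj : j = k
      · subst hj
        simp [hks.1]
      · simp [hj]

/-- The final configuration with output `b`. -/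
def simFinal (M : DFA (Act Γ (Fin c)) Q) (b : Bool) :
    TM2.Cfg (stkAlph Γ c) (Lab Γ c) (Reg Γ c Q) where
  l := none
  var := (M.start, none, true)
  stk k := match k with
    | .out => [b]
    | .inp => []
    | .left _ => []
    | .right _ => []
    | .cnt _ => []

/-- A halting configuration must have empty stacks apart from the output. Each pass pops every stack
once, and a last pass finds all of them empty. -/
theorem leadsIn_clear (M : DFA (Act Γ (Fin c)) Q) (b : Bool) (n : ℕ) (v : Reg Γ c Q)
    (S : ∀ k, List (stkAlph Γ c k)) (hS : ∀ k, (S k).length ≤ n) :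
    LeadsIn (TM2.step (simStmt M)) ⟨some (.clear b), v, S⟩ (simFinal M b) (n + 1) := by
  induction n generalizing v S with
  | zero =>
    refine LeadsIn.head (a' := simFinal M b) ?_ (LeadsIn.refl _ _)
    have h0 : ∀ k, S k = [] := fun k => List.length_eq_zero_iff.1 (Nat.le_zero.1 (hS k))
    simp only [TM2.step, simStmt, TM2.stepAux]
    rw [stepAux_popAll _ (Finset.nodup_toList _)]
    simp only [h0, TM2.stepAux, simFinal]
    simp only [List.isEmpty_nil, Bool.true_and, List.tail_nil, ite_self]
    rw [show (Finset.univ.toList (α := Stk c)).all (fun _ => true) = true by simp]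
    simp only [cond_true]
    congr 2
    funext k
    cases k <;> simp
  | succ n ih =>
    by_cases h0 : ∀ k, S k = []
    · refine LeadsIn.head (a' := simFinal M b) ?_ (LeadsIn.refl _ _)
      simp only [TM2.step, simStmt, TM2.stepAux]
      rw [stepAux_popAll _ (Finset.nodup_toList _)]
      simp only [h0, TM2.stepAux, simFinal]
      simp only [List.isEmpty_nil, Bool.true_and, List.tail_nil, ite_self]
      rw [show (Finset.univ.toList (α := Stk c)).all (fun _ => true) = true by simp]
      simp only [cond_true]
      congr 2
      funext k
      cases k <;> simp
    · refine LeadsIn.head (a' := ⟨some (.clear b), (v.1, v.2.1, false), fun k => (S k).tail⟩) ?_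
        (ih _ _ fun k => by have := hS k; simp only [List.length_tail]; omega)
      simp only [TM2.step, simStmt, TM2.stepAux]
      rw [stepAux_popAll _ (Finset.nodup_toList _)]
      have : (Finset.univ.toList.all fun k => (S k).isEmpty) = false := by
        rw [Bool.eq_false_iff]
        intro h
        rw [List.all_eq_true] at h
        exact h0 fun k => by simpa using h k (by simp)
      simp [this, TM2.stepAux]

theorem update_stkOf_inp (w w' : List (Γ ⊕ Act Γ (Fin c))) (s : Conf Γ (Fin c)) :
    Function.update (stkOf w s) .inp w' = stkOf w' s := by
  funext j
  by_cases h : j = .inp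
  · subst h; rw [Function.update_self]; rfl
  · rw [Function.update_of_ne h]; cases j <;> first | rfl | exact absurd rfl h

theorem update_stkOf_left (w : List (Γ ⊕ Act Γ (Fin c))) (s : Conf Γ (Fin c)) (t : Bool)
    (l : List Γ) : Function.update (stkOf w s) (.left t) l =
      stkOf w { s with left := Function.update s.left t l } := by
  funext j
  by_cases h : j = .left t
  · subst h; rw [Function.update_self]; simp [stkOf]
  · rw [Function.update_of_ne h]
    cases j with
    | left t' => simp only [stkOf]; rw [Function.update_of_ne]; rintro rfl; exact h rfl
    | _ => rfl

theorem update_stkOf_right (w : List (Γ ⊕ Act Γ (Fin c))) (s : Conf Γ (Fin c)) (t : Bool)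
    (l : List Γ) : Function.update (stkOf w s) (.right t) l =
      stkOf w { s with right := Function.update s.right t l } := by
  funext j
  by_cases h : j = .right t
  · subst h; rw [Function.update_self]; simp [stkOf]
  · rw [Function.update_of_ne h]
    cases j with
    | right t' => simp only [stkOf]; rw [Function.update_of_ne]; rintro rfl; exact h rfl
    | _ => rfl

theorem update_stkOf_cnt (w : List (Γ ⊕ Act Γ (Fin c))) (s : Conf Γ (Fin c)) (k : Fin c)
    (n : ℕ) : Function.update (stkOf w s) (.cnt k) (List.replicate n ()) =
      stkOf w { s with cnt := Function.update s.cnt k n } := by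
  funext j
  by_cases h : j = .cnt k
  · subst h; rw [Function.update_self]; simp [stkOf]
  · rw [Function.update_of_ne h]
    cases j with
    | cnt k' => simp only [stkOf]; rw [Function.update_of_ne]; rintro rfl; exact h rfl
    | _ => rfl

/-- A statement may touch several stacks before it jumps, so every action costs a single step. -/
theorem step_act_some (M : DFA (Act Γ (Fin c)) Q) (d : Act Γ (Fin c)) (v : Reg Γ c Q)
    (w : List (Γ ⊕ Act Γ (Fin c))) (s s' : Conf Γ (Fin c)) (h : d.exec s = some s') :
    TM2.step (simStmt M) ⟨some (.act d), v, stkOf w s⟩ =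
      some ⟨some .main, (M.step v.1 d, none, true), stkOf w s'⟩ := by
  cases d with
  | inc k =>
    cases h
    rw [← update_stkOf_cnt]
    rfl
  | dec k =>
    simp only [Act.exec] at h
    split_ifs at h with h0
    cases h
    rw [← update_stkOf_cnt]
    obtain ⟨n, hn⟩ := Nat.exists_eq_succ_of_ne_zero h0
    simp [simStmt, actStmt, check, advance, stkOf, hn, List.replicate_succ]
  | isZero k =>
    simp only [Act.exec] at h
    split_ifs at h with h0
    cases h
    simp [simStmt, actStmt, check, advance, stkOf, h0]
  | moveR t =>
    simp only [Act.exec] at h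
    split at h
    · cases h
    · next a l hl =>
      cases h
      rw [← update_stkOf_right w ⟨Function.update s.left t (a :: s.left t), s.right, s.cnt⟩,
        ← update_stkOf_left, Function.update_comm (by simp)]
      simp [simStmt, actStmt, check, advance, stkOf, hl, bufSym]
  | moveL t =>
    simp only [Act.exec] at h
    split at h
    · cases h
    · next a l hl =>
      cases h
      rw [← update_stkOf_right w ⟨Function.update s.left t l, s.right, s.cnt⟩,
        ← update_stkOf_left]
      simp [simStmt, actStmt, check, advance, stkOf, hl, bufSym]
  | read t o =>
    simp only [Act.exec] at h
    split_ifs at h with h0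
    cases h
    simp [simStmt, actStmt, check, advance, stkOf, h0]
  | atStart t =>
    simp only [Act.exec] at h
    split_ifs at h with h0
    cases h
    simp [simStmt, actStmt, check, advance, stkOf, h0]
  | write a =>
    cases h
    rw [← update_stkOf_right]
    rfl

theorem step_act_none (M : DFA (Act Γ (Fin c)) Q) (d : Act Γ (Fin c)) (v : Reg Γ c Q)
    (w : List (Γ ⊕ Act Γ (Fin c))) (s : Conf Γ (Fin c)) (h : d.exec s = none) :
    ∃ v' : Reg Γ c Q, TM2.step (simStmt M) ⟨some (.act d), v, stkOf w s⟩ =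
      some ⟨some (.clear false), v', stkOf w s⟩ := by
  cases d with
  | inc k => cases h
  | dec k =>
    simp only [Act.exec] at h
    split_ifs at h with h0
    simp [simStmt, actStmt, check, stkOf, h0]
  | isZero k =>
    simp only [Act.exec] at h
    split_ifs at h with h0
    obtain ⟨n, hn⟩ := Nat.exists_eq_succ_of_ne_zero h0
    simp [simStmt, actStmt, check, stkOf, hn, List.replicate_succ]
  | moveR t =>
    simp only [Act.exec] at h
    split at h
    · next hl =>
      simp [simStmt, actStmt, check, stkOf, hl]
    · cases h
  | moveL t =>
    simp only [Act.exec] at h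
    split at h
    · next hl =>
      simp [simStmt, actStmt, check, stkOf, hl]
    · cases h
  | read t o =>
    simp only [Act.exec] at h
    split_ifs at h with h0
    simp [simStmt, actStmt, check, stkOf, h0]
  | atStart t =>
    simp only [Act.exec] at h
    split_ifs at h with h0
    obtain ⟨a, l, hl⟩ := List.exists_cons_of_ne_nil h0
    simp [simStmt, actStmt, check, stkOf, hl]
  | write a => cases h

theorem length_stkOf_le {w w' : List (Γ ⊕ Act Γ (Fin c))} {s s' : Conf Γ (Fin c)} {n m : ℕ}
    (h : ∀ k, (stkOf w s k).length ≤ n) (hs : ∀ t, (s'.left t).length ≤ (s.left t).length + m)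
    (hs' : ∀ t, (s'.right t).length ≤ (s.right t).length + m)
    (hc : ∀ k, s'.cnt k ≤ s.cnt k + m) (hw : w'.length ≤ w.length + m) (k : Stk c) :
    (stkOf w' s' k).length ≤ n + m := by
  cases k with
  | inp => exact hw.trans (Nat.add_le_add_right (h .inp) m)
  | out => exact Nat.zero_le _
  | left t => exact (hs t).trans (Nat.add_le_add_right (h (.left t)) m)
  | right t => exact (hs' t).trans (Nat.add_le_add_right (h (.right t)) m)
  | cnt i =>
    have := h (.cnt i)
    simp only [stkOf, List.length_replicate] at this ⊢
    exact (hc i).trans (Nat.add_le_add_right this m)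

/-- The heights of the stacks determine the time needed for the final clearing. -/
theorem Act.exec_size {d : Act Γ ι} [DecidableEq ι] {s s' : Conf Γ ι} (h : d.exec s = some s') :
    (∀ t, (s'.left t).length ≤ (s.left t).length + 1) ∧
      (∀ t, (s'.right t).length ≤ (s.right t).length + 1) ∧ ∀ k, s'.cnt k ≤ s.cnt k + 1 := by
  cases d <;> simp only [Act.exec] at h
  case inc k =>
    cases h
    refine ⟨by simp, by simp, fun j => ?_⟩
    simp only [Function.update_apply]
    split_ifs with hj <;> simp [hj]
  case dec k =>
    split_ifs at h
    cases h
    refine ⟨by simp, by simp, fun j => ?_⟩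
    simp only [Function.update_apply]
    split_ifs with hj
    · subst hj; omega
    · omega
  case moveR t =>
    split at h
    · cases h
    · next a l hl =>
      cases h
      refine ⟨fun t' => ?_, fun t' => ?_, by simp⟩ <;> simp only [Function.update_apply] <;>
        split_ifs with hj <;> simp [hj, hl]; omega
  case moveL t =>
    split at h
    · cases h
    · next a l hl =>
      cases h
      refine ⟨fun t' => ?_, fun t' => ?_, by simp⟩ <;> simp only [Function.update_apply] <;>
        split_ifs with hj <;> simp [hj, hl]; omega
  case write a =>
    cases h
    refine ⟨by simp, fun t' => ?_, by simp⟩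
    simp only [Function.update_apply]
    split_ifs with hj <;> simp [hj]
  all_goals
    split_ifs at h
    cases h
    simp

open Classical in
/-- The answer of the simulating machine in state `q` and memory contents `s`, when the actions `w`
are still to be carried out. -/
noncomputable def answer (M : DFA (Act Γ (Fin c)) Q) (q : Q) (s : Conf Γ (Fin c))
    (w : List (Act Γ (Fin c))) : Bool :=
  decide (M.evalFrom q w ∈ M.accept ∧ (execs w s).isSome)

theorem answer_eq_true {M : DFA (Act Γ (Fin c)) Q} {q : Q} {s : Conf Γ (Fin c)}
    {w : List (Act Γ (Fin c))} :
    answer M q s w = true ↔ M.evalFrom q w ∈ M.accept ∧ (execs w s).isSome := by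
  simp [answer]

/-- An action takes two steps, one to fetch it and one to carry it out, and may prolong the final
clearing by one pass; hence the factor `3`. -/
theorem leadsIn_act (M : DFA (Act Γ (Fin c)) Q) (w : List (Act Γ (Fin c))) (v : Reg Γ c Q)
    (s : Conf Γ (Fin c)) (n : ℕ) (hn : ∀ k, (stkOf (w.map Sum.inr) s k).length ≤ n) :
    LeadsIn (TM2.step (simStmt M)) ⟨some .main, v, stkOf (w.map Sum.inr) s⟩
      (simFinal M (answer M v.1 s w)) (3 * w.length + n + 2) := by
  induction w generalizing v s n with
  | nil =>
    refine LeadsIn.head (a' := ⟨some (.clear (answer M v.1 s [])), (v.1, none, v.2.2),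
      stkOf [] s⟩) ?_ (LeadsIn.mono (leadsIn_clear M _ n _ _ hn) (by simp))
    have : Function.update (stkOf ([] : List (Γ ⊕ Act Γ (Fin c))) s) .inp [] = stkOf [] s :=
      update_stkOf_inp _ _ _
    classical
    have ha : answer M v.1 s [] = decide (v.1 ∈ M.accept) := by
      simp only [answer, decide_eq_decide]
      simp
    rw [ha]
    simp only [simStmt, TM2.step, TM2.stepAux, stkOf, List.map_nil, List.head?_nil, List.tail_nil, this]
  | cons d w ih =>
    have e1 : TM2.step (simStmt M) ⟨some .main, v, stkOf ((d :: w).map Sum.inr) s⟩ =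
        some ⟨some (.act d), (v.1, some (.inr d), v.2.2), stkOf (w.map Sum.inr) s⟩ := by
      simp only [TM2.step, simStmt, TM2.stepAux]
      rw [← update_stkOf_inp ((d :: w).map Sum.inr) (w.map Sum.inr) s]
      rfl
    have hn' : ∀ k, (stkOf (w.map Sum.inr) s k).length ≤ n + 0 :=
      length_stkOf_le hn (by simp) (by simp) (by simp) (by simp)
    cases hd : d.exec s with
    | none =>
      obtain ⟨v', hv'⟩ := step_act_none M d (v.1, some (.inr d), v.2.2) (w.map Sum.inr) s hd
      have ha : answer M v.1 s (d :: w) = false := by simp [answer, hd]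
      rw [ha]
      exact (LeadsIn.head e1 (LeadsIn.head hv' (leadsIn_clear M _ _ _ _ hn'))).mono
        (by simp only [List.length_cons]; omega)
    | some s' =>
      have e2 := step_act_some M d (v.1, some (.inr d), v.2.2) (w.map Sum.inr) s s' hd
      have ha : answer M v.1 s (d :: w) = answer M (M.step v.1 d) s' w := by
        simp only [answer, decide_eq_decide]
        simp [hd]
      rw [ha]
      obtain ⟨h1, h2, h3⟩ := Act.exec_size hd
      exact (LeadsIn.head e1 (LeadsIn.head e2 (ih (M.step v.1 d, none, true) s' (n + 1)
        (length_stkOf_le hn h1 h2 h3 (by simp; omega))))).mono (by simp only [List.length_cons]; omega)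

/-- The memory contents after the symbols `x` have been pushed to the left of the input head. -/
def Conf.load (x : List Γ) (s : Conf Γ ι) : Conf Γ ι :=
  { s with left := Function.update s.left false (x.reverse ++ s.left false) }

/-- The continuation `h` is assumed for all registers with the same automaton state, because loading
changes the buffer. -/
theorem leadsIn_load (M : DFA (Act Γ (Fin c)) Q) (x : List Γ) (w : List (Γ ⊕ Act Γ (Fin c)))
    (b : TM2.Cfg (stkAlph Γ c) (Lab Γ c) (Reg Γ c Q)) (m : ℕ) (v : Reg Γ c Q)
    (s : Conf Γ (Fin c))
    (h : ∀ v' : Reg Γ c Q, v'.1 = v.1 →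
      LeadsIn (TM2.step (simStmt M)) ⟨some .main, v', stkOf w (s.load x)⟩ b m) :
    LeadsIn (TM2.step (simStmt M)) ⟨some .main, v, stkOf (x.map Sum.inl ++ w) s⟩ b
      (2 * x.length + m) := by
  induction x generalizing v s with
  | nil => simpa [Conf.load] using h v rfl
  | cons a x ih =>
    have e1 : TM2.step (simStmt M) ⟨some .main, v, stkOf ((a :: x).map Sum.inl ++ w) s⟩ =
        some ⟨some (.sym a), (v.1, some (.inl a), v.2.2), stkOf (x.map Sum.inl ++ w) s⟩ := by
      simp only [TM2.step, simStmt, TM2.stepAux]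
      rw [← update_stkOf_inp ((a :: x).map Sum.inl ++ w) (x.map Sum.inl ++ w) s]
      rfl
    have e2 : TM2.step (simStmt M)
        ⟨some (.sym a), (v.1, some (.inl a), v.2.2), stkOf (x.map Sum.inl ++ w) s⟩ =
        some ⟨some .main, (v.1, some (.inl a), v.2.2), stkOf (x.map Sum.inl ++ w) (s.load [a])⟩ := by
      rw [Conf.load, ← update_stkOf_left]
      rfl
    refine (LeadsIn.head e1 (LeadsIn.head e2 (ih _ _ fun v' hv' => ?_))).mono
      (by simp only [List.length_cons]; omega)
    have : (s.load [a]).load x = s.load (a :: x) := by simp [Conf.load]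
    rw [this]
    exact h v' hv'

variable [Fintype Γ] [Fintype Q]

/-- The machine that carries out a given sequence of actions. -/
noncomputable def simMachine (M : DFA (Act Γ (Fin c)) Q) : FinTM2 where
  K := Stk c
  k₀ := .inp
  k₁ := .out
  Γ := stkAlph Γ c
  Λ := Lab Γ c
  main := .main
  σ := Reg Γ c Q
  initialState := (M.start, none, true)
  Γk₀Fin := inferInstanceAs (Fintype (Γ ⊕ Act Γ (Fin c)))
  m := simStmt M

/-- Whether the actions `p.2` form a word of the automaton and can be carried out on input `p.1`. -/
noncomputable def accepts (M : DFA (Act Γ (Fin c)) Q) (p : List Γ × List (Act Γ (Fin c))) : Bool :=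
  answer M M.start (Conf.init p.1) p.2

theorem simMachine_computes (M : DFA (Act Γ (Fin c)) Q) :
    Nonempty (TM2ComputableInPolyTime encodePair Computability.encodeBool (accepts M)) := by
  refine ⟨{ tm := simMachine M
            inputAlphabet := Equiv.refl _
            outputAlphabet := Equiv.refl _
            -- Loading `x` takes `2|x|` steps, the actions `w` take `3|w|`, and clearing takes at
            -- most `|x| + |w| + 2`.
            time := 4 * Polynomial.X + 2
            outputsFun := fun p => Classical.choice ?_ }⟩
  obtain ⟨x, w⟩ := p
  have key : LeadsIn (TM2.step (simStmt M))
      ⟨some .main, (M.start, none, true), stkOf (encodePair (x, w)) ⟨fun _ => [], fun _ => [], 0⟩⟩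
      (simFinal M (accepts M (x, w))) (4 * (encodePair (x, w)).length + 2) := by
    have hi : Conf.load x (⟨fun _ => [], fun _ => [], 0⟩ : Conf Γ (Fin c)) = Conf.init x := by
      ext1
      · funext t; cases t <;> simp [Conf.load, Conf.init]
      · rfl
      · rfl
    refine (leadsIn_load M x (w.map Sum.inr) _ (3 * w.length + (x.length + w.length) + 2) _ _
      fun v' hv' => ?_).mono (by simp [encodePair]; omega)
    rw [hi]
    have := leadsIn_act M w v' (Conf.init x) (x.length + w.length) (by
      intro k
      cases k with
      | left t => cases t <;> simp [stkOf, Conf.init]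
      | _ => simp [stkOf, Conf.init])
    rw [hv'] at this
    exact this
  obtain ⟨n, hn, e⟩ := key
  have h1 : initList (simMachine M) (encodePair (x, w)) =
      ⟨some .main, (M.start, none, true),
        stkOf (encodePair (x, w)) ⟨fun _ => [], fun _ => [], 0⟩⟩ := by
    simp only [initList, simMachine]
    congr 1
    funext k
    cases k <;> simp [stkOf]
    rfl
  have h2 (b : Bool) : haltList (simMachine M) [b] = simFinal M b := by
    simp only [haltList, simMachine, simFinal]
    congr 1
    funext k
    cases k <;> simp
    rfl
  refine ⟨⟨⟨n, ?_⟩, ?_⟩⟩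
  · have h3 : (flip bind (simMachine M).step)^[n]
        (some (initList (simMachine M) (encodePair (x, w)))) =
        some (haltList (simMachine M) [accepts M (x, w)]) := by
      rw [h1, h2]
      exact e
    exact (congrArg (fun l => (flip bind (simMachine M).step)^[n]
      (some (initList (simMachine M) l))) (List.map_id _)).trans h3
  · simpa using hn

/-- Apply a map to the counter index of an action. -/
def Act.map {ι κ : Type} (f : ι → κ) : Act Γ ι → Act Γ κ
  | .inc k => .inc (f k)
  | .dec k => .dec (f k)
  | .isZero k => .isZero (f k)
  | .moveR t => .moveR t
  | .moveL t => .moveL t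
  | .read t o => .read t o
  | .atStart t => .atStart t
  | .write a => .write a

/-- All counters used by the action have an index below `c`. -/
def Act.Below (c : ℕ) : Act Γ ℕ → Prop
  | .inc k => k < c
  | .dec k => k < c
  | .isZero k => k < c
  | _ => True

theorem Act.Below.exists_map {a : Act Γ ℕ} (h : a.Below c) :
    ∃ b : Act Γ (Fin c), b.map Fin.val = a := by
  cases a with
  | inc k => exact ⟨.inc ⟨k, h⟩, rfl⟩
  | dec k => exact ⟨.dec ⟨k, h⟩, rfl⟩
  | isZero k => exact ⟨.isZero ⟨k, h⟩, rfl⟩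
  | moveR t => exact ⟨.moveR t, rfl⟩
  | moveL t => exact ⟨.moveL t, rfl⟩
  | read t o => exact ⟨.read t o, rfl⟩
  | atStart t => exact ⟨.atStart t, rfl⟩
  | write t => exact ⟨.write t, rfl⟩

/-- Forget all but the first `c` counters. -/
def Conf.restrict (c : ℕ) (s : Conf Γ ℕ) : Conf Γ (Fin c) where
  left := s.left
  right := s.right
  cnt k := s.cnt k

/-- Programs are composed with counters indexed by `ℕ`; the machine keeps only the finitely many
that a given program uses. -/
theorem Act.exec_restrict (d : Act Γ (Fin c)) (s : Conf Γ ℕ) :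
    d.exec (s.restrict c) = ((d.map Fin.val).exec s).map (Conf.restrict c) := by
  have hu (k : Fin c) (n : ℕ) :
      Function.update (fun j : Fin c => s.cnt j) k n = fun j : Fin c => Function.update s.cnt k n j := by
    funext j
    simp [Function.update_apply, Fin.ext_iff]
  cases d with
  | moveR t => simp only [Act.map, Act.exec, Conf.restrict]; cases s.right t <;> rfl
  | moveL t => simp only [Act.map, Act.exec, Conf.restrict]; cases s.left t <;> rfl
  | inc k => simp [Act.map, Act.exec, Conf.restrict, hu]
  | dec k => by_cases h : s.cnt k = 0 <;> simp [Act.map, Act.exec, Conf.restrict, hu, h]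
  | isZero k => by_cases h : s.cnt k = 0 <;> simp [Act.map, Act.exec, Conf.restrict, h]
  | read t o => by_cases h : (s.right t).head? = o <;> simp [Act.map, Act.exec, Conf.restrict, h]
  | atStart t => by_cases h : s.left t = [] <;> simp [Act.map, Act.exec, Conf.restrict, h]
  | write a => simp [Act.map, Act.exec, Conf.restrict]

theorem execs_restrict (w : List (Act Γ (Fin c))) (s : Conf Γ ℕ) :
    execs w (s.restrict c) = (execs (w.map (Act.map Fin.val)) s).map (Conf.restrict c) := by
  induction w generalizing s with
  | nil => rfl
  | cons d w ih =>
    simp only [execs_cons, List.map_cons, Act.exec_restrict]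
    cases (d.map Fin.val).exec s with
    | none => rfl
    | some s' => exact ih s'

/-- The language of the runs of a program: it is regular and involves finitely many counters. -/
def IsProgram (P : Language (Act Γ ℕ)) : Prop :=
  P.IsRegular ∧ ∃ c, ∀ w ∈ P, ∀ a ∈ w, a.Below c

/-- A language is in NP if membership is the existence of a run of polynomial length of a
nondeterministic program. -/
theorem inNP_of_isProgram {L : Language Γ} {P : Language (Act Γ ℕ)} (hP : IsProgram P)
    (p : Polynomial ℕ)
    (h : ∀ x, x ∈ L ↔ ∃ w ∈ P, w.length ≤ p.eval x.length ∧ (execs w (Conf.init x)).isSome) :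
    InNP L := by
  obtain ⟨⟨Q, _, M, rfl⟩, c, hc⟩ := hP
  -- The certificate is the run itself. The automaton checks that it belongs to the program, the
  -- execution that it is possible on `x`.
  refine ⟨Act Γ (Fin c), inferInstance, accepts (M.comap (Act.map Fin.val)), p,
    simMachine_computes _, fun x => (h x).trans ?_⟩
  have key (w : List (Act Γ (Fin c))) : accepts (M.comap (Act.map Fin.val)) (x, w) = true ↔
      w.map (Act.map Fin.val) ∈ M.accepts ∧
        (execs (w.map (Act.map Fin.val)) (Conf.init x)).isSome := by
    rw [accepts, answer_eq_true, DFA.evalFrom_comap, DFA.mem_accepts]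
    refine and_congr Iff.rfl ?_
    have : (Conf.init x : Conf Γ (Fin c)) = (Conf.init x : Conf Γ ℕ).restrict c := rfl
    simp only [this, execs_restrict, Option.isSome_map]
  constructor
  · rintro ⟨w, hw, hl, he⟩
    have : ∃ w' : List (Act Γ (Fin c)), w'.map (Act.map Fin.val) = w := by
      have hb := hc w hw
      clear hw hl he
      induction w with
      | nil => exact ⟨[], rfl⟩
      | cons a w ih =>
        obtain ⟨w', rfl⟩ := ih fun b hb' => hb b (by simp [hb'])
        obtain ⟨b, rfl⟩ := (hb a (by simp)).exists_map
        exact ⟨b :: w', rfl⟩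
    obtain ⟨w', rfl⟩ := this
    exact ⟨w', by simpa using hl, (key w').2 ⟨hw, he⟩⟩
  · rintro ⟨w, hl, hw⟩
    obtain ⟨h1, h2⟩ := (key w).1 hw
    exact ⟨_, h1, by simpa using hl, h2⟩

end Machine
end Threading

namespace Threading

set_option linter.unusedSectionVars false

/-! ### Programs as regular languages, and a calculus for their runs. -/

section Programs

variable {Γ : Type} [DecidableEq Γ]

theorem isProgram_one : IsProgram (1 : Language (Act Γ ℕ)) :=
  ⟨isRegular_one, 0, fun w hw a ha => by
    rw [Language.mem_one] at hw
    simp [hw] at ha⟩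

theorem isProgram_singleton (a : Act Γ ℕ) : IsProgram ({[a]} : Language (Act Γ ℕ)) := by
  refine ⟨isRegular_singleton a, ?_⟩
  have : ∃ c, a.Below c := by
    cases a with
    | inc k => exact ⟨k + 1, Nat.lt_succ_self k⟩
    | dec k => exact ⟨k + 1, Nat.lt_succ_self k⟩
    | isZero k => exact ⟨k + 1, Nat.lt_succ_self k⟩
    | _ => exact ⟨0, trivial⟩
  obtain ⟨c, hc⟩ := this
  refine ⟨c, fun w hw b hb => ?_⟩
  have hw' : w = [a] := hw
  simp only [hw', List.mem_singleton] at hb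
  exact hb ▸ hc

theorem Act.Below.mono {c c' : ℕ} (h : c ≤ c') {a : Act Γ ℕ} (ha : a.Below c) : a.Below c' := by
  cases a <;> first | exact trivial | exact lt_of_lt_of_le ha h

theorem IsProgram.mul {P Q : Language (Act Γ ℕ)} (hP : IsProgram P) (hQ : IsProgram Q) :
    IsProgram (P * Q) := by
  obtain ⟨h1, c1, h1'⟩ := hP
  obtain ⟨h2, c2, h2'⟩ := hQ
  refine ⟨isRegular_mul h1 h2, max c1 c2, fun w hw a ha => ?_⟩
  obtain ⟨u, hu, v, hv, rfl⟩ := Language.mem_mul.1 hw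
  rcases List.mem_append.1 ha with ha | ha
  · exact (h1' u hu a ha).mono (le_max_left _ _)
  · exact (h2' v hv a ha).mono (le_max_right _ _)

theorem IsProgram.add {P Q : Language (Act Γ ℕ)} (hP : IsProgram P) (hQ : IsProgram Q) :
    IsProgram (P + Q) := by
  obtain ⟨h1, c1, h1'⟩ := hP
  obtain ⟨h2, c2, h2'⟩ := hQ
  refine ⟨h1.add h2, max c1 c2, fun w hw a ha => ?_⟩
  rcases (Language.mem_add _ _ _).1 hw with hw | hw
  · exact (h1' w hw a ha).mono (le_max_left _ _)
  · exact (h2' w hw a ha).mono (le_max_right _ _)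

theorem IsProgram.kstar {P : Language (Act Γ ℕ)} (hP : IsProgram P) :
    IsProgram (KStar.kstar P) := by
  obtain ⟨h1, c1, h1'⟩ := hP
  refine ⟨isRegular_kstar h1, c1, fun w hw a ha => ?_⟩
  obtain ⟨S, rfl, hS⟩ := Language.mem_kstar.1 hw
  obtain ⟨u, hu, ha⟩ := List.mem_flatten.1 ha
  exact h1' u (hS u hu) a ha

/-- The program that carries out the given actions. -/
def block (l : List (Act Γ ℕ)) : Language (Act Γ ℕ) := ({l} : Set _)

theorem mem_block {w l : List (Act Γ ℕ)} : w ∈ block l ↔ w = l := Iff.rfl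

theorem isProgram_block (l : List (Act Γ ℕ)) : IsProgram (block l) := by
  induction l with
  | nil => exact isProgram_one
  | cons a l ih =>
    have : block (a :: l) = {[a]} * block l := by
      ext w
      rw [mem_block, Language.mem_mul]
      constructor
      · rintro rfl
        exact ⟨[a], rfl, l, rfl, rfl⟩
      · rintro ⟨u, hu, v, hv, rfl⟩
        rw [mem_block] at hv
        have hu' : u = [a] := hu
        rw [hu', hv]
        rfl
    rw [this]
    exact (isProgram_singleton a).mul ih

/-- The program `P` has a run of length `n` from `s` to `t`. -/
def Run (P : Language (Act Γ ℕ)) (n : ℕ) (s t : Conf Γ ℕ) : Prop :=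
  ∃ w ∈ P, w.length = n ∧ execs w s = some t

theorem run_block {l : List (Act Γ ℕ)} {n : ℕ} {s t : Conf Γ ℕ} :
    Run (block l) n s t ↔ l.length = n ∧ execs l s = some t := by
  constructor
  · rintro ⟨w, rfl, h⟩
    exact h
  · intro h
    exact ⟨l, rfl, h⟩

theorem run_mul {P Q : Language (Act Γ ℕ)} {n : ℕ} {s t : Conf Γ ℕ} :
    Run (P * Q) n s t ↔ ∃ k m u, n = k + m ∧ Run P k s u ∧ Run Q m u t := by
  constructor
  · rintro ⟨w, hw, rfl, h⟩
    obtain ⟨u, hu, v, hv, rfl⟩ := Language.mem_mul.1 hw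
    rw [execs_append, Option.bind_eq_some_iff] at h
    obtain ⟨s', h1, h2⟩ := h
    exact ⟨u.length, v.length, s', by simp, ⟨u, hu, rfl, h1⟩, ⟨v, hv, rfl, h2⟩⟩
  · rintro ⟨_, _, s', rfl, ⟨u, hu, rfl, h1⟩, ⟨v, hv, rfl, h2⟩⟩
    exact ⟨u ++ v, Language.append_mem_mul hu hv, by simp, by simp [execs_append, h1, h2]⟩

theorem run_add {P Q : Language (Act Γ ℕ)} {n : ℕ} {s t : Conf Γ ℕ} :
    Run (P + Q) n s t ↔ Run P n s t ∨ Run Q n s t := by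
  simp only [Run, Language.mem_add, or_and_right, exists_or]

theorem run_kstar_zero (P : Language (Act Γ ℕ)) (s : Conf Γ ℕ) : Run (KStar.kstar P) 0 s s :=
  ⟨[], Language.nil_mem_kstar P, rfl, rfl⟩

theorem run_kstar_cons {P : Language (Act Γ ℕ)} {n m : ℕ} {s t u : Conf Γ ℕ} (h : Run P n s t)
    (h' : Run (KStar.kstar P) m t u) : Run (KStar.kstar P) (n + m) s u := by
  obtain ⟨v, hv, rfl, h1⟩ := h
  obtain ⟨w, hw, rfl, h2⟩ := h'
  obtain ⟨S, rfl, hS⟩ := Language.mem_kstar.1 hw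
  refine ⟨v ++ S.flatten, Language.mem_kstar.2 ⟨v :: S, by simp, ?_⟩, by simp, ?_⟩
  · intro z hz
    rcases List.mem_cons.1 hz with rfl | hz
    · exact hv
    · exact hS z hz
  · simp [execs_append, h1, h2]

/-- Induction along the iterations of a loop. -/
theorem run_kstar_induction {P : Language (Act Γ ℕ)} {C : Conf Γ ℕ → Conf Γ ℕ → Prop}
    (refl : ∀ s, C s s) (head : ∀ k s t u, Run P k s t → C t u → C s u) {n : ℕ} {s t : Conf Γ ℕ}
    (h : Run (KStar.kstar P) n s t) : C s t := by
  obtain ⟨w, hw, -, h⟩ := h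
  obtain ⟨S, rfl, hS⟩ := Language.mem_kstar.1 hw
  clear hw
  induction S generalizing s with
  | nil => cases h; exact refl _
  | cons v S ih =>
    rw [List.flatten_cons, execs_append, Option.bind_eq_some_iff] at h
    obtain ⟨s', h1, h2⟩ := h
    exact head v.length s s' t ⟨v, hS v (by simp), rfl, h1⟩ (ih (fun y hy => hS y (by simp [hy])) h2)

/-- Started in `s`, the program `P` can only end in `s'` and only if `φ` holds; if `φ` holds it can
end after at most `n` actions. -/
def Spec (P : Language (Act Γ ℕ)) (s : Conf Γ ℕ) (φ : Prop) (s' : Conf Γ ℕ) (n : ℕ) : Prop :=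
  (∀ k t, Run P k s t → φ ∧ t = s') ∧ (φ → ∃ k ≤ n, Run P k s s')

theorem Spec.mono {P : Language (Act Γ ℕ)} {s s' : Conf Γ ℕ} {φ : Prop} {n m : ℕ}
    (h : Spec P s φ s' n) (hnm : n ≤ m) : Spec P s φ s' m :=
  ⟨h.1, fun hφ => let ⟨k, hk, hr⟩ := h.2 hφ; ⟨k, hk.trans hnm, hr⟩⟩

theorem Spec.congr {P : Language (Act Γ ℕ)} {s s' : Conf Γ ℕ} {φ ψ : Prop} {n : ℕ}
    (h : Spec P s φ s' n) (e : φ ↔ ψ) : Spec P s ψ s' n := by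
  rwa [← propext e]

theorem Spec.post {P : Language (Act Γ ℕ)} {s s' t : Conf Γ ℕ} {φ : Prop} {n : ℕ}
    (h : Spec P s φ s' n) (e : t = s') : Spec P s φ t n := e ▸ h

/-- A program that cannot end satisfies every claim on its final state and running time. -/
theorem Spec.of_not {P : Language (Act Γ ℕ)} {s s' : Conf Γ ℕ} {φ : Prop} {n : ℕ}
    (h : Spec P s φ s' n) (hφ : ¬φ) (t : Conf Γ ℕ) (m : ℕ) : Spec P s φ t m :=
  ⟨fun k u hu => absurd (h.1 k u hu).1 hφ, fun h' => absurd h' hφ⟩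

theorem spec_block {l : List (Act Γ ℕ)} {s s' : Conf Γ ℕ} (h : execs l s = some s') :
    Spec (block l) s True s' l.length :=
  ⟨fun k t ht => ⟨trivial, by simpa [h] using (run_block.1 ht).2.symm⟩,
    fun _ => ⟨_, le_rfl, run_block.2 ⟨rfl, h⟩⟩⟩

theorem spec_block_none {l : List (Act Γ ℕ)} {s : Conf Γ ℕ} (h : execs l s = none)
    (s' : Conf Γ ℕ) (n : ℕ) : Spec (block l) s False s' n :=
  ⟨fun k t ht => by simpa [h] using (run_block.1 ht).2, False.elim⟩

theorem spec_block_if {l : List (Act Γ ℕ)} {s s' : Conf Γ ℕ} {φ : Prop}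
    (h : φ → execs l s = some s') (h' : ¬φ → execs l s = none) :
    Spec (block l) s φ s' l.length := by
  by_cases hφ : φ
  · exact (spec_block (h hφ)).congr (by simp [hφ])
  · exact (spec_block_none (h' hφ) _ _).congr (by simp [hφ])

theorem Spec.seq {P Q : Language (Act Γ ℕ)} {s s' s'' : Conf Γ ℕ} {φ ψ : Prop} {n m : ℕ}
    (hP : Spec P s φ s' n) (hQ : φ → Spec Q s' ψ s'' m) :
    Spec (P * Q) s (φ ∧ ψ) s'' (n + m) := by
  constructor
  · intro k t h
    obtain ⟨a, b, u, -, h1, h2⟩ := run_mul.1 h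
    obtain ⟨hφ, rfl⟩ := hP.1 a u h1
    obtain ⟨hψ, rfl⟩ := (hQ hφ).1 b t h2
    exact ⟨⟨hφ, hψ⟩, rfl⟩
  · rintro ⟨hφ, hψ⟩
    obtain ⟨a, ha, h1⟩ := hP.2 hφ
    obtain ⟨b, hb, h2⟩ := (hQ hφ).2 hψ
    exact ⟨a + b, by omega, run_mul.2 ⟨a, b, s', rfl, h1, h2⟩⟩

/-- Sequential composition of two programs that cannot fail. -/
theorem Spec.seq_true {P Q : Language (Act Γ ℕ)} {s s' s'' : Conf Γ ℕ} {ψ : Prop} {n m : ℕ}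
    (hP : Spec P s True s' n) (hQ : Spec Q s' ψ s'' m) : Spec (P * Q) s ψ s'' (n + m) :=
  (hP.seq fun _ => hQ).congr (by simp)

theorem Spec.alt {P Q : Language (Act Γ ℕ)} {s s' : Conf Γ ℕ} {φ ψ : Prop} {n : ℕ}
    (hP : Spec P s φ s' n) (hQ : Spec Q s ψ s' n) : Spec (P + Q) s (φ ∨ ψ) s' n := by
  constructor
  · intro k t h
    rcases run_add.1 h with h | h
    · exact ⟨Or.inl (hP.1 k t h).1, (hP.1 k t h).2⟩
    · exact ⟨Or.inr (hQ.1 k t h).1, (hQ.1 k t h).2⟩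
  · rintro (h | h)
    · obtain ⟨a, ha, h1⟩ := hP.2 h
      exact ⟨a, ha, run_add.2 (Or.inl h1)⟩
    · obtain ⟨a, ha, h1⟩ := hQ.2 h
      exact ⟨a, ha, run_add.2 (Or.inr h1)⟩

/-- A loop that passes through the states `f 0, …, f n` and can be left in `f n` only. -/
theorem Spec.loop {P E : Language (Act Γ ℕ)} {f : ℕ → Conf Γ ℕ} {n c m : ℕ} {φ : ℕ → Prop}
    {ψ : Prop} {s' : Conf Γ ℕ} (hP : ∀ i ≤ n, Spec P (f i) (i < n ∧ φ i) (f (i + 1)) c)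
    (hE : ∀ i ≤ n, Spec E (f i) (i = n ∧ ψ) s' m) :
    Spec (KStar.kstar P * E) (f 0) ((∀ i < n, φ i) ∧ ψ) s' (n * c + m) := by
  constructor
  · intro k t h
    obtain ⟨a, b, u, -, h1, h2⟩ := run_mul.1 h
    -- However many iterations are chosen, they lead from `f i` to some `f j` with `φ` verified in
    -- between; the exit `E` then forces `j = n`.
    have key := run_kstar_induction (P := P)
      (C := fun s t => ∀ i ≤ n, s = f i → ∃ j ≤ n, i ≤ j ∧ t = f j ∧ ∀ l, i ≤ l → l < j → φ l)
      (fun s i hi hs => ⟨i, hi, le_rfl, hs, fun l h1 h2 => absurd h1 (by omega)⟩)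
      (fun k s t u hst ih i hi hs => by
        subst hs
        obtain ⟨⟨hi', hφ⟩, rfl⟩ := (hP i hi).1 k t hst
        obtain ⟨j, hj, hij, hu, hl⟩ := ih (i + 1) hi' rfl
        refine ⟨j, hj, by omega, hu, fun l h1 h2 => ?_⟩
        rcases Nat.eq_or_lt_of_le h1 with rfl | h1
        · exact hφ
        · exact hl l h1 h2) h1
    obtain ⟨j, hj, -, rfl, hl⟩ := key 0 (Nat.zero_le _) rfl
    obtain ⟨⟨rfl, hψ⟩, ht⟩ := (hE j hj).1 b t h2
    exact ⟨⟨fun i hi => hl i (Nat.zero_le _) hi, hψ⟩, ht⟩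
  · rintro ⟨hφ, hψ⟩
    -- Induction on the number of remaining iterations, since `run_kstar_cons` adds iterations in
    -- front.
    have key : ∀ i ≤ n, ∃ k ≤ i * c, Run (KStar.kstar P) k (f (n - i)) (f n) := by
      intro i
      induction i with
      | zero => exact fun _ => ⟨0, by simp, run_kstar_zero P _⟩
      | succ i ih =>
        intro hi
        obtain ⟨k, hk, h⟩ := ih (by omega)
        obtain ⟨k', hk', h'⟩ := (hP (n - (i + 1)) (by omega)).2
          ⟨by omega, hφ _ (by omega)⟩
        rw [show n - (i + 1) + 1 = n - i by omega] at h'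
        exact ⟨k' + k, by rw [Nat.succ_mul]; omega, run_kstar_cons h' h⟩
    obtain ⟨k, hk, h⟩ := key n le_rfl
    rw [Nat.sub_self] at h
    obtain ⟨k', hk', h'⟩ := (hE n le_rfl).2 ⟨rfl, hψ⟩
    exact ⟨k + k', by omega, run_mul.2 ⟨k, k', _, rfl, h, h'⟩⟩

end Programs

/-! ### Arithmetic on counters. -/

section Basic

variable {Γ : Type} [DecidableEq Γ]

/-- Set a counter to a value. -/
def Conf.set (s : Conf Γ ℕ) (k v : ℕ) : Conf Γ ℕ := { s with cnt := Function.update s.cnt k v }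

@[simp] theorem Conf.set_left (s : Conf Γ ℕ) (k v : ℕ) : (s.set k v).left = s.left := rfl
@[simp] theorem Conf.set_right (s : Conf Γ ℕ) (k v : ℕ) : (s.set k v).right = s.right := rfl

theorem Conf.set_cnt (s : Conf Γ ℕ) (k v j : ℕ) :
    (s.set k v).cnt j = if j = k then v else s.cnt j := by
  simp [Conf.set, Function.update_apply]

theorem Conf.set_eq {s : Conf Γ ℕ} {k v : ℕ} (h : s.cnt k = v) : s.set k v = s := by
  simp [Conf.set, ← h]

/-- Set the contents of a tape. -/
def Conf.tape (s : Conf Γ ℕ) (t : Bool) (l r : List Γ) : Conf Γ ℕ :=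
  { s with left := Function.update s.left t l, right := Function.update s.right t r }

@[simp] theorem Conf.tape_cnt (s : Conf Γ ℕ) (t : Bool) (l r : List Γ) :
    (s.tape t l r).cnt = s.cnt := rfl
@[simp] theorem Conf.tape_left (s : Conf Γ ℕ) (t : Bool) (l r : List Γ) :
    (s.tape t l r).left t = l := by simp [Conf.tape]
@[simp] theorem Conf.tape_right (s : Conf Γ ℕ) (t : Bool) (l r : List Γ) :
    (s.tape t l r).right t = r := by simp [Conf.tape]
@[simp] theorem Conf.tape_tape (s : Conf Γ ℕ) (t : Bool) (l r l' r' : List Γ) :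
    (s.tape t l r).tape t l' r' = s.tape t l' r' := by simp [Conf.tape]

theorem Conf.tape_set (s : Conf Γ ℕ) (t : Bool) (l r : List Γ) (k v : ℕ) :
    (s.tape t l r).set k v = (s.set k v).tape t l r := rfl

theorem Conf.tape_eq {s : Conf Γ ℕ} {t : Bool} {l r : List Γ} (hl : s.left t = l)
    (hr : s.right t = r) : s.tape t l r = s := by
  simp [Conf.tape, ← hl, ← hr]

@[simp] theorem exec_inc (s : Conf Γ ℕ) (k : ℕ) :
    (Act.inc k).exec s = some (s.set k (s.cnt k + 1)) := rfl

theorem exec_dec {s : Conf Γ ℕ} {k : ℕ} (h : s.cnt k ≠ 0) :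
    (Act.dec k).exec s = some (s.set k (s.cnt k - 1)) := if_neg h

theorem exec_dec_none {s : Conf Γ ℕ} {k : ℕ} (h : s.cnt k = 0) :
    (Act.dec k).exec s = none := if_pos h

theorem exec_moveR {s : Conf Γ ℕ} {t : Bool} {a : Γ} {l : List Γ} (h : s.right t = a :: l) :
    (Act.moveR t).exec s = some (s.tape t (a :: s.left t) l) := by
  simp [Act.exec, h, Conf.tape]

theorem exec_moveR_none {s : Conf Γ ℕ} {t : Bool} (h : s.right t = []) :
    (Act.moveR t).exec s = none := by
  simp [Act.exec, h]

theorem exec_moveL {s : Conf Γ ℕ} {t : Bool} {a : Γ} {l : List Γ} (h : s.left t = a :: l) :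
    (Act.moveL t).exec s = some (s.tape t l (a :: s.right t)) := by
  simp [Act.exec, h, Conf.tape]

theorem exec_moveL_none {s : Conf Γ ℕ} {t : Bool} (h : s.left t = []) :
    (Act.moveL t).exec s = none := by
  simp [Act.exec, h]

/-- The state after `i` units have been moved from the counter `k` to all counters of the list. -/
def Conf.move (s : Conf Γ ℕ) (k : ℕ) (js : List ℕ) (i : ℕ) : Conf Γ ℕ :=
  { s with cnt := fun j => if j = k then s.cnt k - i else s.cnt j + i * js.count j }

/-- Empty the counter `k` and add its contents to all counters of the list. -/
def moveProg (k : ℕ) (js : List ℕ) : Language (Act Γ ℕ) :=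
  KStar.kstar (block (.dec k :: js.map .inc)) * block [.isZero k]

theorem execs_map_inc (js : List ℕ) (s : Conf Γ ℕ) :
    execs (js.map .inc) s = some { s with cnt := fun j => s.cnt j + js.count j } := by
  induction js generalizing s with
  | nil => rfl
  | cons k js ih =>
    simp only [List.map_cons, execs_cons, exec_inc, Option.bind_some, ih]
    congr 2
    funext j
    rw [Conf.set_cnt, List.count_cons]
    by_cases h : j = k
    · subst h; simp; omega
    · have : (k == j) = false := by simpa using fun e : k = j => h e.symm
      simp [h, this]

theorem isProgram_moveProg (k : ℕ) (js : List ℕ) : IsProgram (moveProg k js : Language (Act Γ ℕ)) :=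
  (isProgram_block _).kstar.mul (isProgram_block _)

/-- If `k` were in `js`, the loop would refill the counter that it empties. With `js = []` the
program just clears `k`. -/
theorem spec_moveProg (s : Conf Γ ℕ) {k : ℕ} {js : List ℕ} (hk : k ∉ js) :
    Spec (moveProg k js) s True (s.move k js (s.cnt k)) (s.cnt k * (js.length + 1) + 1) := by
  have h0 : s.move k js 0 = s := by
    simp only [Conf.move]
    congr 1
    funext j
    by_cases h : j = k <;> simp [h]
  have := Spec.loop (P := block (.dec k :: js.map .inc)) (E := block [.isZero k])
    (f := s.move k js) (n := s.cnt k) (φ := fun _ => True) (ψ := True)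
    (s' := s.move k js (s.cnt k)) (c := js.length + 1) (m := 1)
    (fun i hi => by
      refine Spec.mono (spec_block_if (fun h => ?_) fun h => ?_) (by simp)
      · rw [execs_cons, exec_dec (by simp [Conf.move]; omega), Option.bind_some, execs_map_inc]
        congr 2
        funext j
        rw [Conf.set_cnt]
        by_cases hj : j = k
        · subst hj
          simp [Conf.move, List.count_eq_zero_of_not_mem hk]; omega
        · simp [Conf.move, hj]; ring
      · rw [execs_cons, exec_dec_none (by simp [Conf.move]; simp at h; omega), Option.bind_none])
    (fun i hi => by
      refine Spec.mono (spec_block_if (fun h => ?_) fun h => ?_) (by simp)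
      · simp [Act.exec, h.1, Conf.move]
      · have : s.cnt k - i ≠ 0 := by simp at h; omega
        simp [Act.exec, Conf.move, this])
  rw [h0] at this
  exact this.congr (by simp)

end Basic
end Threading

namespace Threading

/-! ### Polynomial growth. -/

section PolyBounded

/-- A function that is bounded by a polynomial. -/
def PolyBounded (f : ℕ → ℕ) : Prop := ∃ c, ∀ n, f n ≤ (n + 2) ^ c

/-- The base `n + 2` is at least two, so constants and sums can be absorbed into the exponent. -/
theorem PolyBounded.const (k : ℕ) : PolyBounded fun _ => k :=
  ⟨k, fun n => (Nat.lt_two_pow_self).le.trans (Nat.pow_le_pow_left (by omega) k)⟩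

theorem PolyBounded.id : PolyBounded fun n => n := ⟨1, fun n => by simp⟩

theorem PolyBounded.add {f g : ℕ → ℕ} (hf : PolyBounded f) (hg : PolyBounded g) :
    PolyBounded fun n => f n + g n := by
  obtain ⟨a, ha⟩ := hf
  obtain ⟨b, hb⟩ := hg
  refine ⟨a + b + 1, fun n => ?_⟩
  have h1 : (n + 2) ^ a ≤ (n + 2) ^ (a + b) := Nat.pow_le_pow_right (by omega) (by omega)
  have h2 : (n + 2) ^ b ≤ (n + 2) ^ (a + b) := Nat.pow_le_pow_right (by omega) (by omega)
  have h3 : (n + 2) ^ (a + b + 1) = (n + 2) ^ (a + b) * (n + 2) := pow_succ _ _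
  have := ha n
  have := hb n
  nlinarith

theorem PolyBounded.mul {f g : ℕ → ℕ} (hf : PolyBounded f) (hg : PolyBounded g) :
    PolyBounded fun n => f n * g n := by
  obtain ⟨a, ha⟩ := hf
  obtain ⟨b, hb⟩ := hg
  exact ⟨a + b, fun n => (Nat.mul_le_mul (ha n) (hb n)).trans (pow_add _ _ _).ge⟩

theorem PolyBounded.pow {f : ℕ → ℕ} (hf : PolyBounded f) (k : ℕ) :
    PolyBounded fun n => f n ^ k := by
  obtain ⟨a, ha⟩ := hf
  exact ⟨a * k, fun n => (Nat.pow_le_pow_left (ha n) k).trans (pow_mul _ _ _).ge⟩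

end PolyBounded

/-! ### Moving the heads and counting runs of symbols. -/

section Tapes

/-- Move the head of a tape to the right, by the contents of a counter. -/
def seek (t : Bool) (d : ℕ) : Language (Act (Option Bool) ℕ) :=
  KStar.kstar (block [.dec d] * (block [.moveR t] + block [.read t none])) * block [.isZero d]

/-- Move the head of a tape to its start. -/
def rewind (t : Bool) : Language (Act (Option Bool) ℕ) :=
  KStar.kstar (block [.moveL t]) * block [.atStart t]

theorem isProgram_seek (t : Bool) (d : ℕ) : IsProgram (seek t d) :=
  ((isProgram_block _).mul ((isProgram_block _).add (isProgram_block _))).kstar.mul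
    (isProgram_block _)

theorem isProgram_rewind (t : Bool) : IsProgram (rewind t) :=
  (isProgram_block _).kstar.mul (isProgram_block _)

theorem reverse_take_succ {α : Type*} {l : List α} {i : ℕ} (h : i < l.length) :
    (l.take (i + 1)).reverse = l[i] :: (l.take i).reverse := by
  rw [List.take_add_one, List.getElem?_eq_getElem h]
  simp only [Option.toList_some, List.reverse_append, List.reverse_cons, List.reverse_nil,
    List.nil_append, List.cons_append]

theorem spec_rewind (s : Conf (Option Bool) ℕ) (t : Bool) :
    Spec (rewind t) s True (s.tape t [] ((s.left t).reverse ++ s.right t))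
      ((s.left t).length + 1) := by
  have := Spec.loop (P := block [.moveL t]) (E := block [.atStart t])
    (f := fun i => s.tape t ((s.left t).drop i) (((s.left t).take i).reverse ++ s.right t))
    (n := (s.left t).length) (φ := fun _ => True) (ψ := True)
    (s' := s.tape t [] ((s.left t).reverse ++ s.right t)) (c := 1) (m := 1)
    (fun i hi => by
      refine Spec.mono (spec_block_if (fun h => ?_) fun h => ?_) (by simp)
      · rw [execs_cons, exec_moveL (a := (s.left t)[i]'h.1) (l := (s.left t).drop (i + 1))
          (by simp)]
        simp [reverse_take_succ h.1]
      · rw [execs_cons, exec_moveL_none (by simp at h; simp; omega), Option.bind_none])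
    (fun i hi => by
      refine Spec.mono (spec_block_if (fun h => ?_) fun h => ?_) (by simp)
      · simp [Act.exec, h.1]
      · have : ¬(s.left t).length ≤ i := by simp at h; omega
        simp [Act.exec, this])
  simp only [List.drop_zero, List.take_zero, List.reverse_nil, List.nil_append] at this
  rw [Conf.tape_eq rfl rfl] at this
  exact (this.congr (by simp)).mono (by simp)

theorem spec_seek (s : Conf (Option Bool) ℕ) (t : Bool) (d : ℕ) (h : s.left t = []) :
    Spec (seek t d) s True ((s.set d 0).tape t ((s.right t).take (s.cnt d)).reverse
      ((s.right t).drop (s.cnt d))) (s.cnt d * 2 + 1) := by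
  set v := s.cnt d with hv
  have := Spec.loop (P := block [.dec d] * (block [.moveR t] + block [.read t none]))
    (E := block [.isZero d])
    (f := fun i => (s.set d (v - i)).tape t ((s.right t).take i).reverse ((s.right t).drop i))
    (n := v) (φ := fun _ => True) (ψ := True)
    (s' := (s.set d 0).tape t ((s.right t).take v).reverse ((s.right t).drop v))
    (c := 2) (m := 1)
    (fun i hi => by
      have h1 := spec_block_if (l := [Act.dec d]) (φ := i < v)
        (s := (s.set d (v - i)).tape t ((s.right t).take i).reverse ((s.right t).drop i))
        (s' := (s.set d (v - (i + 1))).tape t ((s.right t).take i).reverse ((s.right t).drop i))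
        (fun h => by
          rw [execs_cons, exec_dec (by simp [Conf.set_cnt]; omega)]
          simp only [Conf.tape_cnt, Conf.set_cnt, if_pos, Option.bind_some, execs_nil,
            Conf.tape_set]
          congr 2
          simp [Conf.set, Nat.sub_sub])
        (fun h => by
          rw [execs_cons, exec_dec_none (by simp [Conf.set_cnt]; omega), Option.bind_none])
      refine (h1.seq fun hiv => Spec.mono (n := 1) ?_ le_rfl)
      -- Exactly one of the two branches is possible: before the end the head moves, at the end it
      -- stays. So `seek` never fails.
      have h2 := spec_block_if (l := [Act.moveR t]) (φ := i < (s.right t).length)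
        (s := (s.set d (v - (i + 1))).tape t ((s.right t).take i).reverse ((s.right t).drop i))
        (s' := (s.set d (v - (i + 1))).tape t ((s.right t).take (i + 1)).reverse
          ((s.right t).drop (i + 1)))
        (fun h => by
          rw [execs_cons, exec_moveR (a := (s.right t)[i]) (l := (s.right t).drop (i + 1))
            (by simp)]
          simp [reverse_take_succ h])
        (fun h => by
          rw [execs_cons, exec_moveR_none (by simp; omega), Option.bind_none])
      have h3 := spec_block_if (l := [Act.read t none]) (φ := ¬ i < (s.right t).length)
        (s := (s.set d (v - (i + 1))).tape t ((s.right t).take i).reverse ((s.right t).drop i))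
        (s' := (s.set d (v - (i + 1))).tape t ((s.right t).take (i + 1)).reverse
          ((s.right t).drop (i + 1)))
        (fun h => by
          rw [List.drop_of_length_le (by omega), List.drop_of_length_le (by omega),
            List.take_of_length_le (by omega), List.take_of_length_le (by omega)]
          simp [Act.exec])
        (fun h => by
          have : ¬ (s.right t).length ≤ i := by simpa using h
          simp [Act.exec, this])
      exact (h2.alt h3).congr (by tauto))
    (fun i hi => by
      refine Spec.mono (spec_block_if (fun h => ?_) fun h => ?_) (by simp)
      · simp [Act.exec, h.1, Conf.set_cnt]
      · have : v - i ≠ 0 := by simp at h; omega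
        simp [Act.exec, Conf.set_cnt, this])
  have e : (s.set d v).tape t [] (s.right t) = s := by
    rw [Conf.set_eq hv.symm, Conf.tape_eq h rfl]
  simp only [Nat.sub_zero, List.drop_zero, List.take_zero, List.reverse_nil, e] at this
  exact this.congr (by simp)

/-- The number of symbols `some true` at the beginning of a list. -/
def runLength (l : List (Option Bool)) : ℕ := (l.takeWhile (· = some true)).length

/-- Move over the symbols `some true` to the right of the head, and count them. -/
def countRun (t : Bool) (d : ℕ) : Language (Act (Option Bool) ℕ) :=
  KStar.kstar (block [.read t (some (some true)), .moveR t, .inc d]) *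
    (block [.read t none] + (block [.read t (some none)] + block [.read t (some (some false))]))

theorem isProgram_countRun (t : Bool) (d : ℕ) : IsProgram (countRun t d) :=
  (isProgram_block _).kstar.mul
    ((isProgram_block _).add ((isProgram_block _).add (isProgram_block _)))

theorem runLength_le (l : List (Option Bool)) : runLength l ≤ l.length :=
  (List.takeWhile_prefix _).length_le

/-- The hypothesis excludes positions behind the first run, where `some true` may occur again. -/
theorem getElem?_runLength (l : List (Option Bool)) {i : ℕ} (hi : i ≤ runLength l) :
    l[i]? = some (some true) ↔ i < runLength l := by
  induction l generalizing i with
  | nil => simp [runLength]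
  | cons a l ih =>
    by_cases ha : a = some true
    · subst ha
      have e : runLength (some true :: l) = runLength l + 1 := by simp [runLength]
      rw [e] at hi ⊢
      cases i with
      | zero => simp
      | succ i => simpa using ih (by omega)
    · have e : runLength (a :: l) = 0 := by simp [runLength, ha]
      rw [e] at hi ⊢
      obtain rfl : i = 0 := by omega
      simp [ha]

theorem spec_countRun (s : Conf (Option Bool) ℕ) (t : Bool) (d : ℕ) (h : s.cnt d = 0) :
    Spec (countRun t d) s True ((s.set d (runLength (s.right t))).tape t
      (((s.right t).take (runLength (s.right t))).reverse ++ s.left t)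
      ((s.right t).drop (runLength (s.right t)))) ((s.right t).length * 3 + 1) := by
  set r := s.right t with hr
  have := Spec.loop (P := block [.read t (some (some true)), .moveR t, .inc d])
    (E := block [.read t none] +
      (block [.read t (some none)] + block [.read t (some (some false))]))
    (f := fun i => (s.set d i).tape t ((r.take i).reverse ++ s.left t) (r.drop i))
    (n := runLength r) (φ := fun _ => True) (ψ := True)
    (s' := (s.set d (runLength r)).tape t ((r.take (runLength r)).reverse ++ s.left t)
      (r.drop (runLength r)))
    (c := 3) (m := 1)
    (fun i hi => by
      refine Spec.mono (spec_block_if (fun h => ?_) fun h => ?_) (by simp)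
      · have h1 := (getElem?_runLength r hi).2 h.1
        have hl : i < r.length := h.1.trans_le (runLength_le r)
        have h2 : r.drop i = some true :: r.drop (i + 1) := by
          rw [List.drop_eq_getElem_cons hl]
          simp only [List.getElem?_eq_getElem hl, Option.some.injEq] at h1
          rw [h1]
        have e1 : (Act.read t (some (some true))).exec
            ((s.set d i).tape t ((r.take i).reverse ++ s.left t) (r.drop i)) =
            some ((s.set d i).tape t ((r.take i).reverse ++ s.left t) (r.drop i)) := by
          simp [Act.exec, h1]
        rw [execs_cons, e1, Option.bind_some, execs_cons,
          exec_moveR (a := some true) (l := r.drop (i + 1)) (by simp [h2])]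
        simp only [Conf.tape_left, Conf.tape_tape, Option.bind_some, execs_cons, exec_inc,
          Conf.tape_cnt, Conf.tape_set, execs_nil, List.take_add_one, h1, Conf.set_cnt]
        simp [Conf.set]
      · have h1 : r[i]? ≠ some (some true) := fun e => h ⟨(getElem?_runLength r hi).1 e, trivial⟩
        have e1 : (Act.read t (some (some true))).exec
            ((s.set d i).tape t ((r.take i).reverse ++ s.left t) (r.drop i)) = none := by
          simp [Act.exec, h1]
        rw [execs_cons, e1, Option.bind_none])
    (fun i hi => by
      have h0 := getElem?_runLength r hi
      have key (o : Option (Option Bool)) := spec_block_if (l := [Act.read t o]) (φ := r[i]? = o)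
        (s := (s.set d i).tape t ((r.take i).reverse ++ s.left t) (r.drop i))
        (s' := (s.set d i).tape t ((r.take i).reverse ++ s.left t) (r.drop i))
        (fun h => by simp [Act.exec, h]) (fun h => by simp [Act.exec, h])
      -- An action can only test for a given symbol, so leaving the run is the disjunction of the
      -- three other cases.
      have := (key none).alt ((key (some none)).alt (key (some (some false))))
      by_cases hin : i = runLength r
      · subst hin
        refine Spec.congr this ?_
        have h1 := h0.not.2 (lt_irrefl _)
        rcases hri : r[runLength r]? with _ | _ | _ | _ <;> simp_all
      · refine Spec.of_not (this.congr (ψ := False) ?_) id _ _ |>.congr (by simp [hin])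
        rw [h0.2 (by omega)]
        simp)
  have e : (s.set d 0).tape t (s.left t) r = s := by
    rw [Conf.set_eq h, Conf.tape_eq rfl rfl]
  simp only [List.drop_zero, List.take_zero, List.reverse_nil, List.nil_append, e] at this
  exact (this.congr (by simp)).mono (by have := runLength_le r; omega)

end Tapes
end Threading

namespace Threading

/-! ### Terms and the programs that evaluate them. -/

section Terms

/-- The code of an input symbol, `0` standing for the end of the input. -/
def symCode : Option (Option Bool) → ℕ
  | none => 0
  | some none => 1
  | some (some false) => 2
  | some (some true) => 3

/-- Arithmetical terms over numbered variables, the symbols of an input string, and the lengths of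
the runs of `some true` in a second string. -/
inductive Trm
  | var (i : ℕ)
  | const (c : ℕ)
  | add (a b : Trm)
  | mul (a b : Trm)
  | inp (a : Trm)
  | fn (a : Trm)

namespace Trm

/-- The value of a term. -/
def eval (x R : List (Option Bool)) (v : ℕ → ℕ) : Trm → ℕ
  | var i => v i
  | const c => c
  | add a b => a.eval x R v + b.eval x R v
  | mul a b => a.eval x R v * b.eval x R v
  | inp a => symCode x[a.eval x R v]?
  | fn a => runLength (R.drop (a.eval x R v))

/-- All variables of the term are below `d`. -/
def Wf (d : ℕ) : Trm → Prop
  | var i => i < d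
  | const _ => True
  | add a b => a.Wf d ∧ b.Wf d
  | mul a b => a.Wf d ∧ b.Wf d
  | inp a => a.Wf d
  | fn a => a.Wf d

theorem eval_congr {x R : List (Option Bool)} {v v' : ℕ → ℕ} {d : ℕ} {t : Trm} (ht : t.Wf d)
    (h : ∀ k < d, v k = v' k) : t.eval x R v = t.eval x R v' := by
  induction t with
  | var i => exact h i ht
  | const c => rfl
  | add a b iha ihb => simp [eval, iha ht.1, ihb ht.2]
  | mul a b iha ihb => simp [eval, iha ht.1, ihb ht.2]
  | inp a iha => simp only [eval]; rw [iha ht]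
  | fn a iha => simp only [eval]; rw [iha ht]

/-- Increase a counter by the code of the symbol under the head of the input tape. -/
def readCode (d : ℕ) : Language (Act (Option Bool) ℕ) :=
  block [.read false none] + (block [.read false (some none), .inc d] +
    (block [.read false (some (some false)), .inc d, .inc d] +
      block [.read false (some (some true)), .inc d, .inc d, .inc d]))

/-- A program that writes the value of the term into the counter `d`. -/
def prog : Trm → ℕ → Language (Act (Option Bool) ℕ)
  -- Reading a counter empties it: two copies are made and one of them is moved back.
  | var i, d => moveProg i [d, d + 1] * moveProg (d + 1) [i]
  | const c, d => block (List.replicate c (.inc d))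
  | add a b, d => a.prog d * (b.prog (d + 1) * moveProg (d + 1) [d])
  | mul a b, d => a.prog d * (b.prog (d + 1) *
      (KStar.kstar (block [.dec d] * (moveProg (d + 1) [d + 2, d + 3] * moveProg (d + 3) [d + 1])) *
        (block [.isZero d] * (moveProg (d + 1) [] * moveProg (d + 2) [d]))))
  | inp a, d => a.prog d * (seek false d * (readCode d * rewind false))
  | fn a, d => a.prog d * (seek true d * (countRun true d * rewind true))

theorem isProgram_prog (t : Trm) (d : ℕ) : IsProgram (t.prog d) := by
  induction t generalizing d with
  | var i => exact (isProgram_moveProg _ _).mul (isProgram_moveProg _ _)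
  | const c => exact isProgram_block _
  | add a b iha ihb => exact (iha d).mul ((ihb _).mul (isProgram_moveProg _ _))
  | mul a b iha ihb =>
    exact (iha d).mul ((ihb _).mul (((isProgram_block _).mul ((isProgram_moveProg _ _).mul
      (isProgram_moveProg _ _))).kstar.mul ((isProgram_block _).mul ((isProgram_moveProg _ _).mul
        (isProgram_moveProg _ _)))))
  | inp a iha =>
    exact (iha d).mul ((isProgram_seek _ _).mul (((isProgram_block _).add ((isProgram_block _).add
      ((isProgram_block _).add (isProgram_block _)))).mul (isProgram_rewind _)))
  | fn a iha =>
    exact (iha d).mul ((isProgram_seek _ _).mul ((isProgram_countRun _ _).mul (isProgram_rewind _)))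

end Trm

/-- Both heads are at the start, and all counters from `d` on are zero. -/
structure Conf.Ready (s : Conf (Option Bool) ℕ) (d : ℕ) : Prop where
  left : ∀ t, s.left t = []
  cnt : ∀ k, d ≤ k → s.cnt k = 0

theorem Conf.Ready.set {s : Conf (Option Bool) ℕ} {d : ℕ} (h : s.Ready d) (v : ℕ) :
    (s.set d v).Ready (d + 1) :=
  ⟨h.left, fun k hk => by rw [Conf.set_cnt, if_neg (by omega), h.cnt k (by omega)]⟩

theorem Conf.ext_cnt {s s' : Conf (Option Bool) ℕ} (h1 : s.left = s'.left)
    (h2 : s.right = s'.right) (h3 : ∀ k, s.cnt k = s'.cnt k) : s = s' :=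
  Conf.ext h1 h2 (funext h3)

namespace Trm

/-- The value of a term in a state. -/
def val (t : Trm) (s : Conf (Option Bool) ℕ) : ℕ := t.eval (s.right false) (s.right true) s.cnt

theorem val_set {t : Trm} {d0 d : ℕ} (ht : t.Wf d0) (hd : d0 ≤ d) (s : Conf (Option Bool) ℕ)
    (v : ℕ) : t.val (s.set d v) = t.val s :=
  eval_congr ht fun k hk => by rw [Conf.set_cnt, if_neg (by omega)]

/-- Repeated addition: `d` counts down from `v`, `d + 1` keeps `w` with the help of the copy in `d +
3`, and `d + 2` accumulates the product. -/
theorem spec_mul_aux (s : Conf (Option Bool) ℕ) (d v w : ℕ) (hs : s.Ready d) :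
    Spec (KStar.kstar (block [.dec d] *
        (moveProg (d + 1) [d + 2, d + 3] * moveProg (d + 3) [d + 1])) *
        (block [.isZero d] * (moveProg (d + 1) [] * moveProg (d + 2) [d])))
      ((s.set d v).set (d + 1) w) True (s.set d (v * w))
      (v * (w * 5 + 3) + (w + v * w * 2 + 3)) := by
  have h0 : s.cnt d = 0 := hs.cnt d le_rfl
  have h1 : s.cnt (d + 1) = 0 := hs.cnt _ (by omega)
  have h2 : s.cnt (d + 2) = 0 := hs.cnt _ (by omega)
  have h3 : s.cnt (d + 3) = 0 := hs.cnt _ (by omega)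
  have := Spec.loop (P := block [.dec d] *
      (moveProg (d + 1) [d + 2, d + 3] * moveProg (d + 3) [d + 1]))
    (E := block [.isZero d] * (moveProg (d + 1) [] * moveProg (d + 2) [d]))
    (f := fun i => ((s.set d (v - i)).set (d + 1) w).set (d + 2) (i * w))
    (n := v) (φ := fun _ => True) (ψ := True) (s' := s.set d (v * w))
    (c := 1 + (w * 3 + 1 + (w * 2 + 1))) (m := 1 + (w * 1 + 1 + (v * w * 2 + 1)))
    (fun i hi => by
      have b1 := spec_block_if (l := [Act.dec d]) (φ := i < v)
        (s := ((s.set d (v - i)).set (d + 1) w).set (d + 2) (i * w))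
        (s' := ((s.set d (v - (i + 1))).set (d + 1) w).set (d + 2) (i * w))
        (fun h => by
          rw [execs_cons, exec_dec (by simp [Conf.set_cnt]; omega)]
          simp only [Option.bind_some, execs_nil]
          congr 1
          refine Conf.ext_cnt rfl rfl fun k => ?_
          simp only [Conf.set_cnt]
          split_ifs <;> omega)
        (fun h => by
          rw [execs_cons, exec_dec_none (by simp [Conf.set_cnt]; omega), Option.bind_none])
      refine b1.seq fun hiv => ?_
      have b2 := spec_moveProg (((s.set d (v - (i + 1))).set (d + 1) w).set (d + 2) (i * w))
        (k := d + 1) (js := [d + 2, d + 3]) (by simp)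
      have e2 : (((s.set d (v - (i + 1))).set (d + 1) w).set (d + 2) (i * w)).cnt (d + 1) = w := by
        simp [Conf.set_cnt]
      rw [e2] at b2
      refine b2.seq_true ?_
      have b3 := spec_moveProg ((((s.set d (v - (i + 1))).set (d + 1) w).set (d + 2) (i * w)).move
        (d + 1) [d + 2, d + 3] w) (k := d + 3) (js := [d + 1]) (by simp)
      have e3 : ((((s.set d (v - (i + 1))).set (d + 1) w).set (d + 2) (i * w)).move
        (d + 1) [d + 2, d + 3] w).cnt (d + 3) = w := by
        simp [Conf.set_cnt, Conf.move, h3]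
      rw [e3] at b3
      refine b3.post (Conf.ext_cnt rfl rfl fun k => ?_)
      simp only [Conf.set_cnt, Conf.move, List.count_cons, List.count_nil, beq_iff_eq]
      have := Nat.add_one_mul i w
      split_ifs <;> subst_vars <;> omega)
    (fun i hi => by
      have b1 := spec_block_if (l := [Act.isZero d]) (φ := i = v)
        (s := ((s.set d (v - i)).set (d + 1) w).set (d + 2) (i * w))
        (s' := ((s.set d (v - i)).set (d + 1) w).set (d + 2) (i * w))
        (fun h => by simp [Act.exec, h, Conf.set_cnt])
        (fun h => by
          have : v - i ≠ 0 := by omega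
          simp [Act.exec, Conf.set_cnt, this])
      refine b1.seq fun hiv => ?_
      subst hiv
      have b2 := spec_moveProg (((s.set d (i - i)).set (d + 1) w).set (d + 2) (i * w))
        (k := d + 1) (js := []) (by simp)
      have e2 : (((s.set d (i - i)).set (d + 1) w).set (d + 2) (i * w)).cnt (d + 1) = w := by
        simp [Conf.set_cnt]
      rw [e2] at b2
      refine b2.seq_true ?_
      have b3 := spec_moveProg ((((s.set d (i - i)).set (d + 1) w).set (d + 2) (i * w)).move
        (d + 1) [] w) (k := d + 2) (js := [d]) (by simp)
      have e3 : ((((s.set d (i - i)).set (d + 1) w).set (d + 2) (i * w)).move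
        (d + 1) [] w).cnt (d + 2) = i * w := by
        simp [Conf.set_cnt, Conf.move]
      rw [e3] at b3
      refine b3.post (Conf.ext_cnt rfl rfl fun k => ?_)
      simp only [Conf.set_cnt, Conf.move, List.count_cons, List.count_nil, beq_iff_eq]
      split_ifs <;> subst_vars <;> omega)
  have e : ((s.set d (v - 0)).set (d + 1) w).set (d + 2) (0 * w) = (s.set d v).set (d + 1) w := by
    refine Conf.ext_cnt rfl rfl fun k => ?_
    simp only [Conf.set_cnt]
    split_ifs <;> subst_vars <;> omega
  rw [e] at this
  refine (this.congr (by simp)).mono ?_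
  have : v * (1 + (w * 3 + 1 + (w * 2 + 1))) = v * (w * 5 + 3) := by ring
  omega

theorem spec_readCode (s : Conf (Option Bool) ℕ) (d : ℕ) (h : s.cnt d = 0) :
    Spec (readCode d) s True (s.set d (symCode (s.right false).head?)) 4 := by
  have key (o : Option (Option Bool)) (l : List (Act (Option Bool) ℕ)) (hl : l.length ≤ 3)
      (h : execs l s = some (s.set d (symCode o))) :
      Spec (block (.read false o :: l)) s ((s.right false).head? = o)
        (s.set d (symCode (s.right false).head?)) 4 :=
    (spec_block_if (fun ho => by simp [Act.exec, ho, h]) fun ho => by simp [Act.exec, ho]).mono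
      (by simp only [List.length_cons]; omega)
  refine ((key none [] (by simp) ?_).alt ((key (some none) [.inc d] (by simp) ?_).alt
    ((key (some (some false)) [.inc d, .inc d] (by simp) ?_).alt
      (key (some (some true)) [.inc d, .inc d, .inc d] (by simp) ?_)))).congr ?_
  · rw [symCode, Conf.set_eq h]; rfl
  · simp [symCode, h]
  · simp [symCode, h, Conf.set]
  · simp [symCode, h, Conf.set]
  · rcases (s.right false).head? with _ | _ | _ | _ <;> simp

/-- The program of a term computes its value, in polynomial time. -/
theorem spec_prog (t : Trm) : ∃ f, PolyBounded f ∧ ∀ (d0 d B : ℕ) (s : Conf (Option Bool) ℕ),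
    t.Wf d0 → d0 ≤ d → s.Ready d → (∀ b, (s.right b).length ≤ B) → (∀ k < d0, s.cnt k ≤ B) →
    t.val s ≤ f B ∧ Spec (t.prog d) s True (s.set d (t.val s)) (f B) := by
  -- Value and time get a common bound: counters are unary, so processing an intermediate value
  -- costs time proportional to it.
  induction t with
  | var i =>
    refine ⟨fun B => 5 * B + 2, ((PolyBounded.const 5).mul .id).add (.const 2), ?_⟩
    intro d0 d B s ht hd hs hr hv
    have hi : i < d0 := ht
    have h0 : s.cnt d = 0 := hs.cnt d le_rfl
    have h1 : s.cnt (d + 1) = 0 := hs.cnt _ (by omega)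
    have hB := hv i hi
    refine ⟨by simp only [val, eval]; omega, ?_⟩
    have b1 := spec_moveProg s (k := i) (js := [d, d + 1]) (by simp; omega)
    have b2 := spec_moveProg (s.move i [d, d + 1] (s.cnt i)) (k := d + 1) (js := [i])
      (by simp; omega)
    have e2 : (s.move i [d, d + 1] (s.cnt i)).cnt (d + 1) = s.cnt i := by
      have : d + 1 ≠ i := by omega
      simp [Conf.move, h1, this]
    rw [e2] at b2
    refine ((b1.seq_true b2).mono (m := 5 * B + 2) (by simp; omega)).post
      (Conf.ext_cnt rfl rfl fun k => ?_)
    simp only [Conf.set_cnt, Conf.move, List.count_cons, List.count_nil, beq_iff_eq, val, eval]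
    split_ifs <;> subst_vars <;> omega
  | const c =>
    refine ⟨fun _ => c, .const c, ?_⟩
    intro d0 d B s ht hd hs hr hv
    refine ⟨le_rfl, ?_⟩
    have := execs_map_inc (List.replicate c d) s
    rw [List.map_replicate] at this
    refine ((spec_block this).mono (by simp)).post (Conf.ext_cnt rfl rfl fun k => ?_)
    simp only [Conf.set_cnt, val, eval, List.count_replicate, beq_iff_eq]
    have h0 : s.cnt d = 0 := hs.cnt d le_rfl
    split_ifs <;> subst_vars <;> omega
  | add a b iha ihb =>
    obtain ⟨f, hf, iha⟩ := iha
    obtain ⟨g, hg, ihb⟩ := ihb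
    refine ⟨fun B => f B + (3 * g B + 1), hf.add (((PolyBounded.const 3).mul hg).add (.const 1)), ?_⟩
    intro d0 d B s ht hd hs hr hv
    obtain ⟨a1, a2⟩ := iha d0 d B s ht.1 hd hs hr hv
    obtain ⟨b1, b2⟩ := ihb d0 (d + 1) B (s.set d (a.val s)) ht.2 (by omega) (hs.set _) hr
      (fun k hk => by rw [Conf.set_cnt, if_neg (by omega)]; exact hv k hk)
    rw [val_set ht.2 hd] at b1 b2
    have e : (a.add b).val s = a.val s + b.val s := rfl
    refine ⟨by rw [e]; dsimp only; omega, ?_⟩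
    have c1 := spec_moveProg ((s.set d (a.val s)).set (d + 1) (b.val s)) (k := d + 1) (js := [d])
      (by simp)
    have e1 : ((s.set d (a.val s)).set (d + 1) (b.val s)).cnt (d + 1) = b.val s := by
      simp [Conf.set_cnt]
    rw [e1] at c1
    refine ((a2.seq_true (b2.seq_true c1)).mono (m := f B + (3 * g B + 1)) (by simp; omega)).post
      (Conf.ext_cnt rfl rfl fun k => ?_)
    have h1 : s.cnt (d + 1) = 0 := hs.cnt _ (by omega)
    simp only [Conf.set_cnt, Conf.move, List.count_cons, List.count_nil, beq_iff_eq, e]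
    split_ifs <;> subst_vars <;> omega
  | mul a b iha ihb =>
    obtain ⟨f, hf, iha⟩ := iha
    obtain ⟨g, hg, ihb⟩ := ihb
    refine ⟨fun B => f B + (g B + (f B * (g B * 5 + 3) + (g B + f B * g B * 2 + 3))),
      hf.add (hg.add ((hf.mul ((hg.mul (.const 5)).add (.const 3))).add
        ((hg.add ((hf.mul hg).mul (.const 2))).add (.const 3)))), ?_⟩
    intro d0 d B s ht hd hs hr hv
    obtain ⟨a1, a2⟩ := iha d0 d B s ht.1 hd hs hr hv
    obtain ⟨b1, b2⟩ := ihb d0 (d + 1) B (s.set d (a.val s)) ht.2 (by omega) (hs.set _) hr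
      (fun k hk => by rw [Conf.set_cnt, if_neg (by omega)]; exact hv k hk)
    rw [val_set ht.2 hd] at b1 b2
    have hab : a.val s * b.val s ≤ f B * g B := Nat.mul_le_mul a1 b1
    have e : (a.mul b).val s = a.val s * b.val s := rfl
    refine ⟨by rw [e]; dsimp only; omega, ?_⟩
    have c1 := spec_mul_aux s d (a.val s) (b.val s) hs
    rw [e]
    refine (a2.seq_true (b2.seq_true c1)).mono ?_
    have : a.val s * (b.val s * 5 + 3) ≤ f B * (g B * 5 + 3) :=
      Nat.mul_le_mul a1 (by omega)
    dsimp only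
    omega
  | inp a iha =>
    obtain ⟨f, hf, iha⟩ := iha
    refine ⟨fun B => f B + (f B * 2 + 1 + (4 + (f B + 1))),
      hf.add (((hf.mul (.const 2)).add (.const 1)).add ((PolyBounded.const 4).add
        (hf.add (.const 1)))), ?_⟩
    intro d0 d B s ht hd hs hr hv
    obtain ⟨a1, a2⟩ := iha d0 d B s ht hd hs hr hv
    have h0 : s.cnt d = 0 := hs.cnt d le_rfl
    have hval : (inp a).val s = symCode (s.right false)[a.val s]? := rfl
    refine ⟨?_, ?_⟩
    · have : (inp a).val s ≤ 3 := by
        rw [hval]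
        rcases (s.right false)[a.val s]? with _ | _ | _ | _ <;> simp [symCode]
      dsimp only
      omega
    have c1 := spec_seek (s.set d (a.val s)) false d (hs.left _)
    simp only [Conf.set_right] at c1
    rw [Conf.set_cnt, if_pos rfl] at c1
    set v := a.val s with hvdef
    set s1 := ((s.set d v).set d 0).tape false ((s.right false).take v).reverse
      ((s.right false).drop v) with hs1
    have c2 := spec_readCode s1 d (by simp [hs1, Conf.set_cnt])
    have c3 := spec_rewind (s1.set d (symCode (s1.right false).head?)) false
    refine Spec.mono (n := f B + (v * 2 + 1 + (4 + (v + 1)))) ?_ (by dsimp only; omega)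
    refine (a2.seq_true (c1.seq_true (c2.seq_true (c3.mono (m := v + 1) ?_)))).post ?_
    · simp [hs1]
    · have e1 : (s1.right false).head? = (s.right false)[v]? := by simp [hs1]
      rw [e1, hval]
      simp only [hs1, Conf.tape_left, Conf.tape_right,
        Conf.tape_set, Conf.tape_tape, List.reverse_reverse, List.take_append_drop]
      rw [Conf.tape_eq (s := ((s.set d v).set d 0).set d _) (r := s.right false) (hs.left _) rfl]
      simp [Conf.set]
  | fn a iha =>
    obtain ⟨f, hf, iha⟩ := iha
    refine ⟨fun B => f B + (f B * 2 + 1 + (B * 3 + 1 + (f B + B + 1))),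
      hf.add (((hf.mul (.const 2)).add (.const 1)).add (((PolyBounded.id.mul (.const 3)).add
        (.const 1)).add ((hf.add .id).add (.const 1)))), ?_⟩
    intro d0 d B s ht hd hs hr hv
    obtain ⟨a1, a2⟩ := iha d0 d B s ht hd hs hr hv
    have h0 : s.cnt d = 0 := hs.cnt d le_rfl
    have hval : (fn a).val s = runLength ((s.right true).drop (a.val s)) := rfl
    have hB := hr true
    have hl : runLength ((s.right true).drop (a.val s)) ≤ B := by
      have := runLength_le ((s.right true).drop (a.val s))
      simp only [List.length_drop] at this
      omega
    refine ⟨by rw [hval]; dsimp only; omega, ?_⟩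
    have c1 := spec_seek (s.set d (a.val s)) true d (hs.left _)
    simp only [Conf.set_right] at c1
    rw [Conf.set_cnt, if_pos rfl] at c1
    set v := a.val s with hvdef
    set s1 := ((s.set d v).set d 0).tape true ((s.right true).take v).reverse
      ((s.right true).drop v) with hs1
    have c2 := spec_countRun s1 true d (by simp [hs1, Conf.set_cnt])
    have e1 : s1.right true = (s.right true).drop v := by simp [hs1]
    have e2 : s1.left true = ((s.right true).take v).reverse := by simp [hs1]
    rw [e1, e2] at c2
    set n := runLength ((s.right true).drop v) with hn
    set s2 := (s1.set d n).tape true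
      ((((s.right true).drop v).take n).reverse ++ ((s.right true).take v).reverse)
      (((s.right true).drop v).drop n) with hs2
    have c3 := spec_rewind s2 true
    refine Spec.mono (n := f B + (v * 2 + 1 + (B * 3 + 1 + (v + B + 1)))) ?_ (by dsimp only; omega)
    refine (a2.seq_true (c1.seq_true ((c2.mono (m := B * 3 + 1) ?_).seq_true
      (c3.mono (m := v + B + 1) ?_)))).post ?_
    · simp only [List.length_drop]; omega
    · simp only [hs2, Conf.tape_left, List.length_append, List.length_reverse, List.length_take]
      omega
    · rw [hval]
      simp only [hs1, hs2, Conf.tape_left, Conf.tape_right,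
        Conf.tape_set, Conf.tape_tape, List.reverse_append, List.reverse_reverse,
        List.append_assoc, List.take_append_drop]
      rw [Conf.tape_eq (s := ((s.set d v).set d 0).set d _) (r := s.right true) (hs.left _) rfl]
      simp [Conf.set]

end Trm
end Terms
end Threading

namespace Threading

/-! ### Bounded formulas and the programs that verify them. -/

section Formulas

/-- Formulas over the terms, with quantifiers that are bounded by the variable `0`. -/
inductive Fml
  | lt (a b : Trm)
  | neg (φ : Fml)
  | and (φ ψ : Fml)
  | all (k : ℕ) (φ : Fml)

namespace Fml

/-- The truth value of a formula. -/
def Sat (x R : List (Option Bool)) : Fml → (ℕ → ℕ) → Prop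
  | lt a b, v => a.eval x R v < b.eval x R v
  | neg φ, v => ¬φ.Sat x R v
  | and φ ψ, v => φ.Sat x R v ∧ ψ.Sat x R v
  | all k φ, v => ∀ a < v 0, φ.Sat x R (Function.update v k a)

/-- The quantified variables are numbered consecutively, starting with `d`, from the outside to the
inside, and no other variables from `d` on occur. -/
def Wf : ℕ → Fml → Prop
  | d, lt a b => a.Wf d ∧ b.Wf d
  | d, neg φ => φ.Wf d
  | d, and φ ψ => φ.Wf d ∧ ψ.Wf d
  | d, all k φ => k = d ∧ φ.Wf (d + 1)

/-- The program that compares the values of two terms: it ends if `a < b` has the given truth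
value. -/
def ltProg (a b : Trm) (p : Bool) (d : ℕ) : Language (Act (Option Bool) ℕ) :=
  a.prog d * (b.prog (d + 1) * (KStar.kstar (block [.dec d, .dec (d + 1)]) *
    (block (if p then [.isZero d, .dec (d + 1)] else [.isZero (d + 1)]) *
      (moveProg d [] * moveProg (d + 1) []))))

/-- The program that ends if the formula has the given truth value. -/
def prog : Fml → Bool → ℕ → Language (Act (Option Bool) ℕ)
  | lt a b, p, d => ltProg a b p d
  | neg φ, p, d => φ.prog (!p) d
  | and φ ψ, true, d => φ.prog true d * ψ.prog true d
  | and φ ψ, false, d => φ.prog false d + ψ.prog false d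
  -- Truth of a universal statement is checked by a loop over all values of the variable.
  | all _ φ, true, d =>
    KStar.kstar (ltProg (.var d) (.var 0) true (d + 1) * (φ.prog true (d + 1) * block [.inc d])) *
      (ltProg (.var d) (.var 0) false (d + 1) * moveProg d [])
  -- For its falsity a counterexample is guessed, by an arbitrary number of increments, and then
  -- verified.
  | all _ φ, false, d =>
    KStar.kstar (block [.inc d]) *
      (ltProg (.var d) (.var 0) true (d + 1) * (φ.prog false (d + 1) * moveProg d []))

theorem isProgram_ltProg (a b : Trm) (p : Bool) (d : ℕ) : IsProgram (ltProg a b p d) :=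
  (a.isProgram_prog d).mul ((b.isProgram_prog _).mul ((isProgram_block _).kstar.mul
    ((isProgram_block _).mul ((isProgram_moveProg _ _).mul (isProgram_moveProg _ _)))))

theorem isProgram_prog (φ : Fml) (p : Bool) (d : ℕ) : IsProgram (φ.prog p d) := by
  induction φ generalizing p d with
  | lt a b => exact isProgram_ltProg a b p d
  | neg φ ih => exact ih _ _
  | and φ ψ ih1 ih2 =>
    cases p
    · exact (ih1 _ _).add (ih2 _ _)
    · exact (ih1 _ _).mul (ih2 _ _)
  | all k φ ih =>
    cases p
    · exact (isProgram_block _).kstar.mul ((isProgram_ltProg _ _ _ _).mul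
        ((ih _ _).mul (isProgram_moveProg _ _)))
    · exact ((isProgram_ltProg _ _ _ _).mul ((ih _ _).mul (isProgram_block _))).kstar.mul
        ((isProgram_ltProg _ _ _ _).mul (isProgram_moveProg _ _))

/-- Both counters are decreased together. The exit test fails until the smaller one is exhausted, so
the loop ends after `min v w` rounds; what is left shows the order and is cleared. -/
theorem spec_lt_aux (s : Conf (Option Bool) ℕ) (d v w : ℕ) (hs : s.Ready d) (p : Bool) :
    Spec (KStar.kstar (block [.dec d, .dec (d + 1)]) *
      (block (if p then [.isZero d, .dec (d + 1)] else [.isZero (d + 1)]) *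
        (moveProg d [] * moveProg (d + 1) []))) ((s.set d v).set (d + 1) w) (v < w ↔ p) s
      (3 * v + w + 4) := by
  have h0 : s.cnt d = 0 := hs.cnt d le_rfl
  have h1 : s.cnt (d + 1) = 0 := hs.cnt _ (by omega)
  have := Spec.loop (P := block [.dec d, .dec (d + 1)])
    (E := block (if p then [.isZero d, .dec (d + 1)] else [.isZero (d + 1)]) *
      (moveProg d [] * moveProg (d + 1) []))
    (f := fun i => (s.set d (v - i)).set (d + 1) (w - i)) (n := min v w)
    (φ := fun _ => True) (ψ := (v < w ↔ p)) (s' := s) (c := 2) (m := 2 + (v + 1 + (w + 1)))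
    (fun i hi => by
      refine Spec.mono (spec_block_if (fun h => ?_) fun h => ?_) (by simp)
      · have hi' := h.1
        rw [execs_cons, exec_dec (by simp [Conf.set_cnt]; omega), Option.bind_some, execs_cons,
          exec_dec (by simp [Conf.set_cnt]; omega)]
        simp only [Option.bind_some, execs_nil]
        congr 1
        refine Conf.ext_cnt rfl rfl fun k => ?_
        simp only [Conf.set_cnt]
        split_ifs <;> omega
      · have hi' : v ≤ i ∨ w ≤ i := by simp at h; omega
        by_cases hv : v ≤ i
        · rw [execs_cons, exec_dec_none (by simp [Conf.set_cnt]; omega), Option.bind_none]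
        · rw [execs_cons, exec_dec (by simp [Conf.set_cnt]; omega), Option.bind_some, execs_cons,
            exec_dec_none (by simp [Conf.set_cnt]; omega), Option.bind_none])
    (fun i hi => by
      have key (w' : ℕ) (hw' : w' ≤ w) : Spec (moveProg d [] * moveProg (d + 1) [])
          ((s.set d (v - i)).set (d + 1) w') True s (v + 1 + (w + 1)) := by
        have b1 := spec_moveProg ((s.set d (v - i)).set (d + 1) w') (k := d) (js := []) (by simp)
        have b2 := spec_moveProg (((s.set d (v - i)).set (d + 1) w').move d [] (v - i))
          (k := d + 1) (js := []) (by simp)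
        have e1 : ((s.set d (v - i)).set (d + 1) w').cnt d = v - i := by simp [Conf.set_cnt]
        have e2 : (((s.set d (v - i)).set (d + 1) w').move d [] (v - i)).cnt (d + 1) = w' := by
          simp [Conf.set_cnt, Conf.move]
        rw [e1] at b1
        rw [e2] at b2
        refine ((b1.seq_true b2).mono (by simp; omega)).post (Conf.ext_cnt rfl rfl fun k => ?_)
        simp only [Conf.set_cnt, Conf.move, List.count_nil]
        split_ifs <;> subst_vars <;> omega
      cases p with
      | true =>
        have b1 := spec_block_if (l := [Act.isZero d, .dec (d + 1)])
          (φ := i = min v w ∧ (v < w ↔ true = true))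
          (s := (s.set d (v - i)).set (d + 1) (w - i))
          (s' := (s.set d (v - i)).set (d + 1) (w - i - 1))
          (fun h => by
            have hvi : i = v ∧ i < w := by have := h.2.2 rfl; omega
            have e1 : (Act.isZero d).exec ((s.set d (v - i)).set (d + 1) (w - i)) =
                some ((s.set d (v - i)).set (d + 1) (w - i)) := by
              simp [Act.exec, Conf.set_cnt, hvi.1]
            rw [execs_cons, e1, Option.bind_some, execs_cons,
              exec_dec (by simp [Conf.set_cnt]; omega)]
            simp only [Option.bind_some, execs_nil]
            congr 1
            refine Conf.ext_cnt rfl rfl fun k => ?_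
            simp only [Conf.set_cnt]
            split_ifs <;> omega)
          (fun h => by
            by_cases hvi : v - i = 0
            · have hw : w - i = 0 := by simp at h; omega
              have e1 : (Act.isZero d).exec ((s.set d (v - i)).set (d + 1) (w - i)) =
                  some ((s.set d (v - i)).set (d + 1) (w - i)) := by
                simp [Act.exec, Conf.set_cnt, hvi]
              rw [execs_cons, e1, Option.bind_some, execs_cons,
                exec_dec_none (by simp [Conf.set_cnt, hw]), Option.bind_none]
            · have e1 : (Act.isZero d).exec ((s.set d (v - i)).set (d + 1) (w - i)) = none := by
                simp [Act.exec, Conf.set_cnt, hvi]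
              rw [execs_cons, e1, Option.bind_none])
        exact ((b1.seq fun _ => key _ (by omega)).congr (by simp)).mono (by simp)
      | false =>
        have b1 := spec_block_if (l := [Act.isZero (d + 1)])
          (φ := i = min v w ∧ (v < w ↔ false = true))
          (s := (s.set d (v - i)).set (d + 1) (w - i))
          (s' := (s.set d (v - i)).set (d + 1) (w - i))
          (fun h => by
            have hw : w - i = 0 := by simp at h; omega
            simp [Act.exec, Conf.set_cnt, hw])
          (fun h => by
            have hw : w - i ≠ 0 := by simp at h; omega
            simp [Act.exec, Conf.set_cnt, hw])
        exact ((b1.seq fun _ => key _ (by omega)).congr (by simp)).mono (by simp))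
  simp only [Nat.sub_zero] at this
  exact (this.congr (by simp)).mono (by omega)

theorem spec_ltProg (a b : Trm) (p : Bool) : ∃ f, PolyBounded f ∧
    ∀ (d0 d B : ℕ) (s : Conf (Option Bool) ℕ), a.Wf d0 → b.Wf d0 → d0 ≤ d → s.Ready d →
    (∀ b, (s.right b).length ≤ B) → (∀ k < d0, s.cnt k ≤ B) →
    Spec (ltProg a b p d) s (a.val s < b.val s ↔ p) s (f B) := by
  obtain ⟨f, hf, iha⟩ := a.spec_prog
  obtain ⟨g, hg, ihb⟩ := b.spec_prog
  refine ⟨fun B => f B + (g B + (3 * f B + g B + 4)),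
    hf.add (hg.add ((((PolyBounded.const 3).mul hf).add hg).add (.const 4))), ?_⟩
  intro d0 d B s ha hb hd hs hr hv
  obtain ⟨a1, a2⟩ := iha d0 d B s ha hd hs hr hv
  obtain ⟨b1, b2⟩ := ihb d0 (d + 1) B (s.set d (a.val s)) hb (by omega) (hs.set _) hr
    (fun k hk => by rw [Conf.set_cnt, if_neg (by omega)]; exact hv k hk)
  rw [Trm.val_set hb hd] at b1 b2
  exact (a2.seq_true (b2.seq_true (spec_lt_aux s d _ _ hs p))).mono (by dsimp only; omega)

/-- The truth value of a formula in a state. -/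
def Holds (φ : Fml) (s : Conf (Option Bool) ℕ) : Prop := φ.Sat (s.right false) (s.right true) s.cnt

/-- Guessing a value for the counter `d` and running `Q`. The final state does not depend on the
guess, so the outcome is still determined; `hχ` bounds the successful guesses and thus the time. -/
theorem spec_inc_kstar {Q : Language (Act (Option Bool) ℕ)} {s s' : Conf (Option Bool) ℕ}
    {d B m : ℕ} {χ : ℕ → Prop} (h0 : s.cnt d = 0) (hQ : ∀ a, Spec Q (s.set d a) (χ a) s' m)
    (hχ : ∀ a, χ a → a ≤ B) :
    Spec (KStar.kstar (block [.inc d]) * Q) s (∃ a, χ a) s' (B + m) := by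
  have hinc (a : ℕ) : execs [Act.inc d] (s.set d a) = some (s.set d (a + 1)) := by
    simp [Conf.set]
  have e0 : s.set d 0 = s := Conf.set_eq h0
  constructor
  · intro k t h
    obtain ⟨a, b, u, -, h1, h2⟩ := run_mul.1 h
    have key := run_kstar_induction (P := block [.inc d])
      (C := fun t u => ∀ a, t = s.set d a → ∃ b, u = s.set d b)
      (fun t a ht => ⟨a, ht⟩)
      (fun k t u w htu ih a ht => by
        subst ht
        have := (run_block.1 htu).2
        rw [hinc, Option.some_inj] at this
        exact ih (a + 1) this.symm) h1
    obtain ⟨c, rfl⟩ := key 0 e0.symm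
    exact ⟨⟨c, ((hQ c).1 b t h2).1⟩, ((hQ c).1 b t h2).2⟩
  · rintro ⟨a, ha⟩
    have key : ∀ i ≤ a, Run (KStar.kstar (block [.inc d])) i (s.set d (a - i)) (s.set d a) := by
      intro i
      induction i with
      | zero => exact fun _ => run_kstar_zero _ _
      | succ i ih =>
        intro hi
        have h1 : Run (block [.inc d]) 1 (s.set d (a - (i + 1))) (s.set d (a - i)) :=
          run_block.2 ⟨rfl, by rw [hinc]; congr 2; omega⟩
        have := run_kstar_cons h1 (ih (by omega))
        rwa [Nat.add_comm] at this
    have h1 := key a le_rfl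
    rw [Nat.sub_self, e0] at h1
    obtain ⟨k, hk, h2⟩ := (hQ a).2 ha
    exact ⟨a + k, Nat.add_le_add (hχ a ha) hk, run_mul.2 ⟨a, k, _, rfl, h1, h2⟩⟩

theorem spec_clear (s : Conf (Option Bool) ℕ) (d a : ℕ) (h : s.cnt d = 0) :
    Spec (moveProg d []) (s.set d a) True s (a + 1) := by
  have b1 := spec_moveProg (s.set d a) (k := d) (js := []) (by simp)
  have e1 : (s.set d a).cnt d = a := by simp [Conf.set_cnt]
  rw [e1] at b1
  refine (b1.mono (by simp)).post (Conf.ext_cnt rfl rfl fun k => ?_)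
  simp only [Conf.set_cnt, Conf.move, List.count_nil]
  split_ifs <;> subst_vars <;> omega

/-- The program of a formula decides its truth value, in polynomial time. -/
theorem spec_prog (φ : Fml) : ∀ p, ∃ f, PolyBounded f ∧ ∀ (d B : ℕ) (s : Conf (Option Bool) ℕ),
    1 ≤ d → φ.Wf d → s.Ready d → (∀ b, (s.right b).length ≤ B) → (∀ k < d, s.cnt k ≤ B) →
    Spec (φ.prog p d) s (φ.Holds s ↔ p) s (f B) := by
  induction φ with
  | lt a b =>
    intro p
    obtain ⟨f, hf, h⟩ := spec_ltProg a b p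
    exact ⟨f, hf, fun d B s _ hw hs hr hv => h d d B s hw.1 hw.2 le_rfl hs hr hv⟩
  | neg φ ih =>
    intro p
    obtain ⟨f, hf, h⟩ := ih (!p)
    refine ⟨f, hf, fun d B s hd hw hs hr hv => (h d B s hd hw hs hr hv).congr ?_⟩
    have : (neg φ).Holds s ↔ ¬φ.Holds s := Iff.rfl
    rw [this]
    cases p <;> simp
  | and φ ψ ih1 ih2 =>
    intro p
    obtain ⟨f, hf, h1⟩ := ih1 p
    obtain ⟨g, hg, h2⟩ := ih2 p
    refine ⟨fun B => f B + g B, hf.add hg, fun d B s hd hw hs hr hv => ?_⟩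
    have e : (and φ ψ).Holds s ↔ φ.Holds s ∧ ψ.Holds s := Iff.rfl
    have a1 := h1 d B s hd hw.1 hs hr hv
    have a2 := h2 d B s hd hw.2 hs hr hv
    cases p
    · refine ((a1.mono (by dsimp only; omega)).alt (a2.mono (by dsimp only; omega))).congr ?_
      rw [e]
      simp only [Bool.false_eq_true, iff_false]
      tauto
    · exact (a1.seq fun _ => a2).congr (by rw [e]; simp)
  | all k φ ih =>
    have ready {s : Conf (Option Bool) ℕ} {d B : ℕ} (hv : ∀ k < d, s.cnt k ≤ B) (a : ℕ)
        (ha : a ≤ B) : ∀ k < d + 1, (s.set d a).cnt k ≤ B := by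
      intro k hk
      rw [Conf.set_cnt]
      split_ifs
      · exact ha
      · exact hv k (by omega)
    have e {s : Conf (Option Bool) ℕ} {d : ℕ} (hk : k = d) : (all k φ).Holds s ↔
        ∀ a < s.cnt 0, φ.Holds (s.set d a) := by
      subst hk
      exact Iff.rfl
    have val_d (s : Conf (Option Bool) ℕ) (a : ℕ) : (Trm.var k).val (s.set k a) = a := by
      simp [Trm.val, Trm.eval, Conf.set_cnt]
    have val_0 {s : Conf (Option Bool) ℕ} (hk : 1 ≤ k) (a : ℕ) :
        (Trm.var 0).val (s.set k a) = s.cnt 0 := by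
      have : (0 : ℕ) ≠ k := by omega
      simp [Trm.val, Trm.eval, Conf.set_cnt, this]
    intro p
    cases p
    · obtain ⟨f, hf, h⟩ := ih false
      obtain ⟨g, hg, hl⟩ := spec_ltProg (.var k) (.var 0) true
      refine ⟨fun B => B + (g B + (f B + (B + 1))), PolyBounded.id.add (hg.add (hf.add
        (PolyBounded.id.add (.const 1)))), ?_⟩
      rintro d B s hd ⟨rfl, hw⟩ hs hr hv
      have hN := hv 0 (by omega)
      refine (spec_inc_kstar (χ := fun a => a < s.cnt 0 ∧ ¬φ.Holds (s.set k a))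
        (m := g B + (f B + (B + 1))) (hs.cnt k le_rfl) (fun a => ?_)
        (fun a ha => ha.1.le.trans hN)).congr ?_
      · by_cases ha : a < s.cnt 0
        · have c1 := hl (k + 1) (k + 1) B (s.set k a) (Nat.lt_succ_self k) (Nat.succ_pos k) le_rfl
            (hs.set a) hr (ready hv a (by omega))
          rw [val_d, val_0 hd] at c1
          have c2 := h (k + 1) B (s.set k a) (by omega) hw (hs.set a) hr (ready hv a (by omega))
          have c3 := (spec_clear s k a (hs.cnt k le_rfl)).mono (m := B + 1) (by omega)
          exact (c1.seq fun _ => c2.seq fun _ => c3).congr (by simp)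
        -- A guess beyond the range may exceed `B`, so the comparison is analysed with the bound `B
        -- + a`. It fails, hence its running time does not matter.
        · have c1 := hl (k + 1) (k + 1) (B + a) (s.set k a) (Nat.lt_succ_self k) (Nat.succ_pos k)
            le_rfl (hs.set a) (fun b => (hr b).trans (Nat.le_add_right _ _))
            (ready (fun j hj => (hv j hj).trans (Nat.le_add_right _ _)) a (Nat.le_add_left _ _))
          rw [val_d, val_0 hd] at c1
          have c2 : Spec (ltProg (.var k) (.var 0) true (k + 1) *
              (φ.prog false (k + 1) * moveProg k [])) (s.set k a) (a < s.cnt 0 ∧ False) s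
              (g (B + a) + 0) :=
            (c1.congr (ψ := a < s.cnt 0) (by simp)).seq fun h' => absurd h' ha
          exact (c2.of_not (by simp) _ _).congr (by simp [ha])
      · rw [e rfl]
        simp only [Bool.false_eq_true, iff_false]
        push Not
        rfl
    · obtain ⟨f, hf, h⟩ := ih true
      obtain ⟨g, hg, hl⟩ := spec_ltProg (.var k) (.var 0) true
      obtain ⟨g', hg', hl'⟩ := spec_ltProg (.var k) (.var 0) false
      refine ⟨fun B => B * (g B + (f B + 1)) + (g' B + (B + 1)), (PolyBounded.id.mul (hg.add
        (hf.add (.const 1)))).add (hg'.add (PolyBounded.id.add (.const 1))), ?_⟩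
      rintro d B s hd ⟨rfl, hw⟩ hs hr hv
      have hN := hv 0 (by omega)
      have h0 := hs.cnt k le_rfl
      have := Spec.loop (P := ltProg (.var k) (.var 0) true (k + 1) *
          (φ.prog true (k + 1) * block [.inc k]))
        (E := ltProg (.var k) (.var 0) false (k + 1) * moveProg k [])
        (f := fun a => s.set k a) (n := s.cnt 0) (φ := fun a => φ.Holds (s.set k a)) (ψ := True)
        (s' := s) (c := g B + (f B + 1)) (m := g' B + (B + 1))
        (fun a ha => by
          have c1 := hl (k + 1) (k + 1) B (s.set k a) (Nat.lt_succ_self k) (Nat.succ_pos k) le_rfl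
            (hs.set a) hr (ready hv a (by omega))
          rw [val_d, val_0 hd] at c1
          have c2 := h (k + 1) B (s.set k a) (by omega) hw (hs.set a) hr (ready hv a (by omega))
          have c3 : Spec (block [Act.inc k]) (s.set k a) True (s.set k (a + 1)) 1 :=
            spec_block (by simp [Conf.set])
          exact (c1.seq fun _ => c2.seq fun _ => c3).congr (by simp))
        (fun a ha => by
          have c1 := hl' (k + 1) (k + 1) B (s.set k a) (Nat.lt_succ_self k) (Nat.succ_pos k) le_rfl
            (hs.set a) hr (ready hv a (by omega))
          rw [val_d, val_0 hd] at c1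
          have c3 := (spec_clear s k a h0).mono (m := B + 1) (by omega)
          exact (c1.seq fun _ => c3).congr (by simp; omega))
      rw [Conf.set_eq h0] at this
      refine (this.congr (by rw [e rfl]; simp)).mono ?_
      exact Nat.add_le_add_right (Nat.mul_le_mul_right _ hN) _

end Fml
end Formulas
end Threading

namespace Threading

/-! ### Guessing a number and a string: bounded formulas define NP languages. -/

section Guess

/-- The memory contents after a number and a string have been guessed. -/
def Conf.guess (x : List (Option Bool)) (N : ℕ) (R : List (Option Bool)) :
    Conf (Option Bool) ℕ where
  left _ := []
  right t := if t then R else x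
  cnt := Function.update 0 0 N

/-- The program that writes an arbitrary symbol on the work tape. -/
def writeAny : Language (Act (Option Bool) ℕ) :=
  block [.write none] + (block [.write (some false)] + block [.write (some true)])

theorem run_writeAny {n : ℕ} {s t : Conf (Option Bool) ℕ} :
    Run writeAny n s t ↔ n = 1 ∧ ∃ a, t = s.tape true (s.left true) (a :: s.right true) := by
  have key (a : Option Bool) : execs [Act.write a] s =
      some (s.tape true (s.left true) (a :: s.right true)) := by
    simp [Act.exec, Conf.tape]
  simp only [writeAny, run_add, run_block, key, List.length_singleton, Option.some_inj]
  constructor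
  · rintro (⟨h, h'⟩ | ⟨h, h'⟩ | ⟨h, h'⟩) <;> exact ⟨h.symm, _, h'.symm⟩
  · rintro ⟨rfl, a, rfl⟩
    rcases a with _ | _ | _ <;> simp

theorem Conf.guess_tape (x : List (Option Bool)) (N : ℕ) (R R' : List (Option Bool)) :
    (Conf.guess x N R).tape true [] R' = Conf.guess x N R' := by
  refine Conf.ext (funext fun t => ?_) (funext fun t => ?_) rfl <;>
    cases t <;> simp [Conf.guess, Conf.tape]

theorem Conf.guess_set (x : List (Option Bool)) (N N' : ℕ) (R : List (Option Bool)) :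
    (Conf.guess x N R).set 0 N' = Conf.guess x N' R :=
  Conf.ext rfl rfl (by simp [Conf.guess, Conf.set])

theorem run_inc_kstar_guess {x R : List (Option Bool)} {N n : ℕ} {t : Conf (Option Bool) ℕ}
    (h : Run (KStar.kstar (block [.inc 0])) n (Conf.guess x N R) t) :
    ∃ N', t = Conf.guess x N' R := by
  refine run_kstar_induction (C := fun s t => ∀ N, s = Conf.guess x N R → ∃ N', t = Conf.guess x N' R)
    (fun s N h => ⟨N, h⟩) (fun k s t u hst ih N hs => ?_) h N rfl
  subst hs
  have := (run_block.1 hst).2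
  simp only [execs_cons, exec_inc, execs_nil, Option.bind_some, Option.some_inj] at this
  exact ih _ (this.symm.trans (Conf.guess_set _ _ _ _))

theorem run_writeAny_kstar_guess {x R : List (Option Bool)} {N n : ℕ} {t : Conf (Option Bool) ℕ}
    (h : Run (KStar.kstar writeAny) n (Conf.guess x N R) t) :
    ∃ R', t = Conf.guess x N R' := by
  refine run_kstar_induction (C := fun s t => ∀ R, s = Conf.guess x N R → ∃ R', t = Conf.guess x N R')
    (fun s R h => ⟨R, h⟩) (fun k s t u hst ih R hs => ?_) h R rfl
  subst hs
  obtain ⟨-, a, rfl⟩ := run_writeAny.1 hst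
  exact ih _ (Conf.guess_tape _ _ _ _)

theorem exists_run_inc_guess (x : List (Option Bool)) (N M : ℕ) :
    Run (KStar.kstar (block [.inc 0])) N (Conf.guess x M []) (Conf.guess x (M + N) []) := by
  induction N generalizing M with
  | zero => exact run_kstar_zero _ _
  | succ N ih =>
    have h1 : Run (block [.inc 0]) 1 (Conf.guess x M []) (Conf.guess x (M + 1) []) :=
      run_block.2 ⟨rfl, by simp [Conf.guess_set]; rfl⟩
    have := run_kstar_cons h1 (ih (M + 1))
    rwa [Nat.add_comm 1, Nat.add_assoc, Nat.add_comm 1] at this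

theorem exists_run_write_guess (x R R' : List (Option Bool)) (N : ℕ) :
    Run (KStar.kstar writeAny) R.length (Conf.guess x N R')
      (Conf.guess x N (R.reverse ++ R')) := by
  induction R generalizing R' with
  | nil => exact run_kstar_zero _ _
  | cons a R ih =>
    have h1 : Run writeAny 1 (Conf.guess x N R') (Conf.guess x N (a :: R')) :=
      run_writeAny.2 ⟨rfl, a, (Conf.guess_tape _ _ _ _).symm⟩
    have := run_kstar_cons h1 (ih (a :: R'))
    rw [Nat.add_comm 1] at this
    simpa using this

/-- A language is in NP if it is defined by a formula that speaks about the input and a guessed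
string, with quantifiers bounded by a guessed number, both of polynomial size. -/
theorem inNP_of_fml {L : Language (Option Bool)} {φ : Fml} (hφ : φ.Wf 1) {f : ℕ → ℕ}
    (hf : PolyBounded f)
    (h1 : ∀ x ∈ L, ∃ N R, N ≤ f x.length ∧ R.length ≤ f x.length ∧
      φ.Sat x R (Function.update 0 0 N))
    (h2 : ∀ x N R, φ.Sat x R (Function.update 0 0 N) → x ∈ L) : InNP L := by
  obtain ⟨g, hg, hspec⟩ := φ.spec_prog true
  have hP : IsProgram (rewind false * (KStar.kstar (block [.inc 0]) *
      (KStar.kstar writeAny * φ.prog true 1))) :=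
    (isProgram_rewind _).mul ((isProgram_block _).kstar.mul
      (((isProgram_block _).add ((isProgram_block _).add (isProgram_block _))).kstar.mul
        (φ.isProgram_prog _ _)))
  have hinit (x : List (Option Bool)) :
      Spec (rewind false) (Conf.init x) True (Conf.guess x 0 []) (x.length + 1) := by
    refine (spec_rewind (Conf.init x) false).mono (m := x.length + 1) (by simp [Conf.init]) |>.post ?_
    refine Conf.ext (funext fun t => ?_) (funext fun t => ?_) ?_
    · cases t <;> simp [Conf.guess, Conf.init, Conf.tape]
    · cases t <;> simp [Conf.guess, Conf.init, Conf.tape]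
    · simp [Conf.guess, Conf.init]; rfl
  have hready (x R : List (Option Bool)) (N : ℕ) : (Conf.guess x N R).Ready 1 :=
    ⟨fun _ => rfl, fun k hk => Function.update_of_ne (by omega) _ _⟩
  have hlen (x R : List (Option Bool)) (N : ℕ) (b : Bool) :
      ((Conf.guess x N R).right b).length ≤ N + x.length + R.length := by
    cases b <;> simp [Conf.guess] <;> omega
  have hcnt (x R : List (Option Bool)) (N : ℕ) :
      ∀ k < 1, (Conf.guess x N R).cnt k ≤ N + x.length + R.length := by
    intro k hk
    obtain rfl : k = 0 := by omega
    simp [Conf.guess]; omega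
  have hφspec (x R : List (Option Bool)) (N : ℕ) := hspec 1 (N + x.length + R.length)
    (Conf.guess x N R) le_rfl hφ (hready x R N) (hlen x R N) (hcnt x R N)
  -- The summands are the times for rewinding the input, guessing `N`, guessing `R`, and verifying
  -- the formula with all data bounded by `N + |x| + |R|`.
  obtain ⟨c, hc⟩ : PolyBounded fun n => n + 1 + (f n + (f n + (f n + n + f n + 2) ^ hg.choose)) :=
    (PolyBounded.id.add (.const 1)).add (hf.add (hf.add (((((hf.add .id).add hf).add
      (.const 2))).pow _)))
  refine inNP_of_isProgram hP ((Polynomial.X + Polynomial.C 2) ^ c) fun x => ⟨fun hx => ?_, ?_⟩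
  · obtain ⟨N, R, hN, hR, hs⟩ := h1 x hx
    obtain ⟨k1, hk1, r1⟩ := (hinit x).2 trivial
    have r2 := exists_run_inc_guess x N 0
    -- Symbols are written in front of each other, so `R` is guessed backwards.
    have r3 := exists_run_write_guess x R.reverse [] N
    rw [Nat.zero_add] at r2
    rw [List.reverse_reverse, List.append_nil] at r3
    obtain ⟨k2, hk2, r4⟩ := (hφspec x R N).2 (iff_of_true hs rfl)
    obtain ⟨w, hw, hl, he⟩ := run_mul.2 ⟨_, _, _, rfl, r1, run_mul.2 ⟨_, _, _, rfl, r2,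
      run_mul.2 ⟨_, _, _, rfl, r3, r4⟩⟩⟩
    refine ⟨w, hw, ?_, by simp [he]⟩
    rw [hl]
    have h3 := hc x.length
    have h4 := hg.choose_spec (N + x.length + R.length)
    have h5 : (N + x.length + R.length + 2) ^ hg.choose ≤
        (f x.length + x.length + f x.length + 2) ^ hg.choose :=
      Nat.pow_le_pow_left (by omega) _
    simp only [List.length_reverse, Polynomial.eval_pow, Polynomial.eval_add, Polynomial.eval_X,
      Polynomial.eval_C]
    dsimp only at h3
    omega
  -- Conversely every run, of any length, reveals some `N` and `R` that satisfy the formula.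
  · rintro ⟨w, hw, -, he⟩
    obtain ⟨t, ht⟩ := Option.isSome_iff_exists.1 he
    obtain ⟨_, _, s1, -, r1, r⟩ := run_mul.1 ⟨w, hw, rfl, ht⟩
    obtain ⟨-, rfl⟩ := (hinit x).1 _ _ r1
    obtain ⟨_, _, s2, -, r2, r⟩ := run_mul.1 r
    obtain ⟨N, rfl⟩ := run_inc_kstar_guess r2
    obtain ⟨_, _, s3, -, r3, r⟩ := run_mul.1 r
    obtain ⟨R, rfl⟩ := run_writeAny_kstar_guess r3
    exact h2 x N R ((((hφspec x R N).1 _ _ r).1).2 rfl)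

end Guess
end Threading

namespace Threading

/-! ### A toolkit for definable predicates, and tables stored in the guessed string. -/

section Definability

/-- What the formulas speak about: an input string, a guessed string and a guessed number. -/
structure Ctx where
  x : List (Option Bool)
  R : List (Option Bool)
  N : ℕ

namespace Ctx

/-- The code of the symbol of the input at the position `p`. -/
def inp (c : Ctx) (p : ℕ) : ℕ := symCode c.x[p]?

/-- The guessed string as a sequence of tables with three arguments. -/
def tab (c : Ctx) (t i j k : ℕ) : ℕ :=
  runLength (c.R.drop ((((t * c.N + i) * c.N + j) * c.N + k) * c.N))

/-- The variable assignment that gives the variable `0` the value `N`. -/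
def assign (c : Ctx) {d : ℕ} (e : Fin d → ℕ) (k : ℕ) : ℕ :=
  if k = 0 then c.N else if h : k - 1 < d then e ⟨k - 1, h⟩ else 0

theorem assign_succ (c : Ctx) {d : ℕ} (e : Fin d → ℕ) (i : Fin d) : c.assign e (i + 1) = e i := by
  simp [assign]

/-- Variable `0` is the bound and variable `i + 1` the coordinate `i`, so the next quantifier binds
variable `d + 1` and extends the tuple at its end. -/
theorem update_assign (c : Ctx) {d : ℕ} (e : Fin d → ℕ) (a : ℕ) :
    Function.update (c.assign e) (d + 1) a = c.assign (Fin.snoc e a : Fin (d + 1) → ℕ) := by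
  funext k
  rw [Function.update_apply]
  rcases k with _ | k
  · simp [assign]
  · rcases lt_trichotomy k d with h | rfl | h
    · have : k ≠ d := by omega
      simp [assign, this, h, Nat.lt_succ_of_lt h, Fin.snoc]
    · simp [assign, Fin.snoc]
    · have h1 : k ≠ d := by omega
      have h2 : ¬k < d := by omega
      have h3 : ¬k < d + 1 := by omega
      simp [assign, h1, h2, h3]

end Ctx

/-- A function that is the value of a term. -/
def IsTrm (d : ℕ) (t : Ctx → (Fin d → ℕ) → ℕ) : Prop :=
  ∃ s : Trm, s.Wf (d + 1) ∧ ∀ c e, s.eval c.x c.R (c.assign e) = t c e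

/-- A predicate that is the truth value of a formula. -/
def IsFml (d : ℕ) (P : Ctx → (Fin d → ℕ) → Prop) : Prop :=
  ∃ φ : Fml, φ.Wf (d + 1) ∧ ∀ c e, φ.Sat c.x c.R (c.assign e) ↔ P c e

variable {d : ℕ} {t t' t'' : Ctx → (Fin d → ℕ) → ℕ} {P Q : Ctx → (Fin d → ℕ) → Prop}

theorem IsTrm.const (k : ℕ) : IsTrm d fun _ _ => k := ⟨.const k, trivial, fun _ _ => rfl⟩

theorem IsTrm.bound : IsTrm d fun c _ => c.N := ⟨.var 0, Nat.succ_pos d, fun _ _ => rfl⟩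

theorem IsTrm.var (i : Fin d) : IsTrm d fun _ e => e i :=
  ⟨.var (i + 1), Nat.succ_lt_succ i.2, fun c e => c.assign_succ e i⟩

theorem IsTrm.add (h : IsTrm d t) (h' : IsTrm d t') : IsTrm d fun c e => t c e + t' c e := by
  obtain ⟨s, hs, h⟩ := h
  obtain ⟨s', hs', h'⟩ := h'
  exact ⟨.add s s', ⟨hs, hs'⟩, fun c e => by simp only [Trm.eval, h, h']⟩

theorem IsTrm.mul (h : IsTrm d t) (h' : IsTrm d t') : IsTrm d fun c e => t c e * t' c e := by
  obtain ⟨s, hs, h⟩ := h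
  obtain ⟨s', hs', h'⟩ := h'
  exact ⟨.mul s s', ⟨hs, hs'⟩, fun c e => by simp only [Trm.eval, h, h']⟩

theorem IsTrm.inp (h : IsTrm d t) : IsTrm d fun c e => c.inp (t c e) := by
  obtain ⟨s, hs, h⟩ := h
  exact ⟨.inp s, hs, fun c e => by simp only [Trm.eval, h, Ctx.inp]⟩

theorem IsTrm.tab (k : ℕ) (h : IsTrm d t) (h' : IsTrm d t') (h'' : IsTrm d t'') :
    IsTrm d fun c e => c.tab k (t c e) (t' c e) (t'' c e) := by
  obtain ⟨s, hs, e⟩ := ((((((IsTrm.const k).mul .bound).add h).mul .bound).add h').mul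
    .bound).add h'' |>.mul .bound
  exact ⟨.fn s, hs, fun c v => by rw [Trm.eval, e]; rfl⟩

theorem IsFml.lt (h : IsTrm d t) (h' : IsTrm d t') : IsFml d fun c e => t c e < t' c e := by
  obtain ⟨s, hs, h⟩ := h
  obtain ⟨s', hs', h'⟩ := h'
  exact ⟨.lt s s', ⟨hs, hs'⟩, fun c e => by simp only [Fml.Sat, h, h']⟩

theorem IsFml.not (h : IsFml d P) : IsFml d fun c e => ¬P c e := by
  obtain ⟨φ, hφ, h⟩ := h
  exact ⟨.neg φ, hφ, fun c e => by simp only [Fml.Sat, h]⟩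

theorem IsFml.and (h : IsFml d P) (h' : IsFml d Q) : IsFml d fun c e => P c e ∧ Q c e := by
  obtain ⟨φ, hφ, h⟩ := h
  obtain ⟨ψ, hψ, h'⟩ := h'
  exact ⟨.and φ ψ, ⟨hφ, hψ⟩, fun c e => by simp only [Fml.Sat, h, h']⟩

theorem IsFml.congr (h : IsFml d P) (e : ∀ c v, P c v ↔ Q c v) : IsFml d Q := by
  have : P = Q := by funext c v; exact propext (e c v)
  exact this ▸ h

theorem IsFml.or (h : IsFml d P) (h' : IsFml d Q) : IsFml d fun c e => P c e ∨ Q c e :=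
  (h.not.and h'.not).not.congr fun c e => by tauto

theorem IsFml.imp (h : IsFml d P) (h' : IsFml d Q) : IsFml d fun c e => P c e → Q c e :=
  (h.and h'.not).not.congr fun c e => by tauto

theorem IsFml.le (h : IsTrm d t) (h' : IsTrm d t') : IsFml d fun c e => t c e ≤ t' c e :=
  (IsFml.lt h' h).not.congr fun _ _ => not_lt

theorem IsFml.eq (h : IsTrm d t) (h' : IsTrm d t') : IsFml d fun c e => t c e = t' c e :=
  ((IsFml.le h h').and (IsFml.le h' h)).congr fun _ _ => le_antisymm_iff.symm

theorem IsFml.ne (h : IsTrm d t) (h' : IsTrm d t') : IsFml d fun c e => t c e ≠ t' c e :=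
  (IsFml.eq h h').not

theorem IsFml.all {P : Ctx → (Fin d → ℕ) → ℕ → Prop}
    (h : IsFml (d + 1) fun c e => P c (Fin.init e) (e (Fin.last d))) :
    IsFml d fun c e => ∀ a < c.N, P c e a := by
  obtain ⟨φ, hφ, h⟩ := h
  refine ⟨.all (d + 1) φ, ⟨rfl, hφ⟩, fun c e => forall₂_congr fun a _ => ?_⟩
  rw [Ctx.update_assign, h]
  simp only [Fin.init_snoc, Fin.snoc_last]

theorem IsFml.ex {P : Ctx → (Fin d → ℕ) → ℕ → Prop}
    (h : IsFml (d + 1) fun c e => P c (Fin.init e) (e (Fin.last d))) :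
    IsFml d fun c e => ∃ a < c.N, P c e a :=
  (IsFml.all (P := fun c e a => ¬P c e a) h.not).not.congr fun c e => by simp

/-- A language is in NP if it is defined by a predicate that is the truth value of a formula, for
a guessed number and a guessed string of polynomial size. -/
theorem inNP_of_isFml {L : Language (Option Bool)} {P : Ctx → Prop} (hP : IsFml 0 fun c _ => P c)
    {f : ℕ → ℕ} (hf : PolyBounded f)
    (h1 : ∀ x ∈ L, ∃ N R, N ≤ f x.length ∧ R.length ≤ f x.length ∧ P ⟨x, R, N⟩)
    (h2 : ∀ c, P c → c.x ∈ L) : InNP L := by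
  obtain ⟨φ, hφ, h⟩ := hP
  have e (c : Ctx) : c.assign (fun i : Fin 0 => i.elim0) =
      Function.update (0 : ℕ → ℕ) 0 c.N := by
    funext k
    rcases k with _ | k <;> simp [Ctx.assign]
  refine inNP_of_fml hφ hf (fun x hx => ?_) fun x N R hs => ?_
  · obtain ⟨N, R, hN, hR, hp⟩ := h1 x hx
    exact ⟨N, R, hN, hR, by rw [← e ⟨x, R, N⟩]; exact (h ⟨x, R, N⟩ _).2 hp⟩
  · exact h2 ⟨x, R, N⟩ ((h ⟨x, R, N⟩ _).1 (by rw [e]; exact hs))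

/-- The string that stores the values of a function in blocks of length `N`. -/
def blocks (N : ℕ) (f : ℕ → ℕ) (n : ℕ) : List (Option Bool) :=
  (List.range n).flatMap fun p =>
    List.replicate (f p) (some true) ++ List.replicate (N - f p) (some false)

theorem blocks_succ (N : ℕ) (f : ℕ → ℕ) (n : ℕ) : blocks N f (n + 1) =
    List.replicate (f 0) (some true) ++ List.replicate (N - f 0) (some false) ++
      blocks N (fun p => f (p + 1)) n := by
  simp [blocks, List.range_succ_eq_map, List.flatMap_map]

theorem length_blocks {N : ℕ} {f : ℕ → ℕ} {n : ℕ} (h : ∀ p < n, f p ≤ N) :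
    (blocks N f n).length = n * N := by
  induction n generalizing f with
  | zero => simp [blocks]
  | succ n ih =>
    have h0 := h 0 (Nat.succ_pos n)
    rw [blocks_succ, List.length_append, ih fun p hp => h (p + 1) (by omega)]
    simp [Nat.add_one_mul]
    omega

/-- As `f p < N` is strict, each block ends with `some false`, and no run extends into the following
block. -/
theorem runLength_blocks {N : ℕ} {f : ℕ → ℕ} {n : ℕ} (h : ∀ p < n, f p < N) {p : ℕ} (hp : p < n) :
    runLength ((blocks N f n).drop (p * N)) = f p := by
  induction n generalizing f p with
  | zero => omega
  | succ n ih =>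
    have h0 := h 0 (Nat.succ_pos n)
    rw [blocks_succ]
    rcases p with _ | p
    · obtain ⟨k, hk⟩ : ∃ k, N - f 0 = k + 1 := ⟨N - f 0 - 1, by omega⟩
      simp only [Nat.zero_mul, List.drop_zero, runLength, hk, List.replicate_succ]
      simp
    · have e : (p + 1) * N - (f 0 + (N - f 0)) = p * N := by rw [Nat.add_one_mul]; omega
      rw [List.drop_append, List.drop_eq_nil_of_le (by simp [Nat.add_one_mul]; omega),
        List.nil_append, List.length_append, List.length_replicate, List.length_replicate, e]
      exact ih (fun p hp => h (p + 1) (by omega)) (by omega)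

/-- All tables with values below `N` can be guessed. -/
theorem exists_tab (x : List (Option Bool)) {N C : ℕ} {f : ℕ → ℕ → ℕ → ℕ → ℕ}
    (h : ∀ t < C, ∀ i < N, ∀ j < N, ∀ k < N, f t i j k < N) :
    ∃ R : List (Option Bool), R.length = C * N ^ 4 ∧
      ∀ t < C, ∀ i < N, ∀ j < N, ∀ k < N, (Ctx.mk x R N).tab t i j k = f t i j k := by
  rcases Nat.eq_zero_or_pos N with rfl | hN
  · exact ⟨[], by simp, fun t _ i hi => absurd hi (by omega)⟩
  -- The table number and the three arguments are recovered from the block number as its digits in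
  -- base `N`.
  set g : ℕ → ℕ := fun p => f (p / N / N / N) (p / N / N % N) (p / N % N) (p % N) with hg
  have hg' : ∀ p < C * N * N * N, g p < N := by
    intro p hp
    refine h _ ?_ _ (Nat.mod_lt _ hN) _ (Nat.mod_lt _ hN) _ (Nat.mod_lt _ hN)
    rw [Nat.div_lt_iff_lt_mul hN, Nat.div_lt_iff_lt_mul hN, Nat.div_lt_iff_lt_mul hN]
    exact hp
  refine ⟨blocks N g (C * N * N * N), ?_, ?_⟩
  · rw [length_blocks fun p hp => (hg' p hp).le]
    ring
  · intro t ht i hi j hj k hk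
    have step {a b M : ℕ} (ha : a < M) (hb : b < N) : a * N + b < M * N := by
      have := Nat.mul_le_mul_right N (Nat.succ_le_of_lt ha)
      rw [Nat.succ_mul] at this
      omega
    have hdiv {a b : ℕ} (hb : b < N) : (a * N + b) / N = a := by
      rw [Nat.mul_comm, Nat.mul_add_div hN, Nat.div_eq_of_lt hb, Nat.add_zero]
    have hmod {a b : ℕ} (hb : b < N) : (a * N + b) % N = b := by
      rw [Nat.mul_comm, Nat.mul_add_mod, Nat.mod_eq_of_lt hb]
    rw [Ctx.tab]
    rw [runLength_blocks hg' (step (step (step ht hi) hj) hk)]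
    simp only [hg, hdiv hk, hmod hk, hdiv hj, hmod hj, hdiv hi, hmod hi]

end Definability
end Threading

namespace Threading

namespace Ctx

/-! ### The formula: what the guessed tables have to satisfy. -/

section Tables

variable (c : Ctx)

/-- The number of turns. -/
def turns : ℕ := c.tab 0 0 0 0
/-- The length of the walk. -/
def len : ℕ := c.tab 0 1 0 0
/-- The common width of all binary numbers. -/
def width : ℕ := c.tab 0 2 0 0
/-- The position of a field of the input. -/
def pos (k : ℕ) : ℕ := c.tab 1 k 0 0
/-- The length of a field of the input. -/
def flen (k : ℕ) : ℕ := c.tab 2 k 0 0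
/-- The bits of a field of the input. -/
def bit (k r : ℕ) : ℕ := c.tab 3 k r 0
/-- The value of the bits of a field from a position on. -/
def high (k r : ℕ) : ℕ := c.tab 4 k r 0
/-- The vertices of the walk. -/
def walk (i : ℕ) : ℕ := c.tab 5 i 0 0
/-- The turns of the walk. -/
def turn (i : ℕ) : ℕ := c.tab 6 i 0 0
/-- A neighbour of a vertex, the root of its junction graph. -/
def root (v : ℕ) : ℕ := c.tab 7 v 0 0
/-- The distance of an edge from the root of a junction graph. -/
def level (v a : ℕ) : ℕ := c.tab 8 v a 0
/-- The digits of the cost of a turn, multiplied by the common denominator. -/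
def scaled (s j : ℕ) : ℕ := c.tab 9 s j 0
/-- The digits of the common denominator. -/
def denom (j : ℕ) : ℕ := c.tab 10 j 0 0
/-- The digits of the partial products of denominators and scaled costs. -/
def prodL (s r j : ℕ) : ℕ := c.tab 11 s r j
/-- The digits of the partial products of numerators and the common denominator. -/
def prodR (s r j : ℕ) : ℕ := c.tab 12 s r j
/-- The carries on the left side of an equation. -/
def carryL (s j : ℕ) : ℕ := c.tab 13 s j 0
/-- The carries on the right side of an equation. -/
def carryR (s j : ℕ) : ℕ := c.tab 14 s j 0
/-- The digits of the partial sums of the scaled costs along the walk. -/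
def partialSum (i j : ℕ) : ℕ := c.tab 15 i j 0
/-- The digits of the difference of the scaled bound and the scaled cost. -/
def slack (j : ℕ) : ℕ := c.tab 16 j 0 0

/-- The number of vertices. -/
def verts : ℕ := c.high 0 0
/-- The number of edges. -/
def edges : ℕ := c.high 3 0
/-- The number of fields before the turns. -/
def base : ℕ := 4 + 2 * c.edges
/-- The number of fields. -/
def fields : ℕ := c.base + 5 * c.turns
/-- The endpoints of an edge. -/
def edge (i e : ℕ) : ℕ := c.high (4 + 2 * e + i) 0
/-- The vertices of a turn. -/
def turnVert (i t : ℕ) : ℕ := c.high (c.base + 5 * t + i) 0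

/-- Two vertices are joined by an edge of the list. -/
def Adj (u v : ℕ) : Prop :=
  ∃ e < c.N, e < c.edges ∧
    ((c.edge 0 e = u ∧ c.edge 1 e = v) ∨ (c.edge 0 e = v ∧ c.edge 1 e = u))

/-- The input consists of the binary numbers with the given positions, lengths and bits. -/
def GoodFields : Prop :=
  c.width < c.N ∧ c.fields ≤ c.N ∧ c.pos 0 = 0 ∧ c.inp (c.pos c.fields) = 0 ∧
  ∀ k < c.N, k < c.fields →
    c.pos (k + 1) = c.pos k + c.flen k + 1 ∧ c.inp (c.pos k + c.flen k) = 1 ∧ c.flen k ≤ c.width ∧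
    ∀ r < c.N, r < c.width → c.bit k r ≤ 1 ∧ (r < c.flen k → c.inp (c.pos k + r) = c.bit k r + 2) ∧
      -- The leading bit is `1`, since only the canonical expansion given by `Nat.bits` is a valid
      -- encoding.
      (c.flen k ≤ r → c.bit k r = 0) ∧ (r + 1 = c.flen k → c.bit k r = 1)

/-- The value of the bits of a field is correct. -/
def GoodHigh (k : ℕ) : Prop :=
  c.high k c.width = 0 ∧
    ∀ r < c.N, r < c.width → c.high k r = c.bit k r + 2 * c.high k (r + 1)

/-- The input describes a graph and its turns. -/
def GoodGraph : Prop :=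
  -- Values are demanded only of fields with numbers of polynomial size: the counts and the
  -- vertices. Costs are accessible through their bits alone.
  c.GoodHigh 0 ∧ c.GoodHigh 3 ∧
  (∀ e < c.N, e < c.edges → c.GoodHigh (4 + 2 * e + 0) ∧ c.GoodHigh (4 + 2 * e + 1)) ∧
  (∀ t < c.N, t < c.turns → c.GoodHigh (c.base + 5 * t + 0) ∧ c.GoodHigh (c.base + 5 * t + 1) ∧
    c.GoodHigh (c.base + 5 * t + 2)) ∧
  0 < c.verts ∧ c.verts ≤ c.N ∧
  (∀ e < c.N, e < c.edges → c.edge 0 e < c.edge 1 e ∧ c.edge 1 e < c.verts ∧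
    -- Strictly increasing keys make the list of edges the lexicographic one without repetitions.
    ∀ f < c.N, f < e →
      c.edge 0 f * c.verts + c.edge 1 f < c.edge 0 e * c.verts + c.edge 1 e) ∧
  (∀ t < c.N, t < c.turns → c.turnVert 0 t < c.turnVert 2 t ∧
    c.Adj (c.turnVert 0 t) (c.turnVert 1 t) ∧ c.Adj (c.turnVert 1 t) (c.turnVert 2 t) ∧
    ∀ s < c.N, s < t →
      (c.turnVert 0 s * c.verts + c.turnVert 1 s) * c.verts + c.turnVert 2 s <
        (c.turnVert 0 t * c.verts + c.turnVert 1 t) * c.verts + c.turnVert 2 t) ∧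
  (∀ u < c.N, ∀ v < c.N, ∀ w < c.N, u < w → c.Adj u v → c.Adj v w →
    ∃ t < c.N, t < c.turns ∧ c.turnVert 0 t = u ∧ c.turnVert 1 t = v ∧ c.turnVert 2 t = w)

/-- The walk is a threading. -/
def GoodWalk : Prop :=
  0 < c.len ∧ c.len ≤ c.N ∧ c.walk c.len = c.walk 0 ∧ c.walk (c.len + 1) = c.walk 1 ∧
  (∀ i < c.N, i < c.len → c.Adj (c.walk i) (c.walk (i + 1)) ∧ c.walk i ≠ c.walk (i + 2) ∧
    c.turn i < c.turns ∧ c.turnVert 1 (c.turn i) = c.walk (i + 1) ∧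
    ((c.turnVert 0 (c.turn i) = c.walk i ∧ c.turnVert 2 (c.turn i) = c.walk (i + 2)) ∨
      (c.turnVert 0 (c.turn i) = c.walk (i + 2) ∧ c.turnVert 2 (c.turn i) = c.walk i))) ∧
  (∀ e < c.N, e < c.edges → ∃ i < c.N, i < c.len ∧
    ((c.edge 0 e = c.walk i ∧ c.edge 1 e = c.walk (i + 1)) ∨
      (c.edge 0 e = c.walk (i + 1) ∧ c.edge 1 e = c.walk i))) ∧
  (∀ v < c.N, v < c.verts → (∃ i < c.N, i < c.len ∧ c.walk (i + 1) = v) ∧ c.Adj v (c.root v) ∧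
    -- Connectedness in bounded form: from every edge at `v` other than the root a passage leads to
    -- an edge of smaller level.
    ∀ a < c.N, c.Adj v a → a = c.root v ∨ ∃ i < c.N, i < c.len ∧ c.walk (i + 1) = v ∧
      ((c.walk i = a ∧ c.level v (c.walk (i + 2)) < c.level v a) ∨
        (c.walk (i + 2) = a ∧ c.level v (c.walk i) < c.level v a)))

/-- The carries of an equation between binary numbers are correct. -/
def GoodCarry (s : ℕ) (f g : ℕ → ℕ) : Prop :=
  c.carryL s 0 = 0 ∧ c.carryR s 0 = 0 ∧ c.carryL s c.width = 0 ∧ c.carryR s c.width = 0 ∧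
  -- Both sides of the equation produce the same binary digit in place `j`; the digit is eliminated
  -- and subtraction is avoided by exchanging the outgoing carries.
  ∀ j < c.N, j < c.width → f j + c.carryL s j + 2 * c.carryR s (j + 1) =
    g j + c.carryR s j + 2 * c.carryL s (j + 1)

/-- The scaled cost number `s` is correct for the fraction with the numerator in the field `k` and
the denominator in the field `l`. -/
def GoodCost (s k l : ℕ) : Prop :=
  -- The denominator is positive.
  (∃ r < c.N, r < c.width ∧ c.bit l r = 1) ∧
  (∀ j < c.N, j < c.width → c.prodL s c.width j = 0 ∧ c.prodR s c.width j = 0) ∧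
  (∀ r < c.N, r < c.width →
    c.prodL s r 0 = c.bit l r * c.scaled s 0 ∧ c.prodR s r 0 = c.bit k r * c.denom 0 ∧
    ∀ j < c.N, j < c.width →
      (j + 1 < c.width →
        c.prodL s r (j + 1) = c.bit l r * c.scaled s (j + 1) + c.prodL s (r + 1) j ∧
        c.prodR s r (j + 1) = c.bit k r * c.denom (j + 1) + c.prodR s (r + 1) j) ∧
      (j + 1 = c.width → c.prodL s (r + 1) j = 0 ∧ c.prodR s (r + 1) j = 0)) ∧
  c.GoodCarry s (c.prodL s 0) (c.prodR s 0)

/-- The cost of the walk does not exceed the bound. -/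
def GoodCosts : Prop :=
  0 < c.width ∧ (∃ j < c.N, j < c.width ∧ c.denom j ≠ 0) ∧ c.GoodCost c.turns 1 2 ∧
  (∀ t < c.N, t < c.turns → c.GoodCost t (c.base + 5 * t + 3) (c.base + 5 * t + 4)) ∧
  (∀ j < c.N, j < c.width → c.partialSum 0 j = 0) ∧
  (∀ i < c.N, i < c.len → ∀ j < c.N, j < c.width →
    c.partialSum (i + 1) j = c.partialSum i j + c.scaled (c.turn i) j) ∧
  -- The slack turns the comparison with the bound into an equation.
  c.GoodCarry (c.turns + 1) (fun j => c.partialSum c.len j + c.slack j) (c.scaled c.turns)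

/-- The guess proves that the input is a yes-instance of Decision Threading. -/
def Good : Prop := c.GoodFields ∧ c.GoodGraph ∧ c.GoodWalk ∧ c.GoodCosts

end Tables

/-- Every quantifier in the conditions ranges over numbers below `c.N`, with the intended range as
an extra clause, so the formula is built by following the syntax. -/
theorem isFml_good : IsFml 0 fun c _ => c.Good := by
  simp only [Good, GoodFields, GoodGraph, GoodWalk, GoodCosts, GoodCost, GoodCarry, GoodHigh, Adj,
    turnVert, edge, fields, base, edges, verts, turns, len, width, pos, flen, bit, high, walk, turn,
    root, level, scaled, denom, prodL, prodR, carryL, carryR, partialSum, slack]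
  repeat' first
    | with_reducible first
      | refine IsFml.all ?_ | refine IsFml.ex ?_ | refine IsFml.and ?_ ?_ | refine IsFml.or ?_ ?_
      | refine IsFml.ne ?_ ?_ | refine IsFml.imp ?_ ?_ | refine IsFml.eq ?_ ?_
      | refine IsFml.lt ?_ ?_ | refine IsFml.le ?_ ?_
      | refine IsTrm.tab _ ?_ ?_ ?_ | refine IsTrm.add ?_ ?_ | refine IsTrm.mul ?_ ?_
      | refine IsTrm.inp ?_ | exact IsTrm.const _ | exact IsTrm.bound
    | exact IsTrm.var _

end Ctx

end Threading

namespace Threading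

/-! ### Arithmetic with binary digits, partial products and carries. -/

section Binary

/-- The value of a sequence of binary digits, which need not be `0` or `1`. -/
def binVal (n : ℕ) (f : ℕ → ℕ) : ℕ := ∑ j ∈ Finset.range n, f j * 2 ^ j

theorem binVal_succ (n : ℕ) (f : ℕ → ℕ) :
    binVal (n + 1) f = f 0 + 2 * binVal n fun j => f (j + 1) := by
  rw [binVal, Finset.sum_range_succ', binVal, Finset.mul_sum, Nat.add_comm, pow_zero, mul_one]
  congr 1
  exact Finset.sum_congr rfl fun j _ => by ring

theorem binVal_congr {n : ℕ} {f g : ℕ → ℕ} (h : ∀ j < n, f j = g j) : binVal n f = binVal n g :=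
  Finset.sum_congr rfl fun j hj => by rw [h j (Finset.mem_range.1 hj)]

theorem binVal_add (n : ℕ) (f g : ℕ → ℕ) :
    (binVal n fun j => f j + g j) = binVal n f + binVal n g := by
  simp only [binVal, Nat.add_mul, Finset.sum_add_distrib]

theorem binVal_mul (n : ℕ) (b : ℕ) (f : ℕ → ℕ) : (binVal n fun j => b * f j) = b * binVal n f := by
  simp only [binVal, Finset.mul_sum, Nat.mul_assoc]

theorem binVal_zero {n : ℕ} {f : ℕ → ℕ} (h : ∀ j < n, f j = 0) : binVal n f = 0 :=
  Finset.sum_eq_zero fun j hj => by rw [h j (Finset.mem_range.1 hj), Nat.zero_mul]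

theorem binVal_eq_of_le {n m : ℕ} {f : ℕ → ℕ} (h : m ≤ n) (h0 : ∀ j < n, m ≤ j → f j = 0) :
    binVal n f = binVal m f := by
  refine (Finset.sum_subset (Finset.range_subset_range.2 h) fun j hj hj' => ?_).symm
  rw [h0 j (Finset.mem_range.1 hj) (by simpa using hj'), Nat.zero_mul]

theorem binVal_pos {n : ℕ} {f : ℕ → ℕ} {j : ℕ} (hj : j < n) (h : f j ≠ 0) : 0 < binVal n f :=
  Finset.sum_pos' (fun _ _ => Nat.zero_le _)
    ⟨j, Finset.mem_range.2 hj, Nat.mul_pos (Nat.pos_of_ne_zero h) (by positivity)⟩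

/-- The canonical binary expansion of a number. -/
theorem bits_binVal {n : ℕ} {b : ℕ → ℕ} (h : ∀ j < n, b j ≤ 1)
    (htop : ∀ j, j + 1 = n → b j = 1) :
    Nat.bits (binVal n b) = (List.range n).map fun j => b j == 1 := by
  induction n generalizing b with
  | zero => simp [binVal]
  | succ n ih =>
    have ih := ih (b := fun j => b (j + 1)) (fun j hj => h (j + 1) (by omega))
      fun j hj => htop (j + 1) (by omega)
    have e : binVal (n + 1) b = Nat.bit (b 0 == 1) (binVal n fun j => b (j + 1)) := by
      rw [binVal_succ, Nat.bit_val]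
      have := h 0 (Nat.succ_pos n)
      interval_cases b 0 <;> (simp; try omega)
    rw [e, Nat.bits_append_bit, ih, List.range_succ_eq_map, List.map_cons, List.map_map]
    · rfl
    -- If the remaining digits have value zero, there are none, because the leading digit is `1`; so
    -- the present digit is the leading one.
    · intro h0
      rcases n with _ | n
      · simp [htop 0 rfl]
      · exact absurd h0 (binVal_pos (f := fun j => b (j + 1)) (j := n) (Nat.lt_succ_self n)
          (by simp [htop (n + 1) rfl])).ne'

/-- The Horner scheme for the value of a binary number. -/
theorem binVal_eq_of_horner {n : ℕ} {b h : ℕ → ℕ} (hn : h n = 0)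
    (hs : ∀ r < n, h r = b r + 2 * h (r + 1)) : h 0 = binVal n b := by
  induction n generalizing b h with
  | zero => simpa [binVal] using hn
  | succ n ih =>
    rw [hs 0 (Nat.succ_pos n), binVal_succ,
      ih (b := fun r => b (r + 1)) (h := fun r => h (r + 1)) hn fun r hr => hs (r + 1) (by omega)]

/-- The Horner scheme for the product of two binary numbers. -/
theorem binVal_mul_of_horner {n : ℕ} {b a : ℕ → ℕ} {w : ℕ → ℕ → ℕ} (hn : ∀ j < n, w n j = 0)
    (h0 : ∀ r < n, w r 0 = b r * a 0)
    (hs : ∀ r < n, ∀ j, j + 1 < n → w r (j + 1) = b r * a (j + 1) + w (r + 1) j)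
    (htop : ∀ r < n, ∀ j, j + 1 = n → w (r + 1) j = 0) :
    binVal n (w 0) = binVal n b * binVal n a := by
  rcases n with _ | n
  · simp [binVal]
  -- Row `r` is `b r` times `a` plus row `r + 1` shifted by one place; by `htop` the shift loses no
  -- digit.
  have key : ∀ r < n + 1, binVal (n + 1) (w r) =
      b r * binVal (n + 1) a + 2 * binVal (n + 1) (w (r + 1)) := by
    intro r hr
    have e1 : binVal (n + 1) (w (r + 1)) = binVal n (w (r + 1)) :=
      binVal_eq_of_le (Nat.le_succ n) fun j hj hj' => htop r hr j (by omega)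
    rw [e1, binVal_succ, binVal_succ, h0 r hr,
      binVal_congr (g := fun j => b r * a (j + 1) + w (r + 1) j) fun j hj => hs r hr j (by omega),
      binVal_add, binVal_mul]
    ring
  have := binVal_eq_of_horner (n := n + 1) (b := fun r => b r * binVal (n + 1) a)
    (h := fun r => binVal (n + 1) (w r)) (binVal_zero hn) key
  refine this.trans ((Finset.sum_congr rfl fun r _ => ?_).trans (Finset.sum_mul _ _ _).symm)
  ring

/-- Equality of two binary numbers by comparison of the digits with carries. -/
theorem binVal_eq_of_carry {n : ℕ} {f g c d : ℕ → ℕ} (hc : c 0 = 0) (hd : d 0 = 0) (hcn : c n = 0)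
    (hdn : d n = 0) (h : ∀ j < n, f j + c j + 2 * d (j + 1) = g j + d j + 2 * c (j + 1)) :
    binVal n f = binVal n g := by
  -- After `m` places both sides agree up to the carries, which have weight `2 ^ m`.
  have key : ∀ m ≤ n, binVal m f + d m * 2 ^ m = binVal m g + c m * 2 ^ m := by
    intro m
    induction m with
    | zero => simp [binVal, hc, hd]
    | succ m ih =>
      intro hm
      have ih := ih (by omega)
      have h := congrArg (· * 2 ^ m) (h m (by omega))
      simp only [binVal, Finset.sum_range_succ] at ih ⊢
      simp only [pow_succ]
      nlinarith
  simpa [hcn, hdn] using key n le_rfl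

end Binary

/-! ### Reconstruction of the input string from its fields. -/

section Strings

theorem symCode_eq_zero {o : Option (Option Bool)} (h : symCode o = 0) : o = none := by
  rcases o with _ | _ | _ | _ <;> simp_all [symCode]

theorem symCode_eq_one {o : Option (Option Bool)} (h : symCode o = 1) : o = some none := by
  rcases o with _ | _ | _ | _ <;> simp_all [symCode]

theorem symCode_eq_add_two {o : Option (Option Bool)} {b : ℕ} (h : symCode o = b + 2)
    (hb : b ≤ 1) : o = some (some (b == 1)) := by
  interval_cases b <;> rcases o with _ | _ | _ | _ <;> simp_all [symCode]

theorem drop_eq_append {α : Type*} {x l : List α} {p : ℕ} (h : ∀ r < l.length, x[p + r]? = l[r]?) :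
    x.drop p = l ++ x.drop (p + l.length) := by
  rw [← List.drop_drop, ← List.take_append_drop l.length (x.drop p)]
  congr 1
  · refine List.ext_getElem? fun r => ?_
    rw [List.getElem?_take]
    split_ifs with hr
    · rw [List.getElem?_drop, h r hr]
    · rw [List.getElem?_eq_none (by omega)]
  · rw [List.take_append_drop]

/-- The input is determined from its end: by induction on `i`, the suffix from the position of the
`i`-th field from last encodes the last `i` fields. -/
theorem Ctx.GoodFields.eq_encodeNats {c : Ctx} (h : c.GoodFields) :
    c.x = encodeNats ((List.range c.fields).map fun k => binVal c.width (c.bit k)) := by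
  obtain ⟨hw, hf, h0, hend, h⟩ := h
  have hx : c.x = c.x.drop (c.pos (c.fields - c.fields)) := by simp [h0]
  have key : ∀ i ≤ c.fields, c.x.drop (c.pos (c.fields - i)) = encodeNats
      ((List.range i).map fun r => binVal c.width (c.bit (c.fields - i + r))) := by
    intro i
    induction i with
    | zero =>
      intro _
      have := symCode_eq_zero hend
      simpa [encodeNats] using this
    | succ i ih =>
      intro hi
      have ih := ih (by omega)
      obtain ⟨h1, h2, h3, h4⟩ := h (c.fields - (i + 1)) (by omega) (by omega)
      rw [List.range_succ_eq_map, List.map_cons, List.map_map]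
      set k := c.fields - (i + 1) with hk
      have hk1 : k + 1 = c.fields - i := by omega
      have e1 : binVal c.width (c.bit k) = binVal (c.flen k) (c.bit k) :=
        binVal_eq_of_le h3 fun j hj hj' => (h4 j (by omega) hj).2.2.1 hj'
      have e2 := bits_binVal (n := c.flen k) (b := c.bit k)
        (fun j hj => (h4 j (by omega) (by omega)).1)
        (fun j hj => (h4 j (by omega) (by omega)).2.2.2 hj)
      have e3 : encodeNats (binVal c.width (c.bit (k + 0)) :: (List.range i).map
          ((fun r => binVal c.width (c.bit (k + r))) ∘ Nat.succ)) =
          ((List.range (c.flen k)).map (fun j => some (c.bit k j == 1)) ++ [none]) ++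
            c.x.drop (c.pos (k + 1)) := by
        rw [hk1, ih, encodeNats, List.flatMap_cons, Nat.add_zero, e1, e2, List.map_map]
        simp only [encodeNats, Function.comp_def, ← hk1, Nat.succ_eq_add_one, Nat.add_assoc,
          Nat.add_comm 1]
      rw [e3, h1]
      convert drop_eq_append (x := c.x) (p := c.pos k)
        (l := (List.range (c.flen k)).map (fun j => some (c.bit k j == 1)) ++ [none]) ?_ using 3
      · simp [Nat.add_assoc]
      · intro r hr
        rw [List.length_append, List.length_map, List.length_range, List.length_singleton] at hr
        rcases Nat.lt_succ_iff_lt_or_eq.1 hr with hr | rfl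
        · obtain ⟨h5, h6, -⟩ := h4 r (by omega) (by omega)
          rw [symCode_eq_add_two (h6 hr) h5, List.getElem?_append_left (by simpa using hr)]
          simp [hr]
        · rw [symCode_eq_one h2, List.getElem?_append_right (by simp)]
          simp
  rw [hx, key _ le_rfl]
  simp

end Strings
end Threading

namespace Threading

/-! ### Closed walks given by functions, and lists sorted by a numerical key. -/

section Lists

theorem rotate_one_map_range {α : Type*} {n : ℕ} {w : ℕ → α} (h : w n = w 0) :
    ((List.range n).map w).rotate 1 = (List.range n).map fun i => w (i + 1) := by
  refine List.ext_getElem (by simp) fun i h1 h2 => ?_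
  have hi : i < n := by simpa using h2
  rw [List.getElem_rotate]
  simp only [List.getElem_map, List.getElem_range, List.length_map, List.length_range]
  rcases Nat.lt_or_ge (i + 1) n with h3 | h3
  · rw [Nat.mod_eq_of_lt h3]
  · obtain rfl : n = i + 1 := by omega
    rw [Nat.mod_self, h]

theorem cyclicTriples_map_range {α : Type*} {n : ℕ} {w : ℕ → α} (h0 : w n = w 0)
    (h1 : w (n + 1) = w 1) : cyclicTriples ((List.range n).map w) =
      (List.range n).map fun i => (w i, w (i + 1), w (i + 2)) := by
  rw [cyclicTriples, show 2 = 1 + 1 from rfl, ← List.rotate_rotate, rotate_one_map_range h0,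
    rotate_one_map_range (w := fun i => w (i + 1)) h1, List.zip_map', List.zip_map']

theorem turnCost_map_range {V : Type*} (α : Sym2 (Sym2 V) → ℝ≥0) {n : ℕ} {w : ℕ → V}
    (h0 : w n = w 0) (h1 : w (n + 1) = w 1) : turnCost α ((List.range n).map w) =
      ((List.range n).map fun i => α s(s(w i, w (i + 1)), s(w (i + 1), w (i + 2)))).sum := by
  rw [turnCost, cyclicTriples_map_range h0 h1, List.map_map]
  rfl

theorem map_range_mul {α : Type*} (g : ℕ → α) (a k : ℕ) : (List.range (k * a)).map g =
    (List.range a).flatMap fun i => (List.range k).map fun j => g (k * i + j) := by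
  induction a with
  | zero => simp
  | succ a ih =>
    rw [Nat.mul_succ, List.range_add, List.map_append, ih, List.range_succ, List.flatMap_append,
      List.map_map]
    simp [Function.comp_def]

/-- Lexicographic order is numerical order of the keys when `M` exceeds the keys of the second
component. -/
theorem pairwise_product_finRange {β : Type*} (n M : ℕ) {l : List β} {key : β → ℕ}
    (hl : l.Pairwise fun a b => key a < key b) (hM : ∀ b ∈ l, key b < M) :
    (List.finRange n ×ˢ l).Pairwise fun p q =>
      (p.1 : ℕ) * M + key p.2 < (q.1 : ℕ) * M + key q.2 := by
  have e : List.finRange n ×ˢ l = (List.finRange n).flatMap fun a => l.map (Prod.mk a) := rfl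
  rw [e, List.pairwise_flatMap]
  refine ⟨fun a _ => ?_, (List.pairwise_lt_finRange n).imp fun {a b} hab x hx y hy => ?_⟩
  · rw [List.pairwise_map]
    exact hl.imp fun h => Nat.add_lt_add_left h _
  · obtain ⟨x', hx', rfl⟩ := List.mem_map.1 hx
    obtain ⟨y', hy', rfl⟩ := List.mem_map.1 hy
    have h1 := Nat.mul_le_mul_right M (Nat.succ_le_of_lt (Fin.lt_def.1 hab))
    have h2 := hM x' hx'
    rw [Nat.succ_mul] at h1
    dsimp only
    omega

/-- This identifies the guessed lists of edges and turns with those of the decoded instance: only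
their members need to be compared. -/
theorem eq_of_pairwise_key {α : Type*} {l l' : List α} {key : α → ℕ}
    (h : l.Pairwise fun a b => key a < key b) (h' : l'.Pairwise fun a b => key a < key b)
    (hm : ∀ a, a ∈ l ↔ a ∈ l') : l = l' := by
  have : Std.Antisymm fun a b : α => key a < key b :=
    ⟨fun a b h1 h2 => absurd (h1.trans h2) (lt_irrefl _)⟩
  have : Std.Irrefl fun a b : α => key a < key b := ⟨fun a => lt_irrefl _⟩
  exact h.eq_of_mem_iff h' hm

theorem pairwise_finRange (n : ℕ) :
    (List.finRange n).Pairwise fun a b : Fin n => (a : ℕ) < (b : ℕ) := List.pairwise_lt_finRange n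

end Lists

namespace ThreadingInstance

variable (I : ThreadingInstance)

theorem pairwise_edgeList : I.edgeList.Pairwise fun p q =>
    (p.1 : ℕ) * I.n + p.2 < (q.1 : ℕ) * I.n + q.2 :=
  List.Pairwise.filter _ (pairwise_product_finRange (key := fun a : Fin I.n => (a : ℕ)) I.n I.n
    (pairwise_finRange I.n) fun b _ => b.2)

theorem pairwise_turnList : I.turnList.Pairwise fun p q =>
    ((p.1 : ℕ) * I.n + p.2.1) * I.n + p.2.2 < ((q.1 : ℕ) * I.n + q.2.1) * I.n + q.2.2 := by
  have h := List.Pairwise.filter (fun t => decide (t.1 < t.2.2 ∧ I.G.Adj t.1 t.2.1 ∧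
    I.G.Adj t.2.1 t.2.2)) (pairwise_product_finRange (key := fun p : Fin I.n × Fin I.n =>
    (p.1 : ℕ) * I.n + p.2) I.n (I.n * I.n) (pairwise_product_finRange
    (key := fun a : Fin I.n => (a : ℕ)) I.n I.n (pairwise_finRange I.n) fun b _ => b.2)
    fun b _ => by
      have h1 := b.1.2
      have h2 := b.2.2
      nlinarith)
  refine h.imp fun {p q} hpq => ?_
  nlinarith

theorem mem_edgeList {p : Fin I.n × Fin I.n} :
    p ∈ I.edgeList ↔ p.1 < p.2 ∧ I.G.Adj p.1 p.2 := by
  simp only [edgeList, List.mem_filter, decide_eq_true_eq, and_iff_right_iff_imp]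
  exact fun _ => List.mem_product.2 ⟨List.mem_finRange _, List.mem_finRange _⟩

theorem mem_turnList {t : Fin I.n × Fin I.n × Fin I.n} :
    t ∈ I.turnList ↔ t.1 < t.2.2 ∧ I.G.Adj t.1 t.2.1 ∧ I.G.Adj t.2.1 t.2.2 := by
  simp only [turnList, List.mem_filter, decide_eq_true_eq, and_iff_right_iff_imp]
  exact fun _ => List.mem_product.2 ⟨List.mem_finRange _,
    List.mem_product.2 ⟨List.mem_finRange _, List.mem_finRange _⟩⟩

end ThreadingInstance

/-! ### The instance that a correct guess describes. -/

namespace Ctx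

variable {c : Ctx}

/-- The value of a field of the input. -/
def field (c : Ctx) (k : ℕ) : ℕ := binVal c.width (c.bit k)

theorem GoodHigh.eq_field {k : ℕ} (hw : c.width < c.N) (h : c.GoodHigh k) : c.high k 0 = c.field k :=
  binVal_eq_of_horner h.1 fun r hr => h.2 r (by omega) hr

/-- The graph that the input describes. -/
def graph (c : Ctx) : SimpleGraph (Fin c.verts) where
  Adj u v := u ≠ v ∧ c.Adj u v
  symm := ⟨fun _ _ h => ⟨h.1.symm, by
    obtain ⟨e, h1, h2, h3⟩ := h.2
    exact ⟨e, h1, h2, h3.symm⟩⟩⟩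
  loopless := ⟨fun _ h => h.1 rfl⟩

theorem GoodGraph.adj (h : c.GoodGraph) {u v : ℕ} (huv : c.Adj u v) :
    u ≠ v ∧ u < c.verts ∧ v < c.verts := by
  obtain ⟨-, -, -, -, -, -, h, -⟩ := h
  obtain ⟨e, h1, h2, h3⟩ := huv
  have := h e h1 h2
  omega

theorem GoodGraph.graph_adj (h : c.GoodGraph) {u v : Fin c.verts} :
    c.graph.Adj u v ↔ c.Adj u v :=
  ⟨fun h => h.2, fun h' => ⟨fun e => (h.adj h').1 (by rw [e]), h'⟩⟩

/-- The index of a turn in the list of turns. -/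
def IsTurn (c : Ctx) (q : Sym2 (Sym2 (Fin c.verts))) (t : ℕ) : Prop :=
  t < c.turns ∧ q.map (Sym2.map Fin.val) =
    s(s(c.turnVert 0 t, c.turnVert 1 t), s(c.turnVert 1 t, c.turnVert 2 t))

/-- A turn determines its middle vertex as the common endpoint, and the order of the two outer
vertices is fixed; so it determines the triple, and the increasing keys determine the index. -/
theorem GoodGraph.isTurn_unique (h : c.GoodGraph) (hN : c.turns ≤ c.N)
    {q : Sym2 (Sym2 (Fin c.verts))} {s t : ℕ} (hs : c.IsTurn q s) (ht : c.IsTurn q t) : s = t := by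
  have adj := @GoodGraph.adj _ h
  obtain ⟨-, -, -, -, -, -, -, h, -⟩ := h
  have h1 := hs.2.symm.trans ht.2
  obtain ⟨a1, a2, a3, a4⟩ := h s (by have := hs.1; omega) hs.1
  obtain ⟨b1, b2, b3, b4⟩ := h t (by have := ht.1; omega) ht.1
  have a5 := (adj a2).1
  have a6 := (adj a3).1
  have b5 := (adj b2).1
  have b6 := (adj b3).1
  have e : c.turnVert 0 s = c.turnVert 0 t ∧ c.turnVert 1 s = c.turnVert 1 t ∧
      c.turnVert 2 s = c.turnVert 2 t := by
    simp only [Sym2.eq_iff] at h1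
    omega
  rcases lt_trichotomy s t with h2 | h2 | h2
  · have := b4 s (by have := hs.1; omega) h2
    rw [e.1, e.2.1, e.2.2] at this
    omega
  · exact h2
  · have := a4 t (by have := ht.1; omega) h2
    rw [e.1, e.2.1, e.2.2] at this
    omega

open Classical in
/-- The instance that the input describes. -/
noncomputable def toInstance (c : Ctx) (hadm : Admissible c.graph)
    (h2 : 0 < c.field 2) (hden : ∀ t < c.turns, 0 < c.field (c.base + 5 * t + 4)) :
    ThreadingInstance where
  n := c.verts
  G := c.graph
  decAdj := Classical.decRel _
  admissible := hadm
  -- Only costs of turns enter the encoding, so the values elsewhere are arbitrary, subject to a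
  -- positive denominator.
  costNum q := if h : ∃ t, c.IsTurn q t then c.field (c.base + 5 * h.choose + 3) else 0
  costDen q := if h : ∃ t, c.IsTurn q t then c.field (c.base + 5 * h.choose + 4) else 1
  costDen_pos q := by
    split_ifs with h
    · exact hden _ h.choose_spec.1
    · exact one_pos
  boundNum := c.field 1
  boundDen := c.field 2
  boundDen_pos := h2

section

variable {hadm : Admissible c.graph} {h2 : 0 < c.field 2}
    {hden : ∀ t < c.turns, 0 < c.field (c.base + 5 * t + 4)}

theorem costNum_toInstance (h : c.GoodGraph) (hN : c.turns ≤ c.N)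
    {q : Sym2 (Sym2 (Fin c.verts))} {t : ℕ} (ht : c.IsTurn q t) :
    (c.toInstance hadm h2 hden).costNum q = c.field (c.base + 5 * t + 3) := by
  have hex : ∃ t, c.IsTurn q t := ⟨t, ht⟩
  simp only [toInstance]
  rw [dif_pos hex, h.isTurn_unique hN hex.choose_spec ht]

theorem costDen_toInstance (h : c.GoodGraph) (hN : c.turns ≤ c.N)
    {q : Sym2 (Sym2 (Fin c.verts))} {t : ℕ} (ht : c.IsTurn q t) :
    (c.toInstance hadm h2 hden).costDen q = c.field (c.base + 5 * t + 4) := by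
  have hex : ∃ t, c.IsTurn q t := ⟨t, ht⟩
  simp only [toInstance]
  rw [dif_pos hex, h.isTurn_unique hN hex.choose_spec ht]

theorem edgeList_toInstance (h : c.GoodGraph) (hN : c.edges ≤ c.N) :
    (c.toInstance hadm h2 hden).edgeList.map (fun p => ((p.1 : ℕ), (p.2 : ℕ))) =
      (List.range c.edges).map fun e => (c.edge 0 e, c.edge 1 e) := by
  refine eq_of_pairwise_key (key := fun p => p.1 * c.verts + p.2) ?_ ?_ ?_
  · rw [List.pairwise_map]
    exact ThreadingInstance.pairwise_edgeList _
  · rw [List.pairwise_map]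
    refine (List.pairwise_lt_range (n := c.edges)).imp_of_mem fun {f e} hf he hfe => ?_
    obtain ⟨-, -, -, -, -, -, h, -⟩ := h
    rw [List.mem_range] at hf he
    exact (h e (by omega) he).2.2 f (by omega) hfe
  · rintro ⟨u, v⟩
    simp only [List.mem_map, ThreadingInstance.mem_edgeList, List.mem_range, Prod.mk.injEq]
    constructor
    · rintro ⟨p, ⟨h1, h3⟩, rfl, rfl⟩
      obtain ⟨e, he, he', h4⟩ := (h.graph_adj (u := p.1) (v := p.2)).1 h3
      obtain ⟨-, -, -, -, -, -, h, -⟩ := h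
      have h5 := (h e he he').1
      have h6 : (p.1 : ℕ) < p.2 := h1
      refine ⟨e, he', ?_⟩
      omega
    · rintro ⟨e, he, rfl, rfl⟩
      have hadj : c.Adj (c.edge 0 e) (c.edge 1 e) := ⟨e, by omega, he, Or.inl ⟨rfl, rfl⟩⟩
      obtain ⟨h3, h4, h5⟩ := h.adj hadj
      refine ⟨(⟨_, h4⟩, ⟨_, h5⟩), ⟨?_, (h.graph_adj (u := ⟨_, h4⟩) (v := ⟨_, h5⟩)).2 hadj⟩, rfl, rfl⟩
      obtain ⟨-, -, -, -, -, -, h, -⟩ := h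
      exact (h e (by omega) he).1

theorem turnList_toInstance (h : c.GoodGraph) (hN : c.turns ≤ c.N) :
    (c.toInstance hadm h2 hden).turnList.map (fun t => ((t.1 : ℕ), (t.2.1 : ℕ), (t.2.2 : ℕ))) =
      (List.range c.turns).map fun t => (c.turnVert 0 t, c.turnVert 1 t, c.turnVert 2 t) := by
  refine eq_of_pairwise_key (key := fun p => (p.1 * c.verts + p.2.1) * c.verts + p.2.2) ?_ ?_ ?_
  · rw [List.pairwise_map]
    exact ThreadingInstance.pairwise_turnList _
  · rw [List.pairwise_map]
    refine (List.pairwise_lt_range (n := c.turns)).imp_of_mem fun {f e} hf he hfe => ?_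
    obtain ⟨-, -, -, -, -, -, -, h, -⟩ := h
    rw [List.mem_range] at hf he
    exact (h e (by omega) he).2.2.2 f (by omega) hfe
  · rintro ⟨u, v, w⟩
    simp only [List.mem_map, ThreadingInstance.mem_turnList, List.mem_range, Prod.mk.injEq]
    constructor
    · rintro ⟨p, ⟨h1, h3, h4⟩, rfl, rfl, rfl⟩
      have hv : c.verts ≤ c.N := by obtain ⟨-, -, -, -, -, hv, -⟩ := h; exact hv
      have h5 := (h.graph_adj (u := p.1) (v := p.2.1)).1 h3
      have h6 := (h.graph_adj (u := p.2.1) (v := p.2.2)).1 h4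
      obtain ⟨-, -, -, -, -, -, -, -, h⟩ := h
      obtain ⟨t, -, ht, h7⟩ := h p.1 (p.1.2.trans_le hv) p.2.1 (p.2.1.2.trans_le hv) p.2.2
        (p.2.2.2.trans_le hv) h1 h5 h6
      exact ⟨t, ht, h7⟩
    · rintro ⟨t, ht, rfl, rfl, rfl⟩
      have h3 := h.2.2.2.2.2.2.2.1 t (by omega) ht
      obtain ⟨-, h4, h5⟩ := h.adj h3.2.1
      obtain ⟨-, h6, h7⟩ := h.adj h3.2.2.1
      exact ⟨(⟨_, h4⟩, ⟨_, h5⟩, ⟨_, h7⟩), ⟨h3.1, (h.graph_adj (u := ⟨_, h4⟩) (v := ⟨_, h5⟩)).2 h3.2.1,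
        (h.graph_adj (u := ⟨_, h5⟩) (v := ⟨_, h7⟩)).2 h3.2.2.1⟩, rfl, rfl, rfl⟩

theorem toNats_toInstance (hf : c.GoodFields) (h : c.GoodGraph) :
    (c.toInstance hadm h2 hden).toNats = (List.range c.fields).map c.field := by
  have hw := hf.1
  have hN := hf.2.1
  have hN1 : c.edges ≤ c.N := by rw [fields, base] at hN; omega
  have hN2 : c.turns ≤ c.N := by rw [fields] at hN; omega
  have hE := edgeList_toInstance (hadm := hadm) (h2 := h2) (hden := hden) h hN1
  have hT := turnList_toInstance (hadm := hadm) (h2 := h2) (hden := hden) h hN2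
  have hlen : (c.toInstance hadm h2 hden).edgeList.length = c.edges := by
    have := congrArg List.length hE
    simpa using this
  have g0 := h.1
  have g3 := h.2.1
  have gE := h.2.2.1
  have gT := h.2.2.2.1
  have e1 : (c.toInstance hadm h2 hden).edgeList.flatMap (fun p => [(p.1 : ℕ), (p.2 : ℕ)]) =
      (List.range c.edges).flatMap fun e => (List.range 2).map fun i => c.field (4 + (2 * e + i)) := by
    have := congrArg (List.flatMap fun p : ℕ × ℕ => [p.1, p.2]) hE
    rw [List.flatMap_map, List.flatMap_map] at this
    refine this.trans (List.flatMap_congr fun e he => ?_)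
    rw [List.mem_range] at he
    obtain ⟨h1, h3⟩ := gE e (by omega) he
    simp only [edge, h1.eq_field hw, h3.eq_field hw]
    simp only [Nat.add_assoc]
    rfl
  have e2 : (c.toInstance hadm h2 hden).turnList.flatMap (fun t =>
        [(t.1 : ℕ), (t.2.1 : ℕ), (t.2.2 : ℕ),
          (c.toInstance hadm h2 hden).costNum s(s(t.1, t.2.1), s(t.2.1, t.2.2)),
          (c.toInstance hadm h2 hden).costDen s(s(t.1, t.2.1), s(t.2.1, t.2.2))]) =
      (List.range c.turns).flatMap fun t =>
        (List.range 5).map fun i => c.field (c.base + (5 * t + i)) := by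
    -- The equality `hT` concerns triples of numbers, whereas costs are defined for vertices; the
    -- case distinction extends the map to all triples of numbers.
    have := congrArg (List.flatMap fun p : ℕ × ℕ × ℕ =>
      if h : p.1 < c.verts ∧ p.2.1 < c.verts ∧ p.2.2 < c.verts then
        [p.1, p.2.1, p.2.2,
          (c.toInstance hadm h2 hden).costNum
            s(s(⟨p.1, h.1⟩, ⟨p.2.1, h.2.1⟩), s(⟨p.2.1, h.2.1⟩, ⟨p.2.2, h.2.2⟩)),
          (c.toInstance hadm h2 hden).costDen
            s(s(⟨p.1, h.1⟩, ⟨p.2.1, h.2.1⟩), s(⟨p.2.1, h.2.1⟩, ⟨p.2.2, h.2.2⟩))]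
      else []) hT
    rw [List.flatMap_map, List.flatMap_map] at this
    refine Eq.trans (List.flatMap_congr fun t _ => ?_) (this.trans (List.flatMap_congr fun t ht => ?_))
    · rw [dif_pos ⟨t.1.2, t.2.1.2, t.2.2.2⟩]
    · rw [List.mem_range] at ht
      have h3 := h.2.2.2.2.2.2.2.1 t (by omega) ht
      obtain ⟨-, h4, h5⟩ := h.adj h3.2.1
      obtain ⟨-, h6, h7⟩ := h.adj h3.2.2.1
      have hturn : c.IsTurn s(s(⟨_, h4⟩, ⟨_, h5⟩), s(⟨_, h5⟩, ⟨_, h7⟩)) t := ⟨ht, rfl⟩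
      rw [dif_pos ⟨h4, h5, h7⟩]
      refine (congrArg₂ (fun a b => [c.turnVert 0 t, c.turnVert 1 t, c.turnVert 2 t, a, b])
        (costNum_toInstance h hN2 hturn) (costDen_toInstance h hN2 hturn)).trans ?_
      obtain ⟨g1, g2, g4⟩ := gT t (by omega) ht
      simp only [turnVert, g1.eq_field hw, g2.eq_field hw, g4.eq_field hw]
      simp only [Nat.add_assoc]
      rfl
  rw [ThreadingInstance.toNats, hlen, e1, e2, fields, base, List.range_add, List.range_add,
    List.map_append, List.map_append, List.map_map, List.map_map]
  congr 1
  · congr 1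
    · have e3 : (c.toInstance hadm h2 hden).n = c.field 0 := g0.eq_field hw
      have e4 : c.edges = c.field 3 := g3.eq_field hw
      rw [e3, e4]
      rfl
    · exact (map_range_mul (fun k => c.field (4 + k)) _ _).symm
  · exact (map_range_mul (fun k => c.field (c.base + k)) _ _).symm

end

end Ctx

end Threading

namespace Threading

/-! ### Soundness: a correct guess proves a yes-instance. -/

namespace Ctx

variable {c : Ctx}

theorem GoodWalk.exists_walk (hg : c.GoodGraph) (h : c.GoodWalk) : ∃ w : ℕ → Fin c.verts,
    (∀ i ≤ c.len + 1, (w i : ℕ) = c.walk i) ∧ w c.len = w 0 ∧ w (c.len + 1) = w 1 := by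
  obtain ⟨hl, hN, h0, h1, h, -⟩ := h
  have hb : ∀ i ≤ c.len + 1, c.walk i < c.verts := by
    intro i hi
    rcases Nat.lt_or_ge i c.len with h2 | h2
    · exact (hg.adj (h i (by omega) h2).1).2.1
    · rcases Nat.eq_or_lt_of_le h2 with rfl | h2
      · rw [h0]
        exact (hg.adj (h 0 (by omega) hl).1).2.1
      · obtain rfl : i = c.len + 1 := by omega
        rw [h1]
        exact (hg.adj (h 0 (by omega) hl).1).2.2
  have hv : 0 < c.verts := (Nat.zero_le _).trans_lt (hb 0 (Nat.zero_le _))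
  -- The remainder is taken only to obtain vertices for all `i`; it changes nothing in the relevant
  -- range.
  have e : ∀ i ≤ c.len + 1, c.walk i % c.verts = c.walk i := fun i hi => Nat.mod_eq_of_lt (hb i hi)
  refine ⟨fun i => ⟨c.walk i % c.verts, Nat.mod_lt _ hv⟩, e, ?_, ?_⟩
  · simp [h0]
  · simp [h1]

variable {w : ℕ → Fin c.verts}

theorem GoodWalk.walk_adj (hg : c.GoodGraph) (h : c.GoodWalk)
    (hw : ∀ i ≤ c.len + 1, (w i : ℕ) = c.walk i) {i : ℕ} (hi : i < c.len) :
    c.graph.Adj (w i) (w (i + 1)) := by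
  obtain ⟨-, hN, -, -, h, -⟩ := h
  rw [hg.graph_adj, hw i (by omega), hw (i + 1) (by omega)]
  exact (h i (by omega) hi).1

theorem GoodWalk.walk_adj' (hg : c.GoodGraph) (h : c.GoodWalk)
    (hw : ∀ i ≤ c.len + 1, (w i : ℕ) = c.walk i) (h0 : w c.len = w 0) (h1 : w (c.len + 1) = w 1)
    {i : ℕ} (hi : i < c.len) : c.graph.Adj (w (i + 1)) (w (i + 2)) := by
  rcases Nat.lt_or_ge (i + 1) c.len with h2 | h2
  · exact h.walk_adj hg hw h2
  · have e : c.len = i + 1 := by omega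
    rw [show i + 2 = c.len + 1 by omega, ← e, h0, h1]
    exact h.walk_adj hg hw h.1

/-- The walk certifies the standing assumptions: it connects all vertices, and passing through a
vertex without U-turn exhibits two neighbours. -/
theorem GoodWalk.admissible (hg : c.GoodGraph) (h : c.GoodWalk)
    (hw : ∀ i ≤ c.len + 1, (w i : ℕ) = c.walk i) (h0 : w c.len = w 0) (h1 : w (c.len + 1) = w 1) :
    Admissible c.graph := by
  have hN := h.2.1
  have hN' : c.verts ≤ c.N := hg.2.2.2.2.2.1
  have hstep := h.2.2.2.2.1
  have hvis : ∀ v : Fin c.verts, ∃ i < c.len, w (i + 1) = v := by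
    intro v
    obtain ⟨i, hi, hi', h2⟩ := (h.2.2.2.2.2.2 v (v.2.trans_le hN') v.2).1
    exact ⟨i, hi', Fin.ext (by rw [hw (i + 1) (by omega), h2])⟩
  have hreach : ∀ i ≤ c.len, c.graph.Reachable (w 0) (w i) := by
    intro i
    induction i with
    | zero => exact fun _ => .refl _
    | succ i ih => exact fun hi => (ih (by omega)).trans (h.walk_adj hg hw hi).reachable
  refine ⟨?_, fun v => ?_⟩
  · have : Nonempty (Fin c.verts) := ⟨w 0⟩
    refine ⟨fun u v => ?_⟩
    obtain ⟨i, hi, rfl⟩ := hvis u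
    obtain ⟨j, hj, rfl⟩ := hvis v
    exact (hreach (i + 1) hi).symm.trans (hreach (j + 1) hj)
  · obtain ⟨i, hi, rfl⟩ := hvis v
    have a1 := (h.walk_adj hg hw hi).symm
    have a2 := h.walk_adj' hg hw h0 h1 hi
    have hne : w i ≠ w (i + 2) := by
      intro e
      have := congrArg Fin.val e
      rw [hw i (by omega), hw (i + 2) (by omega)] at this
      exact (hstep i (by omega) hi).2.1 this
    rw [← Set.ncard_pair hne]
    refine Set.ncard_le_ncard ?_ (Set.toFinite _)
    rintro x (rfl | rfl)
    · exact a1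
    · exact a2

theorem GoodWalk.isThreading (hg : c.GoodGraph) (h : c.GoodWalk)
    (hw : ∀ i ≤ c.len + 1, (w i : ℕ) = c.walk i) (h0 : w c.len = w 0) (h1 : w (c.len + 1) = w 1) :
    IsThreading c.graph ((List.range c.len).map w) := by
  have hN := h.2.1
  have hN' : c.verts ≤ c.N := hg.2.2.2.2.2.1
  have hstep := h.2.2.2.2.1
  have htri := cyclicTriples_map_range h0 h1
  have hpairs : cyclicPairs ((List.range c.len).map w) =
      (List.range c.len).map fun i => (w i, w (i + 1)) := by
    rw [cyclicPairs_eq_map, htri, List.map_map]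
    rfl
  refine ⟨?_, ?_, ?_, ?_⟩
  · rw [hpairs]
    simp only [List.mem_map, List.mem_range]
    rintro _ ⟨i, hi, rfl⟩
    exact h.walk_adj hg hw hi
  · intro e he
    induction e with | h u v =>
    obtain ⟨e, he, he', h2⟩ := hg.graph_adj.1 he
    obtain ⟨i, hi, hi', h3⟩ := h.2.2.2.2.2.1 e he he'
    rw [walkEdges, hpairs, List.map_map, List.mem_map]
    refine ⟨i, List.mem_range.2 hi', ?_⟩
    have e1 := hw i (by omega)
    have e2 := hw (i + 1) (by omega)
    dsimp only at h2
    simp only [Function.comp_apply, Sym2.eq_iff, Fin.ext_iff]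
    omega
  · rw [htri]
    simp only [List.mem_map, List.mem_range]
    rintro _ ⟨i, hi, rfl⟩ e
    dsimp only at e
    rw [Sym2.eq_swap, Sym2.congr_right] at e
    have := congrArg Fin.val e
    rw [hw i (by omega), hw (i + 2) (by omega)] at this
    exact (hstep i (by omega) hi).2.1 this
  · intro v
    obtain ⟨-, hr, hl⟩ := h.2.2.2.2.2.2 v (v.2.trans_le hN') v.2
    have hrv := (hg.adj hr).2.2
    have hr' : c.graph.Adj v ⟨c.root v, hrv⟩ := hg.graph_adj.2 hr
    -- Levels decrease along passages, so every edge at `v` is joined to the root in the junction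
    -- graph.
    have key : ∀ (n : ℕ) (a : Fin c.verts) (ha : c.graph.Adj v a), c.level v a = n →
        (junctionGraph c.graph ((List.range c.len).map w) v).Reachable
          ⟨s(v, a), ha, Sym2.mem_mk_left _ _⟩
          ⟨s(v, ⟨c.root v, hrv⟩), hr', Sym2.mem_mk_left _ _⟩ := by
      intro n
      induction n using Nat.strong_induction_on with
      | _ n ih =>
        intro a ha hn
        rcases hl a (a.2.trans_le hN') (hg.graph_adj.1 ha) with h2 | ⟨i, hi, hi', h2, h3⟩
        · have : a = ⟨c.root v, hrv⟩ := Fin.ext h2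
          subst this
          exact .refl _
        · have e0 := hw i (by omega)
          have e1 := hw (i + 1) (by omega)
          have e2 := hw (i + 2) (by omega)
          have ev : w (i + 1) = v := Fin.ext (by rw [e1, h2])
          have a1 := (h.walk_adj hg hw hi').symm
          have a2 := h.walk_adj' hg hw h0 h1 hi'
          rw [ev] at a1 a2
          have hne : w i ≠ w (i + 2) := by
            intro e
            have := congrArg Fin.val e
            rw [e0, e2] at this
            exact (hstep i hi hi').2.1 this
          have hadj : (junctionGraph c.graph ((List.range c.len).map w) v).Adj
              ⟨s(v, w i), a1, Sym2.mem_mk_left _ _⟩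
              ⟨s(v, w (i + 2)), a2, Sym2.mem_mk_left _ _⟩ := by
            refine ⟨fun e => hne ?_, Or.inl ⟨w i, w (i + 2), ?_, Sym2.eq_swap, rfl⟩⟩
            · exact Sym2.congr_right.1 (Subtype.ext_iff.1 e)
            · rw [htri, List.mem_map]
              exact ⟨i, List.mem_range.2 hi', by rw [ev]⟩
          rcases h3 with ⟨h3, h4⟩ | ⟨h3, h4⟩
          · have ea : w i = a := Fin.ext (by rw [e0, h3])
            subst ea
            exact hadj.reachable.trans (ih _ (by rw [← hn, e2]; exact h4) _ a2 rfl)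
          · have ea : w (i + 2) = a := Fin.ext (by rw [e2, h3])
            subst ea
            exact hadj.symm.reachable.trans (ih _ (by rw [← hn, e0]; exact h4) _ a1 rfl)
    have hroot : ∀ e : c.graph.incidenceSet v,
        (junctionGraph c.graph ((List.range c.len).map w) v).Reachable e
          ⟨s(v, ⟨c.root v, hrv⟩), hr', Sym2.mem_mk_left _ _⟩ := by
      rintro ⟨e, he⟩
      obtain ⟨a, rfl⟩ := Sym2.mem_iff_exists.1 he.2
      exact key _ a he.1 rfl
    have : Nonempty (c.graph.incidenceSet v) := ⟨⟨_, hr', Sym2.mem_mk_left _ _⟩⟩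
    exact ⟨fun e f => (hroot e).trans (hroot f).symm⟩

theorem GoodCarry.binVal_eq {s : ℕ} {f g : ℕ → ℕ} (hw : c.width < c.N) (h : c.GoodCarry s f g) :
    binVal c.width f = binVal c.width g := by
  obtain ⟨h1, h2, h3, h4, h5⟩ := h
  exact binVal_eq_of_carry h1 h2 h3 h4 fun j hj => h5 j (by omega) hj

/-- Cross-multiplied form of the statement that field `k` over field `l` equals the scaled cost over
the common denominator. -/
theorem GoodCost.mul_eq {s k l : ℕ} (hw : c.width < c.N) (h : c.GoodCost s k l) :
    0 < c.field l ∧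
      c.field l * binVal c.width (c.scaled s) = c.field k * binVal c.width c.denom := by
  obtain ⟨⟨r, hr, hr', h1⟩, h2, h3, h4⟩ := h
  refine ⟨binVal_pos hr' (by omega), ?_⟩
  have e := h4.binVal_eq hw
  rwa [binVal_mul_of_horner (b := c.bit l) (a := c.scaled s) (w := c.prodL s)
      (fun j hj => (h2 j (by omega) hj).1) (fun r hr => (h3 r (by omega) hr).1)
      (fun r hr j hj => (((h3 r (by omega) hr).2.2 j (by omega) (by omega)).1 hj).1)
      (fun r hr j hj => (((h3 r (by omega) hr).2.2 j (by omega) (by omega)).2 hj).1),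
    binVal_mul_of_horner (b := c.bit k) (a := c.denom) (w := c.prodR s)
      (fun j hj => (h2 j (by omega) hj).2) (fun r hr => (h3 r (by omega) hr).2.1)
      (fun r hr j hj => (((h3 r (by omega) hr).2.2 j (by omega) (by omega)).1 hj).2)
      (fun r hr j hj => (((h3 r (by omega) hr).2.2 j (by omega) (by omega)).2 hj).2)] at e

theorem div_eq_div_of_mul_eq {a b x d : ℕ} (hb : 0 < b) (hd : 0 < d) (h : b * x = a * d) :
    (a : ℝ≥0) / b = (x : ℝ≥0) / d := by
  rw [div_eq_div_iff (by positivity) (by positivity)]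
  exact_mod_cast (h.symm.trans (Nat.mul_comm b x))

/-- Over the common denominator, the cost of the walk becomes the last partial sum, and adding the
slack gives the scaled bound. -/
theorem Good.mem_decisionThreading (h : c.Good) : c.x ∈ decisionThreading := by
  obtain ⟨hf, hg, hw, hc⟩ := h
  have hwid := hf.1
  have hturns : c.turns ≤ c.N := by have := hf.2.1; rw [fields] at this; omega
  have hlen := hw.2.1
  have hstep := hw.2.2.2.2.1
  obtain ⟨w, hw1, hw2, hw3⟩ := hw.exists_walk hg
  have hadm := hw.admissible hg hw1 hw2 hw3
  obtain ⟨-, ⟨j, -, hj, hjd⟩, hbound, hcost, hsum0, hsum, hslack⟩ := hc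
  have hD : 0 < binVal c.width c.denom := binVal_pos hj hjd
  have hb := hbound.mul_eq hwid
  have ht (t : ℕ) (ht : t < c.turns) := (hcost t (by omega) ht).mul_eq hwid
  refine ⟨c.toInstance hadm hb.1 fun t h => (ht t h).1, ?_, (List.range c.len).map w,
    hw.isThreading hg hw1 hw2 hw3, ?_⟩
  · rw [ThreadingInstance.encode, toNats_toInstance hf hg]
    exact hf.eq_encodeNats.symm
  · have hpart : ∀ i ≤ c.len, binVal c.width (c.partialSum i) =
        ((List.range i).map fun i => binVal c.width (c.scaled (c.turn i))).sum := by
      intro i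
      induction i with
      | zero => exact fun _ => binVal_zero fun j hj => hsum0 j (by omega) hj
      | succ i ih =>
        intro hi
        rw [binVal_congr (g := fun j => c.partialSum i j + c.scaled (c.turn i) j)
          fun j hj => hsum i (by omega) hi j (by omega) hj, binVal_add, ih (by omega),
          List.range_succ]
        simp
    have hle : binVal c.width (c.partialSum c.len) ≤ binVal c.width (c.scaled c.turns) := by
      rw [← hslack.binVal_eq hwid, binVal_add]
      exact Nat.le_add_right _ _
    have hterm : ∀ i < c.len,
        (c.toInstance hadm hb.1 fun t h => (ht t h).1).cost s(s(w i, w (i + 1)), s(w (i + 1), w (i + 2)))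
          = (binVal c.width (c.scaled (c.turn i)) : ℝ≥0) / (binVal c.width c.denom : ℝ≥0) := by
      intro i hi
      obtain ⟨-, -, h1, h2, h3⟩ := hstep i (by omega) hi
      have hturn : c.IsTurn s(s(w i, w (i + 1)), s(w (i + 1), w (i + 2))) (c.turn i) := by
        refine ⟨h1, ?_⟩
        simp only [Sym2.map_mk, hw1 i (by omega), hw1 (i + 1) (by omega), hw1 (i + 2) (by omega), h2]
        rcases h3 with ⟨h4, h5⟩ | ⟨h4, h5⟩
        · rw [h4, h5]
        · rw [h4, h5]
          exact Sym2.eq_iff.2 (Or.inr ⟨Sym2.eq_swap, Sym2.eq_swap⟩)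
      rw [ThreadingInstance.cost]
      erw [costNum_toInstance hg hturns hturn, costDen_toInstance hg hturns hturn]
      exact div_eq_div_of_mul_eq (ht _ h1).1 hD (ht _ h1).2
    have e := turnCost_map_range
      (c.toInstance hadm hb.1 fun t h => (ht t h).1).cost hw2 hw3
    rw [List.map_congr_left fun i hi => hterm i (List.mem_range.1 hi)] at e
    refine e.trans_le ?_
    have e2 : (c.toInstance hadm hb.1 fun t h => (ht t h).1).bound =
        (binVal c.width (c.scaled c.turns) : ℝ≥0) / (binVal c.width c.denom : ℝ≥0) :=
      div_eq_div_of_mul_eq hb.1 hD hb.2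
    rw [e2]
    have e3 (n : ℕ) : ((List.range n).map fun i =>
          (binVal c.width (c.scaled (c.turn i)) : ℝ≥0) / (binVal c.width c.denom : ℝ≥0)).sum =
        ((((List.range n).map fun i => binVal c.width (c.scaled (c.turn i))).sum : ℕ) : ℝ≥0) /
          (binVal c.width c.denom : ℝ≥0) := by
      induction n with
      | zero => simp
      | succ n ih => simp [List.range_succ, ih, add_div]
    rw [e3, ← hpart c.len le_rfl]
    gcongr

end Ctx

end Threading

namespace Threading

/-! ### Levels as certificates of connectedness. -/

section Levels

/-- The level is the distance from `r`; the next vertex on a shortest path is closer. -/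
theorem exists_levels {α : Type*} [Fintype α] {H : SimpleGraph α} (h : H.Connected) (r : α) :
    ∃ level : α → ℕ, (∀ a, level a < Fintype.card α) ∧
      ∀ a, a = r ∨ ∃ b, H.Adj a b ∧ level b < level a := by
  refine ⟨fun a => H.dist a r, fun a => ?_, fun a => ?_⟩
  · obtain ⟨p, hp, hl⟩ := h.exists_path_of_dist a r
    exact hl.symm.trans_lt hp.length_lt
  · obtain ⟨p, -, hl⟩ := h.exists_path_of_dist a r
    cases p with
    | nil => exact Or.inl rfl
    | cons hab q =>
      refine Or.inr ⟨_, hab, ?_⟩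
      have := SimpleGraph.dist_le q
      rw [SimpleGraph.Walk.length_cons] at hl
      dsimp only
      omega

variable {V : Type*} [Fintype V] {G : SimpleGraph V}

/-- Distances in the junction graph at `v`, with the edge `va` represented by its other endpoint
`a`. -/
theorem IsThreading.exists_levels {T : List V} (hT : IsThreading G T) (v : V) :
    ∃ (r : V) (level : V → ℕ), G.Adj v r ∧ (∀ a, level a ≤ Fintype.card V) ∧
      ∀ a, G.Adj v a → a = r ∨ ∃ b, level b < level a ∧
        ((a, v, b) ∈ cyclicTriples T ∨ (b, v, a) ∈ cyclicTriples T) := by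
  classical
  have hc := hT.junctionConnected v
  obtain ⟨⟨e, he⟩⟩ := hc.nonempty
  obtain ⟨r, rfl⟩ := Sym2.mem_iff_exists.1 he.2
  obtain ⟨level, h1, h2⟩ := Threading.exists_levels hc ⟨s(v, r), he⟩
  have hcard : Fintype.card (G.incidenceSet v) ≤ Fintype.card V := by
    have h3 : Fintype.card (G.incidenceSet v) = G.degree v := by
      rw [← G.card_incidenceFinset_eq_degree v, SimpleGraph.incidenceFinset, Set.toFinset_card]
    rw [h3]
    exact (G.degree_lt_card_verts v).le
  refine ⟨r, fun a => if h : s(v, a) ∈ G.incidenceSet v then level ⟨s(v, a), h⟩ else 0,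
    he.1, fun a => ?_, fun a ha => ?_⟩
  · dsimp only
    split_ifs
    · exact (h1 _).le.trans hcard
    · exact Nat.zero_le _
  · rcases h2 ⟨s(v, a), ha, Sym2.mem_mk_left _ _⟩ with h3 | ⟨⟨f, hf⟩, ⟨hne, h3⟩, h4⟩
    · exact Or.inl (Sym2.congr_right.1 (Subtype.ext_iff.1 h3))
    · obtain ⟨b, rfl⟩ := Sym2.mem_iff_exists.1 hf.2
      refine Or.inr ⟨b, ?_, ?_⟩
      · have ha' : s(v, a) ∈ G.incidenceSet v := ⟨ha, Sym2.mem_mk_left _ _⟩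
        dsimp only
        rw [dif_pos ha', dif_pos hf]
        exact h4
      · rcases h3 with ⟨x, y, ht, h5, h6⟩ | ⟨x, y, ht, h5, h6⟩
        · dsimp only at h5 h6
          rw [Sym2.eq_swap, Sym2.congr_left] at h5
          rw [Sym2.congr_right] at h6
          rw [h5, h6]
          exact Or.inl ht
        · dsimp only at h5 h6
          rw [Sym2.eq_swap, Sym2.congr_left] at h5
          rw [Sym2.congr_right] at h6
          rw [h5, h6]
          exact Or.inr ht

end Levels

/-! ### Sizes and fields of an encoded instance, and witnesses of polynomial length. -/

section Encoding

theorem length_le_encodeNats (l : List ℕ) : l.length ≤ (encodeNats l).length := by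
  induction l with
  | nil => simp
  | cons a l ih =>
    simp only [encodeNats, List.flatMap_cons, List.length_append, List.length_cons] at ih ⊢
    omega

theorem encodeNats_append (l l' : List ℕ) :
    encodeNats (l ++ l') = encodeNats l ++ encodeNats l' := by
  simp [encodeNats]

theorem encodeNats_cons (a : ℕ) (l : List ℕ) :
    encodeNats (a :: l) = (Nat.bits a).map some ++ none :: encodeNats l := by
  simp [encodeNats]

/-- The product of the positive entries is at most exponential in the length of the string. -/
theorem prod_max_le (l : List ℕ) : (l.map fun a => max a 1).prod ≤ 2 ^ (encodeNats l).length := by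
  induction l with
  | nil => exact Nat.one_le_two_pow
  | cons a l ih =>
    rw [List.map_cons, List.prod_cons, encodeNats_cons, List.length_append, pow_add]
    refine Nat.mul_le_mul ?_ (ih.trans (Nat.pow_le_pow_right (by omega) (by simp)))
    rw [List.length_map, Nat.size_eq_bits_len]
    exact max_le (Nat.lt_size_self a).le (Nat.one_le_two_pow)

namespace ThreadingInstance

variable (I : ThreadingInstance)

/-- The number of fields before the turns. -/
def base : ℕ := 4 + 2 * I.edgeList.length

theorem length_toNats : I.toNats.length = I.base + 5 * I.turnList.length := by
  simp [toNats, base, List.length_flatMap, Nat.mul_comm]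
  omega

theorem length_toNats_le : I.base + 5 * I.turnList.length ≤ I.encode.length :=
  I.length_toNats ▸ length_le_encodeNats _

theorem ncard_edgeSet_le : I.G.edgeSet.ncard ≤ I.edgeList.length := by
  classical
  have h : I.G.edgeSet ⊆ ((I.edgeList.map fun p => s(p.1, p.2)).toFinset : Set (Sym2 (Fin I.n))) := by
    intro e he
    induction e with | h u v =>
    simp only [List.coe_toFinset, List.mem_map, Set.mem_ofPred_eq]
    have hadj : I.G.Adj u v := he
    rcases lt_or_gt_of_ne hadj.ne with h | h
    · exact ⟨(u, v), I.mem_edgeList.2 ⟨h, hadj⟩, rfl⟩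
    · exact ⟨(v, u), I.mem_edgeList.2 ⟨h, hadj.symm⟩, Sym2.eq_swap⟩
  refine (Set.ncard_le_ncard h (Set.toFinite _)).trans ?_
  rw [Set.ncard_coe_finset]
  exact (List.toFinset_card_le _).trans_eq (List.length_map _)

/-- A field of the encoding. -/
def fieldVal (k : ℕ) : ℕ := I.toNats.getD k 0

theorem getElem?_flatMap {α β : Type*} {f : α → List β} {k : ℕ} (hf : ∀ a, (f a).length = k)
    (l : List α) (e i : ℕ) (hi : i < k) : (l.flatMap f)[k * e + i]? = l[e]?.bind fun a => (f a)[i]? := by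
  induction l generalizing e with
  | nil => simp
  | cons a l ih =>
    rw [List.flatMap_cons]
    rcases e with _ | e
    · rw [Nat.mul_zero, Nat.zero_add, List.getElem?_append_left (by rw [hf]; exact hi)]
      rfl
    · rw [List.getElem?_append_right (by rw [hf, Nat.mul_succ]; omega), hf,
        show k * (e + 1) + i - k = k * e + i by rw [Nat.mul_succ]; omega, ih]
      rfl

theorem fieldVal_edge {e : ℕ} (he : e < I.edgeList.length) :
    I.fieldVal (4 + 2 * e + 0) = I.edgeList[e].1 ∧ I.fieldVal (4 + 2 * e + 1) = I.edgeList[e].2 := by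
  have key (i : ℕ) (hi : i < 2) : I.toNats[4 + 2 * e + i]? =
      [(I.edgeList[e].1 : ℕ), (I.edgeList[e].2 : ℕ)][i]? := by
    rw [toNats, List.getElem?_append_left
      (by simp [List.length_flatMap]; omega), List.getElem?_append_right (by simp; omega)]
    have e1 : 4 + 2 * e + i - [I.n, I.boundNum, I.boundDen, I.edgeList.length].length =
      2 * e + i := by simp; omega
    rw [e1, getElem?_flatMap (k := 2) (fun _ => rfl) _ _ _ hi, List.getElem?_eq_getElem he]
    rfl
  exact ⟨by rw [fieldVal, List.getD_eq_getElem?_getD, key 0 (by omega)]; rfl,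
    by rw [fieldVal, List.getD_eq_getElem?_getD, key 1 (by omega)]; rfl⟩

theorem fieldVal_turn {t : ℕ} (ht : t < I.turnList.length) :
    I.fieldVal (I.base + 5 * t + 0) = I.turnList[t].1 ∧
    I.fieldVal (I.base + 5 * t + 1) = I.turnList[t].2.1 ∧
    I.fieldVal (I.base + 5 * t + 2) = I.turnList[t].2.2 ∧
    I.fieldVal (I.base + 5 * t + 3) = I.costNum s(s(I.turnList[t].1, I.turnList[t].2.1),
      s(I.turnList[t].2.1, I.turnList[t].2.2)) ∧
    I.fieldVal (I.base + 5 * t + 4) = I.costDen s(s(I.turnList[t].1, I.turnList[t].2.1),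
      s(I.turnList[t].2.1, I.turnList[t].2.2)) := by
  have key (i : ℕ) (hi : i < 5) : I.toNats[I.base + 5 * t + i]? =
      [(I.turnList[t].1 : ℕ), (I.turnList[t].2.1 : ℕ), (I.turnList[t].2.2 : ℕ),
        I.costNum s(s(I.turnList[t].1, I.turnList[t].2.1),
          s(I.turnList[t].2.1, I.turnList[t].2.2)),
        I.costDen s(s(I.turnList[t].1, I.turnList[t].2.1),
          s(I.turnList[t].2.1, I.turnList[t].2.2))][i]? := by
    have e0 : ([I.n, I.boundNum, I.boundDen, I.edgeList.length] ++
        I.edgeList.flatMap (fun p => [(p.1 : ℕ), (p.2 : ℕ)])).length = I.base := by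
      simp [List.length_flatMap, base, Nat.mul_comm]; omega
    rw [toNats, List.getElem?_append_right (by rw [e0]; omega), e0,
      show I.base + 5 * t + i - I.base = 5 * t + i by omega,
      getElem?_flatMap (k := 5) (fun _ => rfl) _ _ _ hi, List.getElem?_eq_getElem ht]
    rfl
  exact ⟨by rw [fieldVal, List.getD_eq_getElem?_getD, key 0 (by omega)]; rfl,
    by rw [fieldVal, List.getD_eq_getElem?_getD, key 1 (by omega)]; rfl,
    by rw [fieldVal, List.getD_eq_getElem?_getD, key 2 (by omega)]; rfl,
    by rw [fieldVal, List.getD_eq_getElem?_getD, key 3 (by omega)]; rfl,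
    by rw [fieldVal, List.getD_eq_getElem?_getD, key 4 (by omega)]; rfl⟩

theorem fieldVal_lt (k : ℕ) : I.fieldVal k < 2 ^ I.encode.length := by
  rw [fieldVal, List.getD_eq_getElem?_getD]
  rcases h : I.toNats[k]? with _ | a
  · simp
  · rw [Option.getD_some]
    obtain ⟨l, l', e⟩ := List.append_of_mem (List.mem_of_getElem? h)
    refine (Nat.lt_size_self a).trans_le (Nat.pow_le_pow_right (by omega) ?_)
    rw [encode, e, encodeNats_append, encodeNats_cons, ← Nat.size_eq_bits_len]
    simp only [List.length_append, List.length_map, List.length_cons]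
    omega

/-- A common multiple of all denominators. -/
def denomVal : ℕ := (I.toNats.map fun a => max a 1).prod

theorem denomVal_pos : 0 < I.denomVal :=
  List.prod_pos fun a ha => by
    obtain ⟨b, -, rfl⟩ := List.mem_map.1 ha
    exact lt_max_of_lt_right one_pos

/-- The product contains all positive fields, not only denominators; its binary length is still
controlled by that of the input. -/
theorem denomVal_le : I.denomVal ≤ 2 ^ I.encode.length := prod_max_le _

theorem fieldVal_dvd {k : ℕ} (h : 0 < I.fieldVal k) : I.fieldVal k ∣ I.denomVal := by
  rw [fieldVal, List.getD_eq_getElem?_getD] at h ⊢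
  rcases hk : I.toNats[k]? with _ | a
  · rw [hk] at h; simp at h
  · rw [hk, Option.getD_some] at h
    rw [Option.getD_some]
    refine List.dvd_prod (List.mem_map.2 ⟨a, List.mem_of_getElem? hk, ?_⟩)
    exact max_eq_left h

end ThreadingInstance

end Encoding

/-- A walk of length `ℓ` with turns `κ` that is, as witnessed by roots and levels of the junction
graphs, a threading that proves that the instance is a yes-instance. -/
structure IsWitness (I : ThreadingInstance) (ℓ : ℕ) (w : ℕ → Fin I.n) (κ : ℕ → ℕ)
    (root : Fin I.n → Fin I.n) (level : Fin I.n → Fin I.n → ℕ) : Prop where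
  len_pos : 0 < ℓ
  walk_len : w ℓ = w 0
  walk_len_succ : w (ℓ + 1) = w 1
  len_le : ℓ ≤ 4 * I.encode.length ^ 3
  verts_le : I.n ≤ ℓ
  adj : ∀ i < ℓ, I.G.Adj (w i) (w (i + 1))
  ne : ∀ i < ℓ, w i ≠ w (i + 2)
  turn : ∀ i < ℓ, ∃ h : κ i < I.turnList.length, I.turnList[κ i] = (w i, w (i + 1), w (i + 2)) ∨
    I.turnList[κ i] = (w (i + 2), w (i + 1), w i)
  edges : ∀ u v, I.G.Adj u v → ∃ i < ℓ, (u = w i ∧ v = w (i + 1)) ∨ (u = w (i + 1) ∧ v = w i)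
  verts : ∀ v, ∃ i < ℓ, w (i + 1) = v
  root_adj : ∀ v, I.G.Adj v (root v)
  level_le : ∀ v a, level v a ≤ I.n
  level_spec : ∀ v a, I.G.Adj v a → a = root v ∨ ∃ i < ℓ, w (i + 1) = v ∧
    ((w i = a ∧ level v (w (i + 2)) < level v a) ∨ (w (i + 2) = a ∧ level v (w i) < level v a))
  cost : ((List.range ℓ).map fun i =>
    I.cost s(s(w i, w (i + 1)), s(w (i + 1), w (i + 2)))).sum ≤ I.bound

/-- Here the deletion of redundant cycles enters the proof of membership in NP: an arbitrary
threading is replaced by a short one that is no more expensive. -/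
theorem ThreadingInstance.IsYes.exists_isWitness {I : ThreadingInstance} (h : I.IsYes) :
    ∃ ℓ w κ root level, IsWitness I ℓ w κ root level := by
  classical
  obtain ⟨T0, hT0, hc0⟩ := h
  obtain ⟨T, -, hT, hc, htr⟩ := hT0.exists_short I.admissible
  have hcost := (hc I.cost).trans hc0
  have hlen : T.length ≤ 4 * I.encode.length ^ 3 := by
    have h1 := hT.length_le htr
    have h2 := I.ncard_edgeSet_le
    have h3 := I.length_toNats_le
    have h4 : I.G.edgeSet.ncard ≤ I.encode.length := by rw [ThreadingInstance.base] at h3; omega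
    generalize I.G.edgeSet.ncard = m at *
    generalize I.encode.length = X at *
    -- Each of the `m` edges is traversed at most `4m` times, and `m` is at most the length of the
    -- input.
    have h5 : m * (4 * m) ≤ X * (4 * X) := Nat.mul_le_mul h4 (by omega)
    rcases Nat.eq_zero_or_pos X with rfl | hX
    · have : m = 0 := by omega
      subst this
      simpa using h1
    · nlinarith [Nat.mul_le_mul_left (4 * X * X) hX]
  obtain ⟨v0⟩ := I.admissible.1.nonempty
  have hne : 0 < T.length := by
    obtain ⟨r, -, hr, -⟩ := hT.exists_levels v0
    have := hT.visitsEdges s(v0, r) hr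
    rw [List.length_pos_iff]
    rintro rfl
    simp [walkEdges, cyclicPairs] at this
  obtain ⟨ℓ, hℓ⟩ : ∃ ℓ, T.length = ℓ := ⟨_, rfl⟩
  rw [hℓ] at hlen hne
  -- Periodic continuation, so that the passages around the end need no special treatment.
  obtain ⟨w, hw⟩ : ∃ w : ℕ → Fin I.n, w = fun i => T[i % ℓ]'(by rw [hℓ]; exact Nat.mod_lt _ hne) := ⟨_, rfl⟩
  have hTw : T = (List.range ℓ).map w := by
    refine List.ext_getElem (by simp [hℓ]) fun i h1 h2 => ?_
    simp only [hw, List.getElem_map, List.getElem_range]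
    congr 1
    exact (Nat.mod_eq_of_lt (hℓ ▸ h1)).symm
  have hw0 : w ℓ = w 0 := by simp [hw]
  have hw1 : w (ℓ + 1) = w 1 := by simp [hw]
  clear hw
  subst hTw
  have htri := cyclicTriples_map_range hw0 hw1
  have hpairs : cyclicPairs ((List.range ℓ).map w) = (List.range ℓ).map fun i => (w i, w (i + 1)) := by
    rw [cyclicPairs_eq_map, htri, List.map_map]
    rfl
  have hadj : ∀ i < ℓ, I.G.Adj (w i) (w (i + 1)) := fun i hi =>
    hT.closedWalk (w i, w (i + 1)) (by rw [hpairs]; exact List.mem_map.2 ⟨i, List.mem_range.2 hi, rfl⟩)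
  have hmem : ∀ i < ℓ, (w i, w (i + 1), w (i + 2)) ∈ cyclicTriples ((List.range ℓ).map w) :=
    fun i hi => by rw [htri]; exact List.mem_map.2 ⟨i, List.mem_range.2 hi, rfl⟩
  have hmem' : ∀ a v b, (a, v, b) ∈ cyclicTriples ((List.range ℓ).map w) →
      ∃ i < ℓ, w i = a ∧ w (i + 1) = v ∧ w (i + 2) = b := by
    intro a v b h
    rw [htri] at h
    obtain ⟨i, hi, h⟩ := List.mem_map.1 h
    simp only [Prod.mk.injEq] at h
    exact ⟨i, List.mem_range.1 hi, h⟩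
  have hne2 : ∀ i < ℓ, w i ≠ w (i + 2) := fun i hi h =>
    hT.noUTurn _ (hmem i hi) (by dsimp only; rw [h]; exact Sym2.eq_swap)
  have hturn : ∀ i < ℓ, ∃ t, ∃ h : t < I.turnList.length,
      I.turnList[t] = (w i, w (i + 1), w (i + 2)) ∨ I.turnList[t] = (w (i + 2), w (i + 1), w i) := by
    intro i hi
    have h1 := hadj i hi
    have h2 : I.G.Adj (w (i + 1)) (w (i + 2)) :=
      hT.closedWalk _ (mem_cyclicPairs_of_mem_cyclicTriples (hmem i hi)).2
    rcases lt_or_gt_of_ne (hne2 i hi) with h | h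
    · obtain ⟨t, ht, e⟩ := List.getElem_of_mem
        (I.mem_turnList (t := (w i, w (i + 1), w (i + 2))).2 ⟨h, h1, h2⟩)
      exact ⟨t, ht, Or.inl e⟩
    · obtain ⟨t, ht, e⟩ := List.getElem_of_mem
        (I.mem_turnList (t := (w (i + 2), w (i + 1), w i)).2 ⟨h, h2.symm, h1.symm⟩)
      exact ⟨t, ht, Or.inr e⟩
  choose! κ hκ using hturn
  choose root level h1 h2 h3 using hT.exists_levels
  have hedges : ∀ u v, I.G.Adj u v →
      ∃ i < ℓ, (u = w i ∧ v = w (i + 1)) ∨ (u = w (i + 1) ∧ v = w i) := by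
    intro u v huv
    have := hT.visitsEdges s(u, v) huv
    rw [walkEdges, hpairs, List.map_map] at this
    obtain ⟨i, hi, e⟩ := List.mem_map.1 this
    refine ⟨i, List.mem_range.1 hi, ?_⟩
    rcases Sym2.eq_iff.1 e with ⟨e1, e2⟩ | ⟨e1, e2⟩
    · exact Or.inl ⟨e1.symm, e2.symm⟩
    · exact Or.inr ⟨e2.symm, e1.symm⟩
  have hverts : ∀ v, ∃ i < ℓ, w (i + 1) = v := by
    intro v
    obtain ⟨i, hi, ⟨h, -⟩ | ⟨h, -⟩⟩ := hedges _ _ (h1 v)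
    · rcases i with _ | i
      · exact ⟨ℓ - 1, by omega, by rw [Nat.sub_add_cancel hne, hw0, h]⟩
      · exact ⟨i, by omega, h.symm⟩
    · exact ⟨i, hi, h.symm⟩
  refine ⟨ℓ, w, κ, root, level, hne, hw0, hw1, hlen, ?_, hadj, hne2, hκ, hedges, hverts, h1, ?_, ?_,
    ?_⟩
  · have : Function.Surjective fun i : Fin ℓ => w (i + 1) := fun v =>
      let ⟨i, hi, h⟩ := hverts v
      ⟨⟨i, hi⟩, h⟩
    simpa using Fintype.card_le_of_surjective _ this
  · intro v a
    simpa using h2 v a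
  · intro v a hva
    refine (h3 v a hva).imp_right ?_
    rintro ⟨b, hb, h | h⟩
    · obtain ⟨i, hi, e1, e2, e3⟩ := hmem' _ _ _ h
      exact ⟨i, hi, e2, Or.inl ⟨e1, by rw [e3]; exact hb⟩⟩
    · obtain ⟨i, hi, e1, e2, e3⟩ := hmem' _ _ _ h
      exact ⟨i, hi, e2, Or.inr ⟨e3, by rw [e1]; exact hb⟩⟩
  · rw [turnCost_map_range _ hw0 hw1] at hcost
    exact hcost

end Threading

namespace Threading

/-! ### Digits, convolutions and carries of actual numbers. -/

section Digits

/-- A binary digit of a number. -/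
def digit (a j : ℕ) : ℕ := a / 2 ^ j % 2

theorem digit_le (a j : ℕ) : digit a j ≤ 1 := Nat.le_of_lt_succ (Nat.mod_lt _ two_pos)

theorem div_two_pow_eq (a j : ℕ) : a / 2 ^ j = digit a j + 2 * (a / 2 ^ (j + 1)) := by
  rw [digit, pow_succ, ← Nat.div_div_eq_div_mul]
  exact (Nat.mod_add_div _ 2).symm

theorem digit_eq_zero {a j : ℕ} (h : a < 2 ^ j) : digit a j = 0 := by
  rw [digit, Nat.div_eq_of_lt h]

theorem digit_eq_zero_of_le {a j n : ℕ} (h : a < 2 ^ n) (hj : n ≤ j) : digit a j = 0 :=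
  digit_eq_zero (h.trans_le (Nat.pow_le_pow_right two_pos hj))

theorem binVal_succ_last (n : ℕ) (f : ℕ → ℕ) : binVal (n + 1) f = binVal n f + f n * 2 ^ n :=
  Finset.sum_range_succ _ _

theorem binVal_digit_mod (n a : ℕ) : binVal n (digit a) = a % 2 ^ n := by
  induction n with
  | zero => simp [binVal, Nat.mod_one]
  | succ n ih => rw [binVal_succ_last, ih, Nat.mod_pow_succ, digit, Nat.mul_comm]

theorem binVal_digit {n a : ℕ} (h : a < 2 ^ n) : binVal n (digit a) = a := by
  rw [binVal_digit_mod, Nat.mod_eq_of_lt h]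

theorem digit_size {a j : ℕ} (h : j + 1 = Nat.size a) : digit a j = 1 := by
  have h1 : 2 ^ j ≤ a := Nat.lt_size.1 (by omega)
  have h2 : a < 2 ^ (j + 1) := h ▸ Nat.lt_size_self a
  have h3 : a / 2 ^ j = 1 := by
    rw [Nat.div_eq_iff (by positivity)]
    rw [pow_succ] at h2
    omega
  rw [digit, h3]

theorem bits_eq_map (a : ℕ) :
    Nat.bits a = (List.range (Nat.size a)).map fun j => digit a j == 1 := by
  have := bits_binVal (n := Nat.size a) (b := digit a) (fun j _ => digit_le a j)
    fun j hj => digit_size hj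
  rwa [binVal_digit (Nat.lt_size_self a)] at this

/-- The digits of a partial product. -/
def conv (b a : ℕ → ℕ) (r j : ℕ) : ℕ := ∑ i ∈ Finset.range (j + 1), b (r + i) * a (j - i)

theorem conv_zero (b a : ℕ → ℕ) (r : ℕ) : conv b a r 0 = b r * a 0 := by simp [conv]

/-- Splitting off the first term shifts `b` instead of `a`; this is the recursion of the Horner
scheme for products. -/
theorem conv_succ (b a : ℕ → ℕ) (r j : ℕ) :
    conv b a r (j + 1) = b r * a (j + 1) + conv b a (r + 1) j := by
  rw [conv, Finset.sum_range_succ', Nat.add_comm, conv]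
  congr 1
  refine Finset.sum_congr rfl fun i _ => ?_
  rw [show r + (i + 1) = r + 1 + i by omega, show j + 1 - (i + 1) = j - i by omega]

/-- Without carries the digits of a product grow at most linearly, so they fit into the tables. -/
theorem conv_le {b a : ℕ → ℕ} (hb : ∀ j, b j ≤ 1) (ha : ∀ j, a j ≤ 1) (r j : ℕ) :
    conv b a r j ≤ j + 1 := by
  refine (Finset.sum_le_card_nsmul _ _ 1 fun i _ => ?_).trans_eq (by simp)
  exact Nat.mul_le_mul (hb _) (ha _)

theorem conv_eq_zero {b a : ℕ → ℕ} {p q : ℕ} (hb : ∀ j, p ≤ j → b j = 0)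
    (ha : ∀ j, q ≤ j → a j = 0) {r j : ℕ} (h : p + q ≤ r + j + 1) : conv b a r j = 0 := by
  refine Finset.sum_eq_zero fun i hi => ?_
  rw [Finset.mem_range] at hi
  rcases Nat.lt_or_ge (r + i) p with h1 | h1
  · rw [ha (j - i) (by omega), Nat.mul_zero]
  · rw [hb _ h1, Nat.zero_mul]

/-- The carry into a digit. -/
def carry (f : ℕ → ℕ) (j : ℕ) : ℕ := binVal j f / 2 ^ j

/-- The first `j` digits contribute at most `M * 2 ^ j`, so carries are no larger than digits. -/
theorem carry_le {f : ℕ → ℕ} {M j : ℕ} (h : ∀ i < j, f i ≤ M) : carry f j ≤ M := by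
  refine Nat.div_le_of_le_mul ?_
  induction j with
  | zero => simp [binVal]
  | succ j ih =>
    have h1 := ih fun i hi => h i (by omega)
    have h2 := Nat.mul_le_mul_right (2 ^ j) (h j (Nat.lt_succ_self j))
    rw [binVal_succ_last, pow_succ]
    nlinarith

/-- Normalisation of an unreduced expansion: later places contribute multiples of `2 ^ (j + 1)`, so
the digit produced in place `j` is that of the whole value. -/
theorem add_carry {n j : ℕ} (f : ℕ → ℕ) (hj : j < n) :
    f j + carry f j = digit (binVal n f) j + 2 * carry f (j + 1) := by
  have h1 : f j + carry f j = binVal (j + 1) f / 2 ^ j := by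
    rw [binVal_succ_last, Nat.add_mul_div_right _ _ (by positivity), carry, Nat.add_comm]
  have h2 : digit (binVal n f) j = digit (binVal (j + 1) f) j := by
    obtain ⟨k, rfl⟩ := Nat.exists_eq_add_of_lt hj
    clear h1 hj
    induction k with
    | zero => rfl
    | succ k ih =>
      rw [← ih, show j + (k + 1) + 1 = (j + k + 1) + 1 by omega, binVal_succ_last]
      have e : f (j + k + 1) * 2 ^ (j + k + 1) = 2 ^ j * (2 * (f (j + k + 1) * 2 ^ k)) := by ring
      rw [digit, digit, e, Nat.add_mul_div_left _ _ (by positivity), Nat.add_mul_mod_self_left]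
  rw [h1, h2, div_two_pow_eq, carry]

theorem carry_step {n j : ℕ} {f g : ℕ → ℕ} (h : binVal n f = binVal n g) (hj : j < n) :
    f j + carry f j + 2 * carry g (j + 1) = g j + carry g j + 2 * carry f (j + 1) := by
  rw [add_carry f hj, add_carry g hj, h]
  omega

theorem carry_zero (f : ℕ → ℕ) : carry f 0 = 0 := by simp [carry, binVal]

theorem carry_last {n : ℕ} {f : ℕ → ℕ} (h : binVal n f < 2 ^ n) : carry f n = 0 :=
  Nat.div_eq_of_lt h

theorem binVal_conv {n p q : ℕ} {b a : ℕ → ℕ} (hb : ∀ j, p ≤ j → b j = 0)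
    (ha : ∀ j, q ≤ j → a j = 0) (h : p + q ≤ n) :
    binVal n (conv b a 0) = binVal n b * binVal n a :=
  binVal_mul_of_horner (w := conv b a) (fun _ _ => conv_eq_zero hb ha (by omega))
    (fun r _ => conv_zero b a r) (fun r _ j _ => conv_succ b a r j)
    (fun _ _ _ _ => conv_eq_zero hb ha (by omega))

end Digits

/-! ### Costs as integers over a common denominator. -/

namespace ThreadingInstance

variable (I : ThreadingInstance)

/-- The field with the numerator of the cost of a turn, or of the bound. -/
def numIdx (s : ℕ) : ℕ := if s = I.turnList.length then 1 else I.base + 5 * s + 3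

/-- The field with the denominator of the cost of a turn, or of the bound. -/
def denIdx (s : ℕ) : ℕ := if s = I.turnList.length then 2 else I.base + 5 * s + 4

/-- The cost of a turn, or the bound, multiplied by the common denominator. -/
def scaledVal (s : ℕ) : ℕ := I.fieldVal (I.numIdx s) * (I.denomVal / I.fieldVal (I.denIdx s))

theorem numIdx_last : I.numIdx I.turnList.length = 1 := if_pos rfl

theorem denIdx_last : I.denIdx I.turnList.length = 2 := if_pos rfl

theorem numIdx_turn {s : ℕ} (h : s < I.turnList.length) : I.numIdx s = I.base + 5 * s + 3 :=
  if_neg h.ne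

theorem denIdx_turn {s : ℕ} (h : s < I.turnList.length) : I.denIdx s = I.base + 5 * s + 4 :=
  if_neg h.ne

theorem numIdx_lt {s : ℕ} (h : s ≤ I.turnList.length) :
    I.numIdx s < I.base + 5 * I.turnList.length := by
  rw [numIdx, base]
  split_ifs <;> omega

theorem denIdx_lt {s : ℕ} (h : s ≤ I.turnList.length) :
    I.denIdx s < I.base + 5 * I.turnList.length := by
  rw [denIdx, base]
  split_ifs <;> omega

theorem fieldVal_denIdx_pos {s : ℕ} (h : s ≤ I.turnList.length) :
    0 < I.fieldVal (I.denIdx s) := by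
  rcases h.eq_or_lt with rfl | h
  · rw [denIdx_last]
    exact I.boundDen_pos
  · rw [denIdx_turn _ h, (I.fieldVal_turn h).2.2.2.2]
    exact I.costDen_pos _

theorem mul_scaledVal {s : ℕ} (h : s ≤ I.turnList.length) :
    I.fieldVal (I.denIdx s) * I.scaledVal s = I.fieldVal (I.numIdx s) * I.denomVal := by
  rw [scaledVal, Nat.mul_left_comm, Nat.mul_div_cancel' (I.fieldVal_dvd (I.fieldVal_denIdx_pos h))]

theorem scaledVal_lt (s : ℕ) : I.scaledVal s < 2 ^ (2 * I.encode.length) := by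
  rw [scaledVal, two_mul, pow_add]
  refine Nat.mul_lt_mul_of_lt_of_le (I.fieldVal_lt _) ((Nat.div_le_self _ _).trans I.denomVal_le) ?_
  positivity

theorem cost_turn {t : ℕ} (ht : t < I.turnList.length) :
    I.cost s(s(I.turnList[t].1, I.turnList[t].2.1), s(I.turnList[t].2.1, I.turnList[t].2.2)) =
      (I.scaledVal t : ℝ≥0) / (I.denomVal : ℝ≥0) := by
  obtain ⟨-, -, -, h3, h4⟩ := I.fieldVal_turn ht
  rw [cost, ← h3, ← h4, ← I.numIdx_turn ht, ← I.denIdx_turn ht]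
  exact Ctx.div_eq_div_of_mul_eq (I.fieldVal_denIdx_pos ht.le) I.denomVal_pos (I.mul_scaledVal ht.le)

theorem bound_eq : I.bound = (I.scaledVal I.turnList.length : ℝ≥0) / (I.denomVal : ℝ≥0) := by
  have h := I.mul_scaledVal le_rfl
  rw [I.numIdx_last, I.denIdx_last] at h
  exact Ctx.div_eq_div_of_mul_eq I.boundDen_pos I.denomVal_pos h

/-- The cost inequality multiplied by the common denominator. A turn may be traversed against its
listed order, which does not affect its cost. -/
theorem sum_scaledVal_le {ℓ : ℕ} {w : ℕ → Fin I.n} {κ : ℕ → ℕ} {root : Fin I.n → Fin I.n}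
    {level : Fin I.n → Fin I.n → ℕ} (h : IsWitness I ℓ w κ root level) :
    ∑ i ∈ Finset.range ℓ, I.scaledVal (κ i) ≤ I.scaledVal I.turnList.length := by
  have h1 := h.cost
  have h2 : ∀ i ∈ List.range ℓ, I.cost s(s(w i, w (i + 1)), s(w (i + 1), w (i + 2))) =
      (I.scaledVal (κ i) : ℝ≥0) / (I.denomVal : ℝ≥0) := by
    intro i hi
    obtain ⟨hκ, e | e⟩ := h.turn i (List.mem_range.1 hi)
    · rw [← I.cost_turn hκ, e]
    · rw [← I.cost_turn hκ, e]
      congr 1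
      exact Sym2.eq_iff.2 (Or.inr ⟨Sym2.eq_swap, Sym2.eq_swap⟩)
  rw [List.map_congr_left h2, I.bound_eq] at h1
  have h3 : ∀ n, ((List.range n).map fun i => (I.scaledVal (κ i) : ℝ≥0) / (I.denomVal : ℝ≥0)).sum =
      ((∑ i ∈ Finset.range n, I.scaledVal (κ i) : ℕ) : ℝ≥0) / (I.denomVal : ℝ≥0) := by
    intro n
    induction n with
    | zero => simp
    | succ n ih => rw [List.range_succ, List.map_append, List.sum_append, ih,
        Finset.sum_range_succ, Nat.cast_add, add_div]; simp
  rw [h3, div_le_div_iff_of_pos_right (by exact_mod_cast I.denomVal_pos)] at h1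
  exact_mod_cast h1

end ThreadingInstance
end Threading

namespace Threading

/-! ### Completeness: the tables of a witness satisfy the formula. -/

section Completeness

variable {c : Ctx} {I : ThreadingInstance} {ℓ : ℕ} {w : ℕ → Fin I.n} {κ : ℕ → ℕ}
  {root : Fin I.n → Fin I.n} {level : Fin I.n → Fin I.n → ℕ}

namespace ThreadingInstance

variable (I ℓ κ)

/-- The digits of the scaled cost of an initial part of a walk. -/
def partialDigit (i j : ℕ) : ℕ := ∑ a ∈ Finset.range i, digit (I.scaledVal (κ a)) j

/-- The difference of the scaled bound and the scaled cost of a walk. -/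
def slackVal : ℕ := I.scaledVal I.turnList.length - ∑ a ∈ Finset.range ℓ, I.scaledVal (κ a)

/-- The left side of the equation for a scaled cost or for the cost of the walk. -/
def lhs (s : ℕ) : ℕ → ℕ :=
  if s ≤ I.turnList.length then
    conv (digit (I.fieldVal (I.denIdx s))) (digit (I.scaledVal s)) 0
  else fun j => I.partialDigit κ ℓ j + digit (I.slackVal ℓ κ) j

/-- The right side of the equation for a scaled cost or for the cost of the walk. -/
def rhs (s : ℕ) : ℕ → ℕ :=
  if s ≤ I.turnList.length then
    conv (digit (I.fieldVal (I.numIdx s))) (digit I.denomVal) 0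
  else digit (I.scaledVal I.turnList.length)

theorem partialDigit_le (i j : ℕ) : I.partialDigit κ i j ≤ i :=
  (Finset.sum_le_card_nsmul _ _ 1 fun _ _ => digit_le _ _).trans_eq (by simp)

variable (w root level)

/-- The tables that prove that an instance is a yes-instance. -/
def tables (t i j k : ℕ) : ℕ :=
  match t with
  -- With `X` the length of the input, denominators have at most `X` digits and scaled costs `2X`,
  -- so their products fit into `3X` digits; the width leaves a margin.
  | 0 => if i = 0 then I.turnList.length else if i = 1 then ℓ else 4 * I.encode.length + 4
  | 1 => (encodeNats (I.toNats.take i)).length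
  | 2 => Nat.size (I.fieldVal i)
  | 3 => digit (I.fieldVal i) j
  | 4 => I.fieldVal i / 2 ^ j
  | 5 => w i
  | 6 => κ i
  | 7 => if h : i < I.n then root ⟨i, h⟩ else 0
  | 8 => if h : i < I.n then if h' : j < I.n then level ⟨i, h⟩ ⟨j, h'⟩ else 0 else 0
  | 9 => digit (I.scaledVal i) j
  | 10 => digit I.denomVal i
  | 11 => conv (digit (I.fieldVal (I.denIdx i))) (digit (I.scaledVal i)) j k
  | 12 => conv (digit (I.fieldVal (I.numIdx i))) (digit I.denomVal) j k
  | 13 => carry (I.lhs ℓ κ i) j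
  | 14 => carry (I.rhs i) j
  | 15 => I.partialDigit κ i j
  | _ => digit (I.slackVal ℓ κ) i

end ThreadingInstance

/-- The guess consists of the tables for a walk in the instance. -/
structure Stores (c : Ctx) (I : ThreadingInstance) (ℓ : ℕ) (w : ℕ → Fin I.n) (κ : ℕ → ℕ)
    (root : Fin I.n → Fin I.n) (level : Fin I.n → Fin I.n → ℕ) : Prop where
  isWitness : IsWitness I ℓ w κ root level
  x_eq : c.x = I.encode
  bound_eq : c.N = 4 * I.encode.length ^ 3 + 4 * I.encode.length + 10
  -- Entries that do not fit into a block cannot be stored and are exempted; the formula does not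
  -- refer to them.
  tab_eq : ∀ t < 17, ∀ i < c.N, ∀ j < c.N, ∀ k < c.N, I.tables ℓ w κ root level t i j k < c.N →
    c.tab t i j k = I.tables ℓ w κ root level t i j k

namespace Stores

variable (h : Stores c I ℓ w κ root level)
include h

/-- The margin leaves room for table indices slightly beyond the width. -/
theorem length_add_lt : 4 * I.encode.length + 9 < c.N := by
  rw [h.bound_eq]; omega

theorem len_add_lt : ℓ + 9 < c.N := by
  rw [h.bound_eq]
  have := h.isWitness.len_le
  omega

theorem n_lt : I.n + 9 < c.N := (Nat.add_le_add_right h.isWitness.verts_le 9).trans_lt h.len_add_lt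

theorem turns_eq : c.turns = I.turnList.length := by
  have := h.length_add_lt
  have := I.length_toNats_le
  exact h.tab_eq 0 (by omega) 0 (by omega) 0 (by omega) 0 (by omega)
    (show I.turnList.length < c.N by omega)

theorem len_eq : c.len = ℓ := by
  have := h.len_add_lt
  exact h.tab_eq 0 (by omega) 1 (by omega) 0 (by omega) 0 (by omega) (show ℓ < c.N by omega)

theorem width_eq : c.width = 4 * I.encode.length + 4 := by
  have := h.length_add_lt
  exact h.tab_eq 0 (by omega) 2 (by omega) 0 (by omega) 0 (by omega)
    (show 4 * I.encode.length + 4 < c.N by omega)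

theorem pos_eq {k : ℕ} (hk : k < c.N) : c.pos k = (encodeNats (I.toNats.take k)).length := by
  have := h.length_add_lt
  refine h.tab_eq 1 (by omega) k hk 0 (by omega) 0 (by omega) ?_
  have h1 : (encodeNats (I.toNats.take k)).length ≤ I.encode.length := by
    conv_rhs => rw [ThreadingInstance.encode, ← List.take_append_drop k I.toNats,
      encodeNats_append, List.length_append]
    omega
  exact h1.trans_lt (by omega)

theorem flen_eq {k : ℕ} (hk : k < c.N) : c.flen k = Nat.size (I.fieldVal k) := by
  have := h.length_add_lt
  refine h.tab_eq 2 (by omega) k hk 0 (by omega) 0 (by omega) ?_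
  exact (Nat.size_le.2 (I.fieldVal_lt k)).trans_lt (by omega)

theorem digit_lt (a j : ℕ) : digit a j < c.N :=
  (digit_le a j).trans_lt (by have := h.length_add_lt; omega)

theorem bit_eq {k r : ℕ} (hk : k < c.N) (hr : r < c.N) : c.bit k r = digit (I.fieldVal k) r :=
  h.tab_eq 3 (by omega) k hk r hr 0 (by omega) (h.digit_lt _ _)

theorem high_eq {k r : ℕ} (hk : k < c.N) (hr : r < c.N) (hv : I.fieldVal k < c.N) :
    c.high k r = I.fieldVal k / 2 ^ r :=
  h.tab_eq 4 (by omega) k hk r hr 0 (by omega) ((Nat.div_le_self _ _).trans_lt hv)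

theorem walk_eq {i : ℕ} (hi : i < c.N) : c.walk i = w i := by
  have := h.n_lt
  exact h.tab_eq 5 (by omega) i hi 0 (by omega) 0 (by omega) ((w i).2.trans (by omega))

theorem turn_eq {i : ℕ} (hi : i < ℓ) : c.turn i = κ i := by
  have h1 := h.len_add_lt
  have h2 := (h.isWitness.turn i hi).1
  have h3 := I.length_toNats_le
  have h4 := h.length_add_lt
  exact h.tab_eq 6 (by omega) i (by omega) 0 (by omega) 0 (by omega) (show κ i < c.N by omega)

theorem root_eq (v : Fin I.n) : c.root v = root v := by
  have h1 := h.n_lt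
  have e : I.tables ℓ w κ root level 7 v 0 0 = root v := dif_pos v.2
  rw [← e]
  exact h.tab_eq 7 (by omega) v (by omega) 0 (by omega) 0 (by omega) (by rw [e]; omega)

theorem level_eq (v a : Fin I.n) : c.level v a = level v a := by
  have h1 := h.n_lt
  have h2 := h.isWitness.level_le v a
  have e : I.tables ℓ w κ root level 8 v a 0 = level v a := (dif_pos v.2).trans (dif_pos a.2)
  rw [← e]
  exact h.tab_eq 8 (by omega) v (by omega) a (by omega) 0 (by omega) (by rw [e]; omega)

theorem scaled_eq {s j : ℕ} (hs : s < c.N) (hj : j < c.N) :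
    c.scaled s j = digit (I.scaledVal s) j :=
  h.tab_eq 9 (by omega) s hs j hj 0 (by omega) (h.digit_lt _ _)

theorem denom_eq {j : ℕ} (hj : j < c.N) : c.denom j = digit I.denomVal j :=
  h.tab_eq 10 (by omega) j hj 0 (by omega) 0 (by omega) (h.digit_lt _ _)

theorem prodL_eq {s r j : ℕ} (hs : s < c.N) (hr : r < c.N) (hj : j + 1 < c.N) :
    c.prodL s r j = conv (digit (I.fieldVal (I.denIdx s))) (digit (I.scaledVal s)) r j :=
  h.tab_eq 11 (by omega) s hs r hr j (by omega)
    ((conv_le (digit_le _) (digit_le _) _ _).trans_lt hj)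

theorem prodR_eq {s r j : ℕ} (hs : s < c.N) (hr : r < c.N) (hj : j + 1 < c.N) :
    c.prodR s r j = conv (digit (I.fieldVal (I.numIdx s))) (digit I.denomVal) r j :=
  h.tab_eq 12 (by omega) s hs r hr j (by omega)
    ((conv_le (digit_le _) (digit_le _) _ _).trans_lt hj)

theorem carryL_eq {s j : ℕ} (hs : s < c.N) (hj : j ≤ c.width) :
    c.carryL s j = carry (I.lhs ℓ κ s) j := by
  rw [h.width_eq] at hj
  have h1 := h.length_add_lt
  have h2 := h.len_add_lt
  refine h.tab_eq 13 (by omega) s hs j (by omega) 0 (by omega) ?_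
  refine (carry_le (M := max ℓ (4 * I.encode.length + 4) + 1) fun i hi => ?_).trans_lt (by omega)
  rw [ThreadingInstance.lhs]
  split_ifs
  · exact (conv_le (digit_le _) (digit_le _) _ _).trans (by omega)
  · have h3 := I.partialDigit_le κ ℓ i
    have h4 := digit_le (I.slackVal ℓ κ) i
    dsimp only
    omega

theorem carryR_eq {s j : ℕ} (hs : s < c.N) (hj : j ≤ c.width) :
    c.carryR s j = carry (I.rhs s) j := by
  rw [h.width_eq] at hj
  have h1 := h.length_add_lt
  refine h.tab_eq 14 (by omega) s hs j (by omega) 0 (by omega) ?_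
  refine (carry_le (M := 4 * I.encode.length + 4) fun i hi => ?_).trans_lt (by omega)
  rw [ThreadingInstance.rhs]
  split_ifs
  · exact (conv_le (digit_le _) (digit_le _) _ _).trans (by omega)
  · exact (digit_le _ _).trans (by omega)

theorem partialSum_eq {i j : ℕ} (hi : i ≤ ℓ) (hj : j < c.N) :
    c.partialSum i j = I.partialDigit κ i j := by
  have h1 := h.len_add_lt
  exact h.tab_eq 15 (by omega) i (by omega) j hj 0 (by omega)
    ((I.partialDigit_le κ i j).trans_lt (by omega))

theorem slack_eq {j : ℕ} (hj : j < c.N) : c.slack j = digit (I.slackVal ℓ κ) j :=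
  h.tab_eq 16 (by omega) j hj 0 (by omega) 0 (by omega) (h.digit_lt _ _)

theorem verts_eq : c.verts = I.n := by
  have h1 := h.n_lt
  exact (h.high_eq (k := 0) (by omega) (by omega) (show I.n < c.N by omega)).trans (Nat.div_one _)

theorem edges_eq : c.edges = I.edgeList.length := by
  have h1 := h.length_add_lt
  have h2 := I.length_toNats_le
  rw [ThreadingInstance.base] at h2
  exact (h.high_eq (k := 3) (by omega) (by omega)
    (show I.edgeList.length < c.N by omega)).trans (Nat.div_one _)

theorem base_eq : c.base = I.base := by rw [Ctx.base, h.edges_eq, ThreadingInstance.base]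

theorem fields_eq : c.fields = I.toNats.length := by
  rw [Ctx.fields, h.base_eq, h.turns_eq, I.length_toNats]

theorem goodHigh {k : ℕ} (hk : k < c.N) (hv : I.fieldVal k < c.N) : c.GoodHigh k := by
  have h1 := h.length_add_lt
  have h2 := h.width_eq
  refine ⟨?_, fun r hr hrw => ?_⟩
  · rw [h.high_eq hk (by omega) hv, Nat.div_eq_of_lt]
    exact (I.fieldVal_lt k).trans_le (Nat.pow_le_pow_right two_pos (by omega))
  · rw [h.high_eq hk hr hv, h.high_eq hk (by omega) hv, h.bit_eq hk hr]
    exact div_two_pow_eq _ _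

theorem edge_eq {e : ℕ} (he : e < I.edgeList.length) :
    c.edge 0 e = I.edgeList[e].1 ∧ c.edge 1 e = I.edgeList[e].2 ∧
      c.GoodHigh (4 + 2 * e + 0) ∧ c.GoodHigh (4 + 2 * e + 1) := by
  have h1 := h.length_add_lt
  have h2 := I.length_toNats_le
  have h3 := h.n_lt
  rw [ThreadingInstance.base] at h2
  obtain ⟨e1, e2⟩ := I.fieldVal_edge he
  have l1 : I.fieldVal (4 + 2 * e + 0) < c.N := by rw [e1]; omega
  have l2 : I.fieldVal (4 + 2 * e + 1) < c.N := by rw [e2]; omega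
  refine ⟨?_, ?_, h.goodHigh (by omega) l1, h.goodHigh (by omega) l2⟩
  · rw [Ctx.edge, h.high_eq (by omega) (by omega) l1, e1, pow_zero, Nat.div_one]
  · rw [Ctx.edge, h.high_eq (by omega) (by omega) l2, e2, pow_zero, Nat.div_one]

theorem turnVert_eq {t : ℕ} (ht : t < I.turnList.length) :
    c.turnVert 0 t = I.turnList[t].1 ∧ c.turnVert 1 t = I.turnList[t].2.1 ∧
      c.turnVert 2 t = I.turnList[t].2.2 ∧ c.GoodHigh (c.base + 5 * t + 0) ∧
      c.GoodHigh (c.base + 5 * t + 1) ∧ c.GoodHigh (c.base + 5 * t + 2) := by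
  have h1 := h.length_add_lt
  have h2 := I.length_toNats_le
  have h3 := h.n_lt
  obtain ⟨e1, e2, e3, -⟩ := I.fieldVal_turn ht
  have l1 : I.fieldVal (I.base + 5 * t + 0) < c.N := by rw [e1]; omega
  have l2 : I.fieldVal (I.base + 5 * t + 1) < c.N := by rw [e2]; omega
  have l3 : I.fieldVal (I.base + 5 * t + 2) < c.N := by rw [e3]; omega
  simp only [Ctx.turnVert, h.base_eq]
  refine ⟨?_, ?_, ?_, h.goodHigh (by omega) l1, h.goodHigh (by omega) l2, h.goodHigh (by omega) l3⟩
  · rw [h.high_eq (by omega) (by omega) l1, e1, pow_zero, Nat.div_one]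
  · rw [h.high_eq (by omega) (by omega) l2, e2, pow_zero, Nat.div_one]
  · rw [h.high_eq (by omega) (by omega) l3, e3, pow_zero, Nat.div_one]

theorem adj_iff {u v : ℕ} : c.Adj u v ↔ ∃ a b : Fin I.n, I.G.Adj a b ∧ (a : ℕ) = u ∧ (b : ℕ) = v := by
  have h1 := h.length_add_lt
  have h2 := I.length_toNats_le
  rw [ThreadingInstance.base] at h2
  constructor
  · rintro ⟨e, -, he, h3⟩
    rw [h.edges_eq] at he
    obtain ⟨e1, e2, -⟩ := h.edge_eq he
    have h4 := (I.mem_edgeList.1 (List.getElem_mem he)).2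
    rw [e1, e2] at h3
    rcases h3 with ⟨h3, h5⟩ | ⟨h3, h5⟩
    · exact ⟨_, _, h4, h3, h5⟩
    · exact ⟨_, _, h4.symm, h5, h3⟩
  · rintro ⟨a, b, hab, rfl, rfl⟩
    rcases lt_or_gt_of_ne hab.ne with hlt | hlt
    · obtain ⟨e, he, h3⟩ := List.getElem_of_mem (I.mem_edgeList (p := (a, b)).2 ⟨hlt, hab⟩)
      obtain ⟨e1, e2, -⟩ := h.edge_eq he
      rw [h3] at e1 e2
      exact ⟨e, by omega, by rw [h.edges_eq]; exact he, Or.inl ⟨e1, e2⟩⟩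
    · obtain ⟨e, he, h3⟩ := List.getElem_of_mem (I.mem_edgeList (p := (b, a)).2 ⟨hlt, hab.symm⟩)
      obtain ⟨e1, e2, -⟩ := h.edge_eq he
      rw [h3] at e1 e2
      exact ⟨e, by omega, by rw [h.edges_eq]; exact he, Or.inr ⟨e1, e2⟩⟩

theorem adj_fin {a b : Fin I.n} (hab : I.G.Adj a b) : c.Adj a b :=
  h.adj_iff.2 ⟨a, b, hab, rfl, rfl⟩

theorem goodFields : c.GoodFields := by
  have h1 := h.length_add_lt
  have h2 := length_le_encodeNats I.toNats
  rw [← ThreadingInstance.encode] at h2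
  have h3 := h.width_eq
  have h4 := h.fields_eq
  refine ⟨by omega, by omega, ?_, ?_, fun k hk hkf => ?_⟩
  · rw [h.pos_eq (by omega)]; rfl
  · rw [h.pos_eq (by omega), h4, List.take_length, Ctx.inp, h.x_eq,
      List.getElem?_eq_none (by rfl)]
    rfl
  · rw [h4] at hkf
    have e1 : I.toNats.take (k + 1) = I.toNats.take k ++ [I.fieldVal k] := by
      rw [List.take_succ_eq_append_getElem hkf, ThreadingInstance.fieldVal,
        List.getD_eq_getElem _ _ hkf]
    -- The input is split around field `k`: the earlier fields, its bits, the separator, and the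
    -- rest.
    have e2 : c.x = encodeNats (I.toNats.take k) ++ (((List.range (Nat.size (I.fieldVal k))).map
        fun j => some (digit (I.fieldVal k) j == 1)) ++
        none :: encodeNats (I.toNats.drop (k + 1))) := by
      rw [h.x_eq, ThreadingInstance.encode]
      conv_lhs => rw [← List.take_append_drop (k + 1) I.toNats, e1]
      rw [encodeNats_append, encodeNats_append, encodeNats_cons, bits_eq_map, List.map_map]
      simp [encodeNats, Function.comp_def]
    have e3 (r : ℕ) : c.inp (c.pos k + r) = symCode ((((List.range (Nat.size (I.fieldVal k))).map
        fun j => some (digit (I.fieldVal k) j == 1)) ++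
        none :: encodeNats (I.toNats.drop (k + 1)))[r]?) := by
      rw [Ctx.inp, h.pos_eq hk, e2, List.getElem?_append_right (by omega)]
      congr 2
      omega
    rw [h.flen_eq hk]
    refine ⟨?_, ?_, ?_, fun r hr hrw => ?_⟩
    · rw [h.pos_eq (by omega), h.pos_eq hk, e1, encodeNats_append, encodeNats_cons,
        ← Nat.size_eq_bits_len]
      simp [encodeNats]
      omega
    · rw [e3, List.getElem?_append_right (by simp)]
      simp [symCode]
    · exact (Nat.size_le.2 (I.fieldVal_lt k)).trans (by omega)
    · rw [h.bit_eq hk hr]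
      refine ⟨digit_le _ _, fun hlt => ?_, fun hle => ?_, digit_size⟩
      · rw [e3, List.getElem?_append_left (by simpa using hlt)]
        have := digit_le (I.fieldVal k) r
        simp only [List.getElem?_map, List.getElem?_range hlt, Option.map_some]
        interval_cases digit (I.fieldVal k) r <;> rfl
      · exact digit_eq_zero_of_le (Nat.lt_size_self _) hle

theorem goodGraph : c.GoodGraph := by
  have h1 := h.length_add_lt
  have h2 := I.length_toNats_le
  have h3 := h.n_lt
  have hb := h.base_eq
  rw [ThreadingInstance.base] at h2
  refine ⟨h.goodHigh (by omega) (show I.n < c.N by omega),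
    h.goodHigh (by omega) (show I.edgeList.length < c.N by omega), fun e _ he => ?_,
    fun t _ ht => ?_, ?_, ?_, fun e _ he => ?_, fun t _ ht => ?_,
    fun u _ v _ x _ hux huv hvx => ?_⟩
  · rw [h.edges_eq] at he
    exact (h.edge_eq he).2.2
  · rw [h.turns_eq] at ht
    exact (h.turnVert_eq ht).2.2.2
  · rw [h.verts_eq]
    obtain ⟨v⟩ := I.admissible.1.nonempty
    exact v.pos
  · rw [h.verts_eq]; omega
  · rw [h.edges_eq] at he
    obtain ⟨e1, e2, -⟩ := h.edge_eq he
    rw [e1, e2, h.verts_eq]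
    refine ⟨(I.mem_edgeList.1 (List.getElem_mem he)).1, Fin.is_lt _, fun f _ hf => ?_⟩
    obtain ⟨e3, e4, -⟩ := h.edge_eq (hf.trans he)
    rw [e3, e4]
    exact List.pairwise_iff_getElem.1 I.pairwise_edgeList _ _ _ _ hf
  · rw [h.turns_eq] at ht
    obtain ⟨e1, e2, e3, -⟩ := h.turnVert_eq ht
    obtain ⟨h4, h5, h6⟩ := I.mem_turnList.1 (List.getElem_mem ht)
    rw [e1, e2, e3, h.verts_eq]
    refine ⟨h4, h.adj_fin h5, h.adj_fin h6, fun s _ hs => ?_⟩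
    obtain ⟨e4, e5, e6, -⟩ := h.turnVert_eq (hs.trans ht)
    rw [e4, e5, e6]
    exact List.pairwise_iff_getElem.1 I.pairwise_turnList _ _ _ _ hs
  · obtain ⟨a, b, hab, rfl, rfl⟩ := h.adj_iff.1 huv
    obtain ⟨b', d, hbd, e, rfl⟩ := h.adj_iff.1 hvx
    obtain rfl := Fin.ext e
    obtain ⟨t, ht, e⟩ := List.getElem_of_mem (I.mem_turnList (t := (a, b', d)).2 ⟨hux, hab, hbd⟩)
    obtain ⟨e1, e2, e3, -⟩ := h.turnVert_eq ht
    rw [e] at e1 e2 e3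
    exact ⟨t, by omega, by rw [h.turns_eq]; exact ht, e1, e2, e3⟩

theorem goodWalk : c.GoodWalk := by
  have h1 := h.len_add_lt
  have h3 := h.n_lt
  have hw := h.isWitness
  have hl := h.len_eq
  refine ⟨?_, ?_, ?_, ?_, fun i _ hi => ?_, fun e _ he => ?_, fun v _ hv => ?_⟩
  · rw [hl]; exact hw.len_pos
  · omega
  · rw [hl, h.walk_eq (by omega), h.walk_eq (by omega), hw.walk_len]
  · rw [hl, h.walk_eq (by omega), h.walk_eq (by omega), hw.walk_len_succ]
  · rw [hl] at hi
    obtain ⟨ht, e⟩ := hw.turn i hi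
    obtain ⟨e1, e2, e3, -⟩ := h.turnVert_eq ht
    rw [h.walk_eq (by omega), h.walk_eq (by omega), h.walk_eq (by omega), h.turn_eq hi, h.turns_eq,
      e1, e2, e3]
    refine ⟨h.adj_fin (hw.adj i hi), fun h4 => hw.ne i hi (Fin.ext h4), ht, ?_, ?_⟩
    · rcases e with e | e <;> rw [e]
    · rcases e with e | e <;> rw [e] <;> simp
  · rw [h.edges_eq] at he
    obtain ⟨e1, e2, -⟩ := h.edge_eq he
    obtain ⟨i, hi, h4⟩ := hw.edges _ _ (I.mem_edgeList.1 (List.getElem_mem he)).2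
    refine ⟨i, by omega, by omega, ?_⟩
    rw [e1, e2, h.walk_eq (by omega), h.walk_eq (by omega)]
    exact h4.imp (fun h => ⟨congrArg _ h.1, congrArg _ h.2⟩) fun h => ⟨congrArg _ h.1, congrArg _ h.2⟩
  · rw [h.verts_eq] at hv
    obtain ⟨v, rfl⟩ : ∃ a : Fin I.n, (a : ℕ) = v := ⟨⟨v, hv⟩, rfl⟩
    rw [h.root_eq]
    refine ⟨?_, h.adj_fin (hw.root_adj v), fun a _ hva => ?_⟩
    · obtain ⟨i, hi, e⟩ := hw.verts v
      exact ⟨i, by omega, by omega, by rw [h.walk_eq (by omega), e]⟩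
    · obtain ⟨v', a, hadj, e, rfl⟩ := h.adj_iff.1 hva
      obtain rfl := Fin.ext e
      refine (hw.level_spec v' a hadj).imp (congrArg _) ?_
      rintro ⟨i, hi, e1, h4⟩
      refine ⟨i, by omega, by omega, ?_⟩
      rw [h.walk_eq (by omega), h.walk_eq (by omega), h.walk_eq (by omega), h.level_eq, h.level_eq,
        h.level_eq, e1]
      exact ⟨rfl, h4.imp (fun h => ⟨congrArg _ h.1, h.2⟩) fun h => ⟨congrArg _ h.1, h.2⟩⟩

/-- Two kinds of equations: for `s` up to the number of turns, denominator times scaled cost equals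
numerator times common denominator; beyond that, cost plus slack equals the bound. The upper bound
makes the last carry vanish. -/
theorem binVal_lhs (s : ℕ) :
    binVal c.width (I.lhs ℓ κ s) = binVal c.width (I.rhs s) ∧
      binVal c.width (I.lhs ℓ κ s) < 2 ^ c.width := by
  have hw := h.width_eq
  have hX : ∀ k ≤ c.width, 2 ^ k ≤ 2 ^ c.width := fun k hk => Nat.pow_le_pow_right two_pos hk
  have hv (k) := (I.fieldVal_lt k).trans_le (hX _ (by omega))
  have hsc (s) := (I.scaledVal_lt s).trans_le (hX _ (by omega))
  have hd : I.denomVal < 2 ^ (I.encode.length + 1) :=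
    I.denomVal_le.trans_lt (Nat.pow_lt_pow_right one_lt_two (Nat.lt_succ_self _))
  rw [ThreadingInstance.lhs, ThreadingInstance.rhs]
  split_ifs with hst
  · rw [binVal_conv (fun _ => digit_eq_zero_of_le (I.fieldVal_lt _))
        (fun _ => digit_eq_zero_of_le (I.scaledVal_lt _)) (by omega),
      binVal_conv (fun _ => digit_eq_zero_of_le (I.fieldVal_lt _))
        (fun _ => digit_eq_zero_of_le hd) (by omega),
      binVal_digit (hv _), binVal_digit (hv _), binVal_digit (hsc _),
      binVal_digit (hd.trans_le (hX _ (by omega)))]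
    refine ⟨I.mul_scaledVal hst, ?_⟩
    refine (Nat.mul_lt_mul'' (I.fieldVal_lt _) (I.scaledVal_lt _)).trans_le ?_
    rw [← pow_add]
    exact hX _ (by omega)
  · have e : ∀ i, binVal c.width (I.partialDigit κ i) =
        ∑ a ∈ Finset.range i, I.scaledVal (κ a) := by
      intro i
      induction i with
      | zero => exact binVal_zero fun _ _ => rfl
      | succ i ih =>
        rw [Finset.sum_range_succ, ← ih, ← binVal_digit (hsc (κ i)), ← binVal_add]
        exact binVal_congr fun j _ => Finset.sum_range_succ _ _
    have hle := I.sum_scaledVal_le h.isWitness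
    rw [binVal_add, e, binVal_digit (hsc _), binVal_digit, ThreadingInstance.slackVal,
      Nat.add_sub_cancel' hle]
    · exact ⟨rfl, hsc _⟩
    · exact (Nat.sub_le _ _).trans_lt (hsc _)

theorem goodCarry {s : ℕ} (hs : s ≤ I.turnList.length + 1) {f g : ℕ → ℕ}
    (hf : ∀ j < c.width, f j = I.lhs ℓ κ s j) (hg : ∀ j < c.width, g j = I.rhs s j) :
    c.GoodCarry s f g := by
  have h1 := h.length_add_lt
  have h2 := I.length_toNats_le
  obtain ⟨h3, h4⟩ := h.binVal_lhs s
  refine ⟨?_, ?_, ?_, ?_, fun j _ hj => ?_⟩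
  · rw [h.carryL_eq (by omega) (by omega), carry_zero]
  · rw [h.carryR_eq (by omega) (by omega), carry_zero]
  · rw [h.carryL_eq (by omega) le_rfl, carry_last h4]
  · rw [h.carryR_eq (by omega) le_rfl, carry_last (h3 ▸ h4)]
  · rw [h.carryL_eq (by omega) (by omega), h.carryR_eq (by omega) (by omega),
      h.carryL_eq (by omega) (by omega), h.carryR_eq (by omega) (by omega), hf j hj, hg j hj]
    exact carry_step h3 hj

theorem goodCost {s : ℕ} (hs : s ≤ I.turnList.length) : c.GoodCost s (I.numIdx s) (I.denIdx s) := by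
  have h1 := h.length_add_lt
  have h2 := I.length_toNats_le
  have h3 := I.numIdx_lt hs
  have h4 := I.denIdx_lt hs
  have hw := h.width_eq
  have hd : I.denomVal < 2 ^ (I.encode.length + 1) :=
    I.denomVal_le.trans_lt (Nat.pow_lt_pow_right one_lt_two (Nat.lt_succ_self _))
  -- Both factors have bounded length, so the rows of the multiplication scheme vanish in high
  -- places.
  have zL {r j : ℕ} (hrj : 3 * I.encode.length ≤ r + j + 1) :
      conv (digit (I.fieldVal (I.denIdx s))) (digit (I.scaledVal s)) r j = 0 :=
    conv_eq_zero (fun _ => digit_eq_zero_of_le (I.fieldVal_lt _))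
      (fun _ => digit_eq_zero_of_le (I.scaledVal_lt _)) (by omega)
  have zR {r j : ℕ} (hrj : 2 * I.encode.length + 1 ≤ r + j + 1) :
      conv (digit (I.fieldVal (I.numIdx s))) (digit I.denomVal) r j = 0 :=
    conv_eq_zero (fun _ => digit_eq_zero_of_le (I.fieldVal_lt _))
      (fun _ => digit_eq_zero_of_le hd) (by omega)
  refine ⟨?_, fun j _ hj => ?_, fun r _ hr => ⟨?_, ?_, fun j _ hj => ⟨fun hj' => ⟨?_, ?_⟩,
    fun hj' => ⟨?_, ?_⟩⟩⟩, ?_⟩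
  · have h5 := Nat.size_pos.2 (I.fieldVal_denIdx_pos hs)
    have h6 := Nat.size_le.2 (I.fieldVal_lt (I.denIdx s))
    -- The leading digit shows that the denominator is positive.
    refine ⟨Nat.size (I.fieldVal (I.denIdx s)) - 1, by omega, by omega, ?_⟩
    rw [h.bit_eq (by omega) (by omega)]
    exact digit_size (by omega)
  · rw [h.prodL_eq (by omega) (by omega) (by omega), h.prodR_eq (by omega) (by omega) (by omega)]
    exact ⟨zL (by omega), zR (by omega)⟩
  · rw [h.prodL_eq (by omega) (by omega) (by omega), h.bit_eq (by omega) (by omega),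
      h.scaled_eq (by omega) (by omega), conv_zero]
  · rw [h.prodR_eq (by omega) (by omega) (by omega), h.bit_eq (by omega) (by omega),
      h.denom_eq (by omega), conv_zero]
  · rw [h.prodL_eq (by omega) (by omega) (by omega), h.prodL_eq (by omega) (by omega) (by omega),
      h.bit_eq (by omega) (by omega), h.scaled_eq (by omega) (by omega), conv_succ]
  · rw [h.prodR_eq (by omega) (by omega) (by omega), h.prodR_eq (by omega) (by omega) (by omega),
      h.bit_eq (by omega) (by omega), h.denom_eq (by omega), conv_succ]
  · rw [h.prodL_eq (by omega) (by omega) (by omega), zL (by omega)]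
  · rw [h.prodR_eq (by omega) (by omega) (by omega), zR (by omega)]
  · refine h.goodCarry (by omega) (fun j hj => ?_) fun j hj => ?_
    · rw [h.prodL_eq (by omega) (by omega) (by omega), ThreadingInstance.lhs, if_pos hs]
    · rw [h.prodR_eq (by omega) (by omega) (by omega), ThreadingInstance.rhs, if_pos hs]

theorem goodCosts : c.GoodCosts := by
  have h1 := h.length_add_lt
  have h2 := I.length_toNats_le
  have h3 := h.len_add_lt
  have hw := h.width_eq
  have hl := h.len_eq
  have ht := h.turns_eq
  refine ⟨by omega, ?_, ?_, fun t _ htt => ?_, fun j hj _ => ?_, fun i _ hi j hj _ => ?_, ?_⟩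
  · have h5 := Nat.size_pos.2 I.denomVal_pos
    have h6 := Nat.size_le.2 (I.denomVal_le.trans_lt
      (Nat.pow_lt_pow_right one_lt_two (Nat.lt_succ_self I.encode.length)))
    refine ⟨Nat.size I.denomVal - 1, by omega, by omega, ?_⟩
    rw [h.denom_eq (by omega), digit_size (by omega)]
    exact one_ne_zero
  · have := h.goodCost le_rfl
    rwa [I.numIdx_last, I.denIdx_last, ← ht] at this
  · rw [ht] at htt
    have := h.goodCost htt.le
    rwa [I.numIdx_turn htt, I.denIdx_turn htt, ← h.base_eq] at this
  · rw [h.partialSum_eq (Nat.zero_le _) hj]; rfl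
  · rw [hl] at hi
    have := (h.isWitness.turn i hi).1
    rw [h.partialSum_eq hi hj, h.partialSum_eq hi.le hj, h.turn_eq hi, h.scaled_eq (by omega) hj]
    exact Finset.sum_range_succ _ _
  · rw [ht, hl]
    refine h.goodCarry le_rfl (fun j hj => ?_) fun j hj => ?_
    · rw [h.partialSum_eq le_rfl (by omega), h.slack_eq (by omega), ThreadingInstance.lhs,
        if_neg (by omega)]
    · rw [h.scaled_eq (by omega) (by omega), ThreadingInstance.rhs, if_neg (by omega)]

theorem good : c.Good := ⟨h.goodFields, h.goodGraph, h.goodWalk, h.goodCosts⟩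

end Stores

theorem exists_good {x : List (Option Bool)} (hx : x ∈ decisionThreading) :
    ∃ N R, N = 4 * x.length ^ 3 + 4 * x.length + 10 ∧ R.length = 17 * N ^ 4 ∧
      (Ctx.mk x R N).Good := by
  obtain ⟨I, rfl, hI⟩ := hx
  obtain ⟨ℓ, w, κ, root, level, hwit⟩ := hI.exists_isWitness
  obtain ⟨N, hN⟩ : ∃ N, N = 4 * I.encode.length ^ 3 + 4 * I.encode.length + 10 := ⟨_, rfl⟩
  -- Entries that are too large are replaced by `0`, as every stored value has to be below `N`.
  obtain ⟨R, hR, htab⟩ := exists_tab I.encode (N := N) (C := 17) (f := fun t i j k =>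
    if I.tables ℓ w κ root level t i j k < N then I.tables ℓ w κ root level t i j k else 0)
    fun t _ i _ j _ k _ => by split_ifs <;> omega
  exact ⟨N, R, hN, hR, Stores.good ⟨hwit, rfl, hN, fun t ht i hi j hj k hk hlt =>
    (htab t ht i hi j hj k hk).trans (if_pos hlt)⟩⟩

/-- The guessed number is cubic in the input length, and `17` tables of `N ^ 3` blocks of length `N`
make up the guessed string. -/
theorem inNP_decisionThreading : InNP decisionThreading := by
  have hN : PolyBounded fun X => 4 * X ^ 3 + 4 * X + 10 :=
    (((PolyBounded.const 4).mul (PolyBounded.id.pow 3)).add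
      ((PolyBounded.const 4).mul .id)).add (.const 10)
  refine inNP_of_isFml Ctx.isFml_good (hN.add ((PolyBounded.const 17).mul (hN.pow 4)))
    (fun x hx => ?_) fun c h => h.mem_decisionThreading
  obtain ⟨N, R, rfl, hR, h⟩ := exists_good hx
  exact ⟨_, R, by omega, by omega, h⟩

end Completeness

end Threading

theorem mainTheorem9 :
    Threading.InNP Threading.decisionThreading ∧
    ∃ C : ℕ, ∀ (V : Type*) [Fintype V] [DecidableEq V] (G : SimpleGraph V),
      Threading.Admissible G →
      ∀ (α : Sym2 (Sym2 V) → ℝ≥0) (T : List V), Threading.IsThreading G T →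
        ∃ T' : List V,
          Relation.ReflTransGen (Threading.DeletesRedundantCycle G) T T' ∧
          Threading.IsThreading G T' ∧
          Threading.turnCost α T' ≤ Threading.turnCost α T ∧
          (∀ e ∈ G.edgeSet, Threading.traversals T' e ≤ C * G.edgeSet.ncard ^ 2) ∧
          T'.length ≤ C * G.edgeSet.ncard ^ 3 := by
  refine ⟨Threading.inNP_decisionThreading, 4, fun V _ _ G hG α T hT => ?_⟩
  obtain ⟨T', h1, h2, h3, h4⟩ := hT.exists_short hG
  -- The linear bound `4m` is at most `4m²` because an edge exists.
  have key : ∀ e ∈ G.edgeSet, Threading.traversals T' e ≤ 4 * G.edgeSet.ncard ^ 2 := by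
    intro e he
    have hm : 1 ≤ G.edgeSet.ncard := (Set.ncard_pos (Set.toFinite _)).2 ⟨e, he⟩
    have := h4 e he
    nlinarith
  exact ⟨T', h1, h2, h3 α, key, (h2.length_le key).trans_eq (by ring)⟩
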